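/- Let $A=(a_0,\dots,a_5,\eta,t)\in\mathbb C^8$ with $a_0+\dots+a_5=1$, $t\neq 0,1$, and such that no partial sum $a_i+a_{i+1}+\dots+a_{i+l-1}$ with $1\le l\le 5$ is an integer (indices are modulo $6$ throughout). Write $Q_j=1/q_j$, $R_j=1/r_j$, and let $\mathcal X_A$ be the variety obtained from $(\mathbb P^1)^4$, with affine coordinates $(q_1,q_2,r_1,r_2)$, by blowing up successively along the closures of $$\begin{aligned} &C_1: q_1=r_1=0,\quad C_2: Q_1=r_1+a_1=0,\quad C_3: q_2=r_2=0,\quad C_4: Q_2=r_2+a_5=0,\\ &C_5: q_1=q_2=r_1+r_2-a_3+\eta=0,\quad C_6: Q_1=Q_2=r_1+r_2+\eta=0,\\ &C_7: q_1-t=R_1=0,\quad C_8: u_7=v_7-a_2t=0,\ \text{where } (u_7,v_7)=(R_1,(q_1-t)/R_1),\\ &C_9: q_2-1=R_2=0,\quad C_{10}: u_9=v_9-a_4=0,\ \text{where } (u_9,v_9)=(R_2,(q_2-1)/R_2),\\ &C_{11}: q_1-q_2=R_1=R_2=0,\quad C_{12}: u=v+1=w-a_0q_2=0,\ \text{where }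 (u,v,w)=(R_1,R_2/R_1,(q_1-q_2)/R_1). \end{aligned}$$ Then $\operatorname{Pic}\mathcal X_A\cong H^2(\mathcal X_A,\mathbb Z)$ is free on the classes $\mathcal H_{q_1},\mathcal H_{q_2},\mathcal H_{r_1},\mathcal H_{r_2}$ of the total transforms of the coordinate hyperplanes and the classes $\mathcal E_1,\dots,\mathcal E_{12}$ of the total transforms of the exceptional divisors; with these bases the groups $\operatorname{Pic}\mathcal X_A$ for different $A$ are identified. Let $H_2$ have the basis $h_{q_1},h_{q_2},h_{r_1},h_{r_2},e_1,\dots,e_{12}$ with the pairing $\langle\mathcal H_i,h_j\rangle=\delta_{ij}$, $\langle\mathcal E_k,e_l\rangle=-\delta_{kl}$, $\langle\mathcal H_i,e_k\rangle=\langle\mathcal E_k,h_i\rangle=0$. Put $$\begin{aligned} &\alpha_0=\mathcal H_{q_1}+\mathcal H_{q_2}-\mathcal E_5-\mathcal E_6-\mathcal E_{11}-\mathcal E_{12},\quad \alpha_1=\mathcal H_{r_1}-\mathcal E_1-\mathcal E_2,\quad \alpha_2=\mathcal H_{q_1}-\mathcal E_7-\mathcal E_8,\\ &\alpha_3=\mathcal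 H_{r_1}+\mathcal H_{r_2}-\mathcal E_5-\mathcal E_6-\mathcal E_{11}-\mathcal E_{12},\quad \alpha_4=\mathcal H_{q_2}-\mathcal E_9-\mathcal E_{10},\quad \alpha_5=\mathcal H_{r_2}-\mathcal E_3-\mathcal E_4,\\ &\check\alpha_0=h_{r_1}+h_{r_2}-e_{11}-e_{12},\quad \check\alpha_1=h_{q_1}-e_1-e_2,\quad \check\alpha_2=h_{r_1}-e_7-e_8,\\ &\check\alpha_3=h_{q_1}+h_{q_2}-e_5-e_6,\quad \check\alpha_4=h_{r_2}-e_9-e_{10},\quad \check\alpha_5=h_{q_2}-e_3-e_4, \end{aligned}$$ $\delta=\sum_i\alpha_i$ and $\check\delta=\sum_i\check\alpha_i$. Let $s_i$ act on parameters by $a_i\mapsto -a_i$, $a_{i\pm1}\mapsto a_{i\pm1}+a_i$, $\eta\mapsto\eta+(-1)^ia_i$, fixing the other parameters, and let $s_i:\mathcal X_A\dashrightarrow\mathcal X_{s_i(A)}$ be the birational map that changes the following coordinates and fixes the others: $$\begin{aligned} s_0:&\ \bar r_1=r_1-\tfrac{a_0q_1}{q_1-q_2},\ \bar r_2=r_2+\tfrac{a_0q_2}{q_1-q_2};\qquad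 s_1:\ \bar q_1=q_1(1+\tfrac{a_1}{r_1}),\ \bar r_1=r_1+a_1;\\ s_2:&\ \bar r_1=r_1-\tfrac{a_2q_1}{q_1-t};\qquad s_3:\ \bar q_j=q_j+\tfrac{a_3q_j}{r_1+r_2-a_3+\eta}\ (j=1,2);\\ s_4:&\ \bar r_2=r_2-\tfrac{a_4q_2}{q_2-1};\qquad s_5:\ \bar q_2=q_2(1+\tfrac{a_5}{r_2}),\ \bar r_2=r_2+a_5 . \end{aligned}$$ Fix $i$ and let $T=T_{\alpha_i}=s_{i+1}\circ s_{i+2}\circ s_{i+3}\circ s_{i+4}\circ s_{i+5}\circ s_{i+4}\circ s_{i+3}\circ s_{i+2}\circ s_{i+1}\circ s_i$, where each factor is taken at the parameters produced by the preceding ones. The $n$-th iterate $T^n:\mathcal X_A\dashrightarrow\mathcal X_{T^n(A)}$ is understood in the same way. Then: (1) $\delta=-K_{\mathcal X_{T^n(A)}}$ for all $n\ge 0$. The map $T$ is a pseudo-isomorphism (a birational map that induces a bijection of prime divisors), and for all $D$ $$T^*(D)=D+\langle D,\check\delta\rangle\alpha_i+\Bigl(\langle D,\check\delta\rangle+\tfrac12\langle\alpha_i,\check\alpha_i\rangle\langle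 D,\check\alpha_i\rangle\Bigr)\delta .$$ In particular $T^*(\alpha_i)=\alpha_i+2\delta$, $T^*(\alpha_{i\pm1})=\alpha_{i\pm1}-\delta$, and $T^*(\alpha_j)=\alpha_j$ for the other $j$. (2) For every $n\ge0$, $T^n$ is a pseudo-isomorphism, and for all $D$ $$(T^n)^*(D)=D+n\langle D,\check\delta\rangle\alpha_i+\Bigl(n^2\langle D,\check\delta\rangle+\tfrac n2\langle\alpha_i,\check\alpha_i\rangle\langle D,\check\alpha_i\rangle\Bigr)\delta .$$ (3) For all $x,y\in\{q_1,q_2,r_1,r_2\}$ and $n\ge 0$, the degree with respect to $y$ (the maximum of the degrees in $y$ of numerator and denominator in lowest terms) of the component $\bar x$ of $T^n$ equals the coefficient of $\mathcal H_y$ in $(T^n)^*(\mathcal H_x)$ given by (2). It grows quadratically: it is bounded above and below by positive constant multiples of $n^2$ for all large $n$. -/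

import Mathlib

open MvPolynomial

noncomputable section

namespace FST

/-! ## Parameters, rational functions and birational maps -/

/-- The parameters `A = (a₀, …, a₅, η, t)`; indices of the `aᵢ` are residues modulo 6. -/
structure Params where
  a : Fin 6 → ℂ
  η : ℂ
  t : ℂ

/-- The normalisation `a₀ + ⋯ + a₅ = 1`, the condition `t ≠ 0, 1`, and genericity: no cyclically
consecutive partial sum `aᵢ + aᵢ₊₁ + ⋯ + aᵢ₊ₗ₋₁` with `1 ≤ l ≤ 5` is an integer. Since the `aᵢ` sum
to `1`, the last condition says that no real root of the affine root system of type `A₅` takes the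
value zero at `(a₀, …, a₅)`. -/
structure Params.Generic (A : Params) : Prop where
  sum_eq_one : ∑ i, A.a i = 1
  t_ne_zero : A.t ≠ 0
  t_ne_one : A.t ≠ 1
  sum_ne_int : ∀ (i : Fin 6) (l : ℕ), 1 ≤ l → l ≤ 5 →
    ∀ m : ℤ, ∑ k ∈ Finset.range l, A.a (i + Fin.ofNat 6 k) ≠ (m : ℂ)

/-- The polynomial ring `ℂ[q₁, q₂, r₁, r₂]`. -/
abbrev Poly := MvPolynomial (Fin 4) ℂ

/-- The field of rational functions `ℂ(q₁, q₂, r₁, r₂)`. -/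
abbrev RatFun := FractionRing Poly

/-- The coordinate functions; `x 0, x 1, x 2, x 3` are `q₁, q₂, r₁, r₂`. -/
def x (j : Fin 4) : RatFun := algebraMap Poly RatFun (X j)

/-- A complex number as a constant rational function. -/
def const (c : ℂ) : RatFun := algebraMap ℂ RatFun c

open Classical in
/-- The comorphism `f ↦ f(y₀, y₁, y₂, y₃)` of the dominant rational map `(y₀, y₁, y₂, y₃)` of `ℂ⁴`
to itself, where dominance means that the `yⱼ` are algebraically independent. (A tuple that is not
dominant gets the identity; all tuples used below are birational.) -/
def subst (y : Fin 4 → RatFun) : RatFun →ₐ[ℂ] RatFun :=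
  if h : Function.Injective (aeval y : Poly →ₐ[ℂ] RatFun) then IsFractionRing.liftAlgHom h
  else AlgHom.id ℂ RatFun

/-- The degree of a rational function with respect to the `k`-th variable: the maximum of the
degrees of numerator and denominator in lowest terms. -/
def degIn (k : Fin 4) (f : RatFun) : ℕ :=
  max (degreeOf k (IsFractionRing.num Poly f)) (degreeOf k (IsFractionRing.den Poly f : Poly))

/-! ## The Bäcklund transformations and the translation -/

/-- Action of `sᵢ` on the parameters: `aᵢ ↦ -aᵢ`, `aᵢ±₁ ↦ aᵢ±₁ + aᵢ`, `η ↦ η + (-1)ⁱ aᵢ`. -/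
def sParam (i : Fin 6) (A : Params) : Params where
  a := fun j =>
    if j = i then -A.a i
    else if j = i + 1 ∨ j = i - 1 then A.a j + A.a i
    else A.a j
  η := A.η + (-1) ^ (i : ℕ) * A.a i
  t := A.t

/-- Action of `sᵢ` on the dependent variables: the values of `(q̄₁, q̄₂, r̄₁, r̄₂)`. -/
def sVar (i : Fin 6) (A : Params) : Fin 4 → RatFun :=
  let q₁ := x 0
  let q₂ := x 1
  let r₁ := x 2
  let r₂ := x 3
  let a : RatFun := const (A.a i)
  match i with
  | 0 => ![q₁, q₂, r₁ - a * q₁ / (q₁ - q₂), r₂ + a * q₂ / (q₁ - q₂)]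
  | 1 => ![q₁ * (1 + a / r₁), q₂, r₁ + a, r₂]
  | 2 => ![q₁, q₂, r₁ - a * q₁ / (q₁ - const A.t), r₂]
  | 3 =>
    let D := r₁ + r₂ - a + const A.η
    ![q₁ + a * q₁ / D, q₂ + a * q₂ / D, r₁, r₂]
  | 4 => ![q₁, q₂, r₁, r₂ - a * q₂ / (q₂ - 1)]
  | 5 => ![q₁, q₂ * (1 + a / r₂), r₁, r₂ + a]

/-- The comorphism of the birational map `sᵢ : 𝒳_A ⇢ 𝒳_{sᵢ(A)}`. -/
def sPull (i : Fin 6) (A : Params) : RatFun →ₐ[ℂ] RatFun := subst (sVar i A)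

/-- The parameters obtained from `A` by applying the transformations of a list, the head first. -/
def wordParam : List (Fin 6) → Params → Params
  | [], A => A
  | i :: l, A => wordParam l (sParam i A)

/-- The comorphism of the composition of the transformations of a list, the head being applied
first; every transformation is taken at the parameters produced by those before it. -/
def wordPull : List (Fin 6) → Params → (RatFun →ₐ[ℂ] RatFun)
  | [], _ => AlgHom.id ℂ RatFun
  | i :: l, A => (sPull i A).comp (wordPull l (sParam i A))

/-- The word of
`T_{αᵢ} = sᵢ₊₁ ∘ sᵢ₊₂ ∘ sᵢ₊₃ ∘ sᵢ₊₄ ∘ sᵢ₊₅ ∘ sᵢ₊₄ ∘ sᵢ₊₃ ∘ sᵢ₊₂ ∘ sᵢ₊₁ ∘ sᵢ`,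
in order of application. -/
def translationWord (i : Fin 6) : List (Fin 6) :=
  [i, i + 1, i + 2, i + 3, i + 4, i + 5, i + 4, i + 3, i + 2, i + 1]

/-- Action of `T_{αᵢ}` on the parameters. -/
def TParam (i : Fin 6) : Params → Params := wordParam (translationWord i)

/-- The comorphism of `T_{αᵢ} : 𝒳_A ⇢ 𝒳_{T(A)}`. -/
def TPull (i : Fin 6) (A : Params) : RatFun →ₐ[ℂ] RatFun := wordPull (translationWord i) A

/-- The comorphism of the `n`-th iterate `𝒳_A ⇢ 𝒳_{T(A)} ⇢ ⋯ ⇢ 𝒳_{Tⁿ(A)}` of `T_{αᵢ}`. -/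
def TPullIter (i : Fin 6) : ℕ → Params → (RatFun →ₐ[ℂ] RatFun)
  | 0, _ => AlgHom.id ℂ RatFun
  | n + 1, A => (TPull i A).comp (TPullIter i n (TParam i A))

/-! ## The variety `𝒳_A` and its Picard group

`𝒳_A` is the blow-up of `(ℙ¹)⁴` along `C₁, …, C₁₂`. It is smooth and projective, so its Picard group
is the group of Weil divisors modulo principal divisors. A prime divisor is given through its order
function `ℂ(q₁, q₂, r₁, r₂) → ℤ`. The prime divisors of `𝒳_A` are the strict transforms of
the irreducible hypersurfaces of `ℂ⁴`, those of the four hyperplanes at infinity of `(ℙ¹)⁴`, and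
those of the twelve exceptional divisors. -/

/-- The order of vanishing of a rational function along the hypersurface `p = 0`, for `p`
irreducible. (The value at `f = 0` is a constant without meaning.) -/
def ordAlong (p : Poly) (f : RatFun) : ℤ :=
  (multiplicity p (IsFractionRing.num Poly f) : ℤ) -
    (multiplicity p (IsFractionRing.den Poly f : Poly) : ℤ)

/-- Index set of the sixteen prime divisors of `𝒳_A` that do not meet `ℂ⁴` in a hypersurface, and
of the bases of the Néron-Severi bilattice: `Sum.inl j` belongs to the variable `x j`, and
`Sum.inr k` to the centre `C_k`, where `k` is a residue modulo 12, so that `C₁₂` has index `0`. -/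
abbrev Comp := Fin 4 ⊕ Fin 12

/-- For every `b : Comp` a chart of `𝒳_A` that meets the `b`-th divisor: the values of
`(q₁, q₂, r₁, r₂)` as rational functions of the chart coordinates `y₀, y₁, y₂, y₃`. At `Sum.inl j`
the `j`-th coordinate is replaced by its inverse. At `Sum.inr k` the chart is the chart `U_k` of
the blow-up along `C_k`. The centres, and the coordinates of `U_k` that are not among
`q₁, q₂, r₁, r₂`, are, with `Qᵢ = 1 / qᵢ` and `Rᵢ = 1 / rᵢ`:

* `C₁ : q₁ = r₁ = 0`; `(y₀, y₂) = (q₁, r₁ / q₁)`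
* `C₂ : Q₁ = r₁ + a₁ = 0`; `(y₀, y₂) = (Q₁, (r₁ + a₁) / Q₁)`
* `C₃ : q₂ = r₂ = 0`; `(y₁, y₃) = (q₂, r₂ / q₂)`
* `C₄ : Q₂ = r₂ + a₅ = 0`; `(y₁, y₃) = (Q₂, (r₂ + a₅) / Q₂)`
* `C₅ : q₁ = q₂ = r₁ + r₂ - a₃ + η = 0`; `(y₀, y₁, y₂) = (q₁, q₂ / q₁, (r₁ + r₂ - a₃ + η) / q₁)`
* `C₆ : Q₁ = Q₂ = r₁ + r₂ + η = 0`; `(y₀, y₁, y₂) = (Q₁, Q₂ / Q₁, (r₁ + r₂ + η) / Q₁)`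
* `C₇ : q₁ - t = R₁ = 0`; `(y₀, y₂) = (v₇, u₇) = ((q₁ - t) / R₁, R₁)`
* `C₈ : u₇ = v₇ - a₂ t = 0`; `(y₀, y₂) = ((v₇ - a₂ t) / u₇, u₇)`
* `C₉ : q₂ - 1 = R₂ = 0`; `(y₁, y₃) = (v₉, u₉) = ((q₂ - 1) / R₂, R₂)`
* `C₁₀ : u₉ = v₉ - a₄ = 0`; `(y₁, y₃) = ((v₉ - a₄) / u₉, u₉)`
* `C₁₁ : q₁ - q₂ = R₁ = R₂ = 0`;
  `(y₀, y₂, y₃) = (w₁₁, u₁₁, v₁₁) = ((q₁ - q₂) / R₁, R₁, R₂ / R₁)`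
* `C₁₂ : u₁₁ = v₁₁ + 1 = w₁₁ - a₀ q₂ = 0`;
  `(y₀, y₂, y₃) = ((w₁₁ - a₀ q₂) / u₁₁, u₁₁, (v₁₁ + 1) / u₁₁)` -/
def chart (A : Params) : Comp → Fin 4 → RatFun
  | Sum.inl j => Function.update x j (x j)⁻¹
  | Sum.inr k =>
    let y₀ := x 0
    let y₁ := x 1
    let y₂ := x 2
    let y₃ := x 3
    let a : Fin 6 → RatFun := fun i => const (A.a i)
    let η : RatFun := const A.η
    let t : RatFun := const A.t
    match k with
    | 1 => ![y₀, y₁, y₀ * y₂, y₃]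
    | 2 => ![y₀⁻¹, y₁, y₀ * y₂ - a 1, y₃]
    | 3 => ![y₀, y₁, y₂, y₁ * y₃]
    | 4 => ![y₀, y₁⁻¹, y₂, y₁ * y₃ - a 5]
    | 5 => ![y₀, y₀ * y₁, y₀ * y₂ - y₃ + a 3 - η, y₃]
    | 6 => ![y₀⁻¹, (y₀ * y₁)⁻¹, y₀ * y₂ - y₃ - η, y₃]
    | 7 => ![t + y₂ * y₀, y₁, y₂⁻¹, y₃]
    | 8 => ![t + y₂ * (a 2 * t + y₂ * y₀), y₁, y₂⁻¹, y₃]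
    | 9 => ![y₀, 1 + y₃ * y₁, y₂, y₃⁻¹]
    | 10 => ![y₀, 1 + y₃ * (a 4 + y₃ * y₁), y₂, y₃⁻¹]
    | 11 => ![y₁ + y₂ * y₀, y₁, y₂⁻¹, (y₂ * y₃)⁻¹]
    | 0 => ![y₁ + y₂ * (a 0 * y₁ + y₂ * y₀), y₁, y₂⁻¹, (y₂ * (y₂ * y₃ - 1))⁻¹]

/-- The coordinate of the chart whose vanishing defines the `b`-th divisor. -/
def chartEq : Comp → Fin 4
  | Sum.inl j => j
  | Sum.inr k =>
    match k with
    | 1 | 2 | 5 | 6 => 0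
    | 3 | 4 => 1
    | 7 | 8 | 11 | 0 => 2
    | 9 | 10 => 3

/-- The order function of the `b`-th divisor: write `f` in the coordinates of the chart and take
the order of vanishing along the coordinate hyperplane that defines the divisor. -/
def boundaryOrd (A : Params) (b : Comp) (f : RatFun) : ℤ :=
  ordAlong (X (chartEq b)) (subst (chart A b) f)

/-- The set of (order functions of) prime divisors of `𝒳_A`. -/
def primeDivisors (A : Params) : Set (RatFun → ℤ) :=
  {v | ∃ p : Poly, Irreducible p ∧ v = ordAlong p} ∪ Set.range (boundaryOrd A)

/-- The group of Weil divisors of `𝒳_A`. -/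
abbrev Div (A : Params) := primeDivisors A →₀ ℤ

/-- The group of principal divisors of `𝒳_A`. -/
def principal (A : Params) : AddSubgroup (Div A) :=
  AddSubgroup.closure {D | ∃ f : RatFun, f ≠ 0 ∧ ∀ v : primeDivisors A, D v = v.1 f}

/-- The Picard group of `𝒳_A`. -/
abbrev Pic (A : Params) := Div A ⧸ principal A

/-- The `b`-th prime divisor, as a divisor. -/
def boundaryDiv (A : Params) (b : Comp) : Div A :=
  Finsupp.single ⟨boundaryOrd A b, Or.inr ⟨b, rfl⟩⟩ 1

/-- The total transform of the hyperplane `x j = ∞` of `(ℙ¹)⁴`, i.e. the divisor of poles of `x j`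
on `𝒳_A`: the hyperplane has the local equation `1 / x j`. Its class is `ℋ_{x j}`. -/
def hyperplaneDiv (A : Params) (j : Fin 4) : Div A :=
  ∑ b : Comp, max 0 (-boundaryOrd A b (x j)) • boundaryDiv A b

/-- The total transform of the exceptional divisor of the blow-up along `C_k`. Its class is `ℰ_k`.
It is the strict transform, except that the centres `C₈`, `C₁₀`, `C₁₂` lie on the exceptional
divisors over `C₇`, `C₉`, `C₁₁`. -/
def exceptionalDiv (A : Params) (k : Fin 12) : Div A :=
  boundaryDiv A (Sum.inr k) +
    if k = 7 ∨ k = 9 ∨ k = 11 then boundaryDiv A (Sum.inr (k + 1)) else 0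

/-- The partial derivative of a rational function. -/
def partialDeriv (j : Fin 4) (f : RatFun) : RatFun :=
  let p := IsFractionRing.num Poly f
  let q : Poly := IsFractionRing.den Poly f
  algebraMap Poly RatFun (pderiv j p * q - p * pderiv j q) / algebraMap Poly RatFun q ^ 2

/-- The divisor on `𝒳_A` of the rational differential form `dq₁ ∧ dq₂ ∧ dr₁ ∧ dr₂`. The form has no
zeros or poles on `ℂ⁴`, and in the `b`-th chart it is the Jacobian determinant times
`dy₀ ∧ dy₁ ∧ dy₂ ∧ dy₃`. -/
def canonicalDiv (A : Params) : Div A :=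
  ∑ b : Comp,
    ordAlong (X (chartEq b)) (Matrix.of fun i j => partialDeriv j (chart A b i)).det •
      boundaryDiv A b

/-- The canonical class `K_{𝒳_A}`. -/
def canonicalClass (A : Params) : Pic A := QuotientAddGroup.mk (canonicalDiv A)

/-! ## Pseudo-isomorphisms and pullback -/

/-- `φ` is the comorphism of a pseudo-isomorphism `f` from `𝒳_A` to `𝒳_B`: the map `f` is birational,
and it induces a bijection from the prime divisors of `𝒳_A` to those of `𝒳_B`; the image of a prime
divisor with order function `v` is the prime divisor with order function `v ∘ φ`. -/
structure IsPseudoIso (A B : Params) (φ : RatFun →ₐ[ℂ] RatFun) : Prop where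
  birational : Function.Bijective φ
  bijOn : Set.BijOn (fun v : RatFun → ℤ => v ∘ φ) (primeDivisors A) (primeDivisors B)

namespace IsPseudoIso

variable {A B : Params} {φ : RatFun →ₐ[ℂ] RatFun}

/-- The pullback of divisors: the multiplicity of `f^*(D)` along a prime divisor is the
multiplicity of `D` along its image. -/
def pullDiv (h : IsPseudoIso A B φ) : Div B →+ Div A :=
  (Finsupp.domCongr (h.bijOn.equiv _).symm : Div B ≃+ Div A).toAddMonoidHom

theorem pullDiv_apply (h : IsPseudoIso A B φ) (D : Div B) (v : primeDivisors A) :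
    h.pullDiv D v = D (h.bijOn.equiv _ v) := by
  simp [pullDiv, Finsupp.equivMapDomain_apply]

theorem apply_ne_zero (h : IsPseudoIso A B φ) {f : RatFun} (hf : f ≠ 0) : φ f ≠ 0 :=
  fun h0 => hf (h.birational.1 (h0.trans (map_zero φ).symm))

theorem equiv_val (h : IsPseudoIso A B φ) (v : primeDivisors A) (f : RatFun) :
    (h.bijOn.equiv _ v).1 f = v.1 (φ f) := rfl

theorem pullDiv_principal (h : IsPseudoIso A B φ) (D : Div B) (f : RatFun)
    (hD : ∀ v : primeDivisors B, D v = v.1 f) (v : primeDivisors A) :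
    h.pullDiv D v = v.1 (φ f) :=
  (h.pullDiv_apply D v).trans ((hD _).trans (h.equiv_val v f))

theorem principal_le (h : IsPseudoIso A B φ) :
    principal B ≤ (principal A).comap h.pullDiv := by
  refine (AddSubgroup.closure_le _).2 ?_
  rintro D ⟨f, hf, hD⟩
  exact AddSubgroup.mem_comap.2
    (AddSubgroup.subset_closure ⟨φ f, h.apply_ne_zero hf, h.pullDiv_principal D f hD⟩)

/-- The pullback `f^* : Pic 𝒳_B → Pic 𝒳_A`. -/
def pull (h : IsPseudoIso A B φ) : Pic B →+ Pic A :=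
  QuotientAddGroup.map _ _ h.pullDiv h.principal_le

end IsPseudoIso

/-! ## The Néron-Severi bilattice and the root system -/

/-- The lattice `H²(𝒳_A, ℤ)`: coordinates in the basis `ℋ_{q₁}, ℋ_{q₂}, ℋ_{r₁}, ℋ_{r₂}, ℰ_k`. -/
abbrev NSLattice := Comp → ℤ

/-- The lattice `H₂(𝒳_A, ℤ)`: coordinates in the basis `h_{q₁}, h_{q₂}, h_{r₁}, h_{r₂}, e_k`. -/
abbrev NSDual := Comp → ℤ

/-- The basis element `ℋ_{x j}` of `H²`, and `h_{x j}` of `H₂`. -/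
def H (j : Fin 4) : Comp → ℤ := Pi.single (Sum.inl j) 1

/-- The basis element `ℰ_k` of `H²`, and `e_k` of `H₂`. -/
def E (k : Fin 12) : Comp → ℤ := Pi.single (Sum.inr k) 1

/-- The intersection form:
`⟨ℋᵢ, hⱼ⟩ = δᵢⱼ`, `⟨ℰ_k, e_l⟩ = -δ_{kl}`, `⟨ℋᵢ, e_k⟩ = ⟨ℰ_k, hᵢ⟩ = 0`. -/
def pairing (D : NSLattice) (d : NSDual) : ℤ :=
  ∑ j, D (Sum.inl j) * d (Sum.inl j) - ∑ k, D (Sum.inr k) * d (Sum.inr k)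

/-- The roots `αᵢ`. -/
def root : Fin 6 → NSLattice
  | 0 => H 0 + H 1 - (E 5 + E 6 + E 11 + E 12)
  | 1 => H 2 - (E 1 + E 2)
  | 2 => H 0 - (E 7 + E 8)
  | 3 => H 2 + H 3 - (E 5 + E 6 + E 11 + E 12)
  | 4 => H 1 - (E 9 + E 10)
  | 5 => H 3 - (E 3 + E 4)

/-- The co-roots `α̌ᵢ`. -/
def coroot : Fin 6 → NSDual
  | 0 => H 2 + H 3 - (E 11 + E 12)
  | 1 => H 0 - (E 1 + E 2)
  | 2 => H 2 - (E 7 + E 8)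
  | 3 => H 0 + H 1 - (E 5 + E 6)
  | 4 => H 3 - (E 9 + E 10)
  | 5 => H 1 - (E 3 + E 4)

/-- The pairing matrix is minus the Cartan matrix; in particular `⟨αᵢ, α̌ᵢ⟩ = -2` is even. -/
theorem pairing_root_coroot_self (i : Fin 6) : pairing (root i) (coroot i) = -2 := by
  decide +revert

/-- `δ = α₀ + ⋯ + α₅`. -/
def δ : NSLattice := ∑ i, root i

/-- `δ̌ = α̌₀ + ⋯ + α̌₅`. -/
def coδ : NSDual := ∑ i, coroot i

/-- The element of `Pic 𝒳_A` with the given coordinates in `ℋ_{q₁}, …, ℋ_{r₂}, ℰ₁, …, ℰ₁₂`. -/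
def toPic (A : Params) (D : NSLattice) : Pic A :=
  ∑ j, D (Sum.inl j) • (QuotientAddGroup.mk (hyperplaneDiv A j) : Pic A) +
    ∑ k, D (Sum.inr k) • (QuotientAddGroup.mk (exceptionalDiv A k) : Pic A)

/-- The right-hand side of the formula for the `n`-th iterate of `T_{αᵢ}`:
`D + n ⟨D, δ̌⟩ αᵢ + (n² ⟨D, δ̌⟩ + (n / 2) ⟨αᵢ, α̌ᵢ⟩ ⟨D, α̌ᵢ⟩) δ`. The division is exact. -/
def kac (i : Fin 6) (n : ℕ) (D : NSLattice) : NSLattice :=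
  D + ((n : ℤ) * pairing D coδ) • root i +
    ((n : ℤ) ^ 2 * pairing D coδ +
      (n : ℤ) * (pairing (root i) (coroot i) / 2) * pairing D (coroot i)) • δ

end FST

end

open FST

open MvPolynomial FST

noncomputable section

namespace FST

/-! ## Shortcuts for instance search -/

-- A prime divisor is recorded by its order function, so every geometric claim becomes an identity
-- between functions on the fixed field `RatFun`. The core is that each generator `sᵢ` is a
-- pseudo-isomorphism that acts on the Picard group as a reflection.
--
-- Along the boundary (four hyperplanes at infinity, twelve exceptional divisors) this is a
-- computation in charts. By `ordAlong_subst`, a map carries the order along `x c = 0` to the order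
-- along `x c' = 0` once its `c'`-th component is `x c` times a generic unit and the other
-- components restrict to a dominant map of hyperplanes; `transition` reduces this to explicit
-- expressions. Every boundary divisor goes to the one with the same label, except for one or two
-- (`moved`). These are exchanged with the hypersurfaces of `ℂ⁴` on which a denominator of `sᵢ` or
-- of its inverse vanishes. Along any other hypersurface `sᵢ` and its inverse are regular, and
-- unique factorisation shows that its image is again a hypersurface (`exists_ordAlong_comp`). The
-- exchange needs `aᵢ ≠ 0`. Genericity supplies this at every stage, because `sᵢ` only permutes six
-- numbers that are distinct modulo the integers.
--
-- Since `ℂ[q₁, q₂, r₁, r₂]` is factorial with constant units, the sixteen boundary classes form a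
-- basis of the Picard group (`exists_sum_bd`, `eq_zero_of_sum_bd`), and passing to total transforms
-- is unitriangular (`toBd_bijective`). The divisor of the equation of an exchanged hypersurface
-- shows that its class is that of its boundary partner plus `αᵢ`. The coefficients of `D` along the
-- exchanged boundary divisors add up to `⟨D, α̌ᵢ⟩` (`sum_moved`), whence the reflection formula
-- `pull_sPull`. The anticanonical class is read off from Jacobians of the charts.
--
-- What remains of the action is linear algebra: ten reflections compose to a Kac translation
-- (`wordReflect_translationWord`), and translations add up (`kac_one_kac`).
--
-- For the degrees, a pseudo-isomorphism pulls the polar divisor of `x j` back to the polar divisor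
-- of the `j`-th component, with no correction term. Moving the finite poles to the boundary by
-- means of the denominator gives, along `x k = ∞`, the coefficient `max (deg num) (deg den)`, so
-- the degree is a lattice coefficient (`degIn_eq`). Its leading term in `n` is `⟨ℋ, δ̌⟩` times a
-- coefficient of `δ`, which is not zero.

local instance : Mul RatFun := inferInstance
local instance : Add RatFun := inferInstance
local instance : Sub RatFun := inferInstance
local instance : Neg RatFun := inferInstance
local instance : Zero RatFun := inferInstance
local instance : One RatFun := inferInstance
local instance : CommRing RatFun := inferInstance
local instance : Ring RatFun := inferInstance
local instance : CommSemiring RatFun := inferInstance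
local instance : Semiring RatFun := inferInstance
local instance : AddCommGroup RatFun := inferInstance
local instance : AddGroup RatFun := inferInstance
local instance : AddMonoid RatFun := inferInstance
local instance : AddCommMonoid RatFun := inferInstance
local instance : Monoid RatFun := inferInstance
local instance : CommMonoid RatFun := inferInstance
local instance : MulZeroClass RatFun := inferInstance
local instance : MulZeroOneClass RatFun := inferInstance
local instance : MulOneClass RatFun := inferInstance
local instance : MonoidWithZero RatFun := inferInstance
local instance : GroupWithZero RatFun := inferInstance
local instance : CommGroupWithZero RatFun := inferInstance
local instance : DivisionRing RatFun := inferInstance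
local instance : DivInvMonoid RatFun := inferInstance
local instance : DivisionMonoid RatFun := inferInstance
local instance : AddZeroClass RatFun := inferInstance
local instance : SubNegMonoid RatFun := inferInstance
local instance : Nontrivial RatFun := inferInstance
local instance : NoZeroDivisors RatFun := inferInstance
local instance : IsDomain RatFun := inferInstance
local instance : CharZero RatFun := inferInstance
local instance : Distrib RatFun := inferInstance
local instance : NonAssocSemiring RatFun := inferInstance
local instance : NonUnitalNonAssocSemiring RatFun := inferInstance

section

/-! ## Order functions -/

theorem algebraMap_poly_ne_zero {p : Poly} (hp : p ≠ 0) : algebraMap Poly RatFun p ≠ 0 := by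
  rwa [Ne, FaithfulSMul.algebraMap_eq_zero_iff]

theorem exists_fraction (f : RatFun) :
    ∃ n d : Poly, d ≠ 0 ∧ f = algebraMap Poly RatFun n / algebraMap Poly RatFun d := by
  obtain ⟨n, d, hd, rfl⟩ := IsFractionRing.div_surjective (A := Poly) f
  exact ⟨n, d, nonZeroDivisors.ne_zero hd, rfl⟩

theorem finiteMultiplicity_of_irreducible {p f : Poly} (hp : Irreducible p) (hf : f ≠ 0) :
    FiniteMultiplicity p f :=
  FiniteMultiplicity.of_not_isUnit hp.not_isUnit hf

theorem multiplicity_mul_of_irreducible {p f g : Poly} (hp : Irreducible p) (hf : f ≠ 0)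
    (hg : g ≠ 0) : multiplicity p (f * g) = multiplicity p f + multiplicity p g :=
  multiplicity_mul hp.prime (finiteMultiplicity_of_irreducible hp (mul_ne_zero hf hg))

theorem num_div_den (f : RatFun) :
    algebraMap Poly RatFun (IsFractionRing.num Poly f) /
      algebraMap Poly RatFun (IsFractionRing.den Poly f : Poly) = f := by
  rw [← IsFractionRing.mk'_eq_div]
  exact IsFractionRing.mk'_num_den Poly f

theorem den_ne_zero (f : RatFun) : (IsFractionRing.den Poly f : Poly) ≠ 0 :=
  nonZeroDivisors.ne_zero (IsFractionRing.den Poly f).2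

theorem num_ne_zero {f : RatFun} (hf : f ≠ 0) : IsFractionRing.num Poly f ≠ 0 := by
  intro h
  apply hf
  rw [← num_div_den f, h, map_zero, zero_div]

theorem num_zero : IsFractionRing.num Poly (0 : RatFun) = 0 := by
  have h := num_div_den 0
  rw [div_eq_zero_iff] at h
  rcases h with h | h
  · simpa [FaithfulSMul.algebraMap_eq_zero_iff] using h
  · exact absurd h (algebraMap_poly_ne_zero (den_ne_zero 0))

theorem isUnit_den_zero : IsUnit (IsFractionRing.den Poly (0 : RatFun) : Poly) := by
  have h := IsFractionRing.num_den_reduced Poly (0 : RatFun)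
  rw [num_zero] at h
  exact isRelPrime_zero_left.1 h

/-- The value is the convention `multiplicity p 0 = 1`, the denominator of `0` being a unit. It
matters that it is the same for all divisors: prime divisors are compared as functions on the whole
field, zero included. -/
theorem ordAlong_zero {p : Poly} (hp : Irreducible p) : ordAlong p 0 = 1 := by
  unfold ordAlong
  rw [num_zero, multiplicity_zero]
  rw [multiplicity_eq_zero.2]
  · simp
  · exact fun h => hp.not_isUnit (isUnit_of_dvd_unit h isUnit_den_zero)

/-- Cross-multiplication with the reduced fraction and additivity of multiplicities at a prime free
the order function from lowest terms. -/
theorem ordAlong_div {p n d : Poly} (hp : Irreducible p) (hn : n ≠ 0) (hd : d ≠ 0) :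
    ordAlong p (algebraMap Poly RatFun n / algebraMap Poly RatFun d) =
      (multiplicity p n : ℤ) - multiplicity p d := by
  set f := algebraMap Poly RatFun n / algebraMap Poly RatFun d with hf
  have hf0 : f ≠ 0 := div_ne_zero (algebraMap_poly_ne_zero hn) (algebraMap_poly_ne_zero hd)
  have h := num_div_den f
  have hf' := hf
  rw [← h, div_eq_div_iff (algebraMap_poly_ne_zero (den_ne_zero f)) (algebraMap_poly_ne_zero hd),
    ← map_mul, ← map_mul] at hf'
  have h2 := FaithfulSMul.algebraMap_injective Poly RatFun hf'
  have h3 := congrArg (multiplicity p) h2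
  rw [multiplicity_mul_of_irreducible hp (num_ne_zero hf0) hd,
    multiplicity_mul_of_irreducible hp hn (den_ne_zero f)] at h3
  unfold ordAlong
  omega

theorem ordAlong_algebraMap {p n : Poly} (hp : Irreducible p) (hn : n ≠ 0) :
    ordAlong p (algebraMap Poly RatFun n) = multiplicity p n := by
  have h := ordAlong_div hp hn (one_ne_zero (α := Poly))
  rw [map_one, div_one, multiplicity_eq_zero.2 (fun h => hp.not_isUnit (isUnit_of_dvd_one h))] at h
  simpa using h

/-- The formal properties of the order function of a prime divisor that do not depend on
additivity. -/
structure IsOrd (w : RatFun → ℤ) : Prop where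
  zero : w 0 = 1
  mul : ∀ {f g : RatFun}, f ≠ 0 → g ≠ 0 → w (f * g) = w f + w g

theorem isOrd_ordAlong {p : Poly} (hp : Irreducible p) : IsOrd (ordAlong p) where
  zero := ordAlong_zero hp
  mul := by
    intro f g hf hg
    obtain ⟨n, d, hd, rfl⟩ := exists_fraction f
    obtain ⟨n', d', hd', rfl⟩ := exists_fraction g
    have hn : n ≠ 0 := by rintro rfl; simp at hf
    have hn' : n' ≠ 0 := by rintro rfl; simp at hg
    rw [div_mul_div_comm, ← map_mul, ← map_mul, ordAlong_div hp hn hd, ordAlong_div hp hn' hd',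
      ordAlong_div hp (mul_ne_zero hn hn') (mul_ne_zero hd hd'),
      multiplicity_mul_of_irreducible hp hn hn', multiplicity_mul_of_irreducible hp hd hd']
    push_cast
    ring

namespace IsOrd

variable {w : RatFun → ℤ}

theorem comp (hw : IsOrd w) (φ : RatFun →ₐ[ℂ] RatFun) : IsOrd (w ∘ φ) where
  zero := by simpa using hw.zero
  mul := by
    intro f g hf hg
    simpa using hw.mul ((map_ne_zero φ).2 hf) ((map_ne_zero φ).2 hg)

theorem one (hw : IsOrd w) : w 1 = 0 := by
  have h := hw.mul (one_ne_zero (α := RatFun)) one_ne_zero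
  rw [mul_one] at h
  omega

theorem inv (hw : IsOrd w) {f : RatFun} (hf : f ≠ 0) : w f⁻¹ = -w f := by
  have h := hw.mul hf (inv_ne_zero hf)
  rw [mul_inv_cancel₀ hf, hw.one] at h
  omega

theorem div (hw : IsOrd w) {f g : RatFun} (hf : f ≠ 0) (hg : g ≠ 0) : w (f / g) = w f - w g := by
  rw [div_eq_mul_inv, hw.mul hf (inv_ne_zero hg), hw.inv hg, sub_eq_add_neg]

theorem pow (hw : IsOrd w) {f : RatFun} (hf : f ≠ 0) (n : ℕ) : w (f ^ n) = n * w f := by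
  induction n with
  | zero => simp [hw.one]
  | succ n ih => rw [pow_succ, hw.mul (pow_ne_zero n hf) hf, ih]; push_cast; ring

theorem zpow (hw : IsOrd w) {f : RatFun} (hf : f ≠ 0) (n : ℤ) : w (f ^ n) = n * w f := by
  cases n with
  | ofNat n => simpa using hw.pow hf n
  | negSucc n =>
    rw [zpow_negSucc, hw.inv (pow_ne_zero _ hf), hw.pow hf, Int.negSucc_eq]
    push_cast; ring

theorem ext_of_poly {w' : RatFun → ℤ} (hw : IsOrd w) (hw' : IsOrd w')
    (h : ∀ n : Poly, n ≠ 0 → w (algebraMap Poly RatFun n) = w' (algebraMap Poly RatFun n)) :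
    w = w' := by
  funext f
  by_cases hf : f = 0
  · rw [hf, hw.zero, hw'.zero]
  obtain ⟨n, d, hd, rfl⟩ := exists_fraction f
  have hn : n ≠ 0 := by rintro rfl; simp at hf
  rw [hw.div (algebraMap_poly_ne_zero hn) (algebraMap_poly_ne_zero hd),
    hw'.div (algebraMap_poly_ne_zero hn) (algebraMap_poly_ne_zero hd), h n hn, h d hd]

/-- An order function that is `1` at an irreducible `p`, and `0` at the polynomials that `p` does
not divide, is the order along `p = 0`. -/
theorem eq_ordAlong (hw : IsOrd w) {p : Poly} (hp : Irreducible p)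
    (h1 : w (algebraMap Poly RatFun p) = 1)
    (h0 : ∀ g : Poly, ¬ p ∣ g → w (algebraMap Poly RatFun g) = 0) : w = ordAlong p := by
  refine hw.ext_of_poly (isOrd_ordAlong hp) fun n hn => ?_
  obtain ⟨k, hk, hk'⟩ := (finiteMultiplicity_of_irreducible hp hn).exists_eq_pow_mul_and_not_dvd
  rw [ordAlong_algebraMap hp hn]
  have hk0 : k ≠ 0 := by rintro rfl; exact hk' (dvd_zero p)
  conv_lhs => rw [hk]
  rw [map_mul, map_pow, hw.mul (pow_ne_zero _ (algebraMap_poly_ne_zero hp.ne_zero))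
    (algebraMap_poly_ne_zero hk0), hw.pow (algebraMap_poly_ne_zero hp.ne_zero), h1, h0 k hk']
  ring

end IsOrd

theorem ordAlong_self {p : Poly} (hp : Irreducible p) :
    ordAlong p (algebraMap Poly RatFun p) = 1 := by
  rw [ordAlong_algebraMap hp hp.ne_zero]
  simp [multiplicity_self]

theorem ordAlong_eq_zero {p g : Poly} (hp : Irreducible p) (h : ¬ p ∣ g) :
    ordAlong p (algebraMap Poly RatFun g) = 0 := by
  rw [ordAlong_algebraMap hp (by rintro rfl; exact h (dvd_zero p)), multiplicity_eq_zero.2 h]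
  rfl

theorem ordAlong_nonneg {p g : Poly} (hp : Irreducible p) :
    0 ≤ ordAlong p (algebraMap Poly RatFun g) := by
  by_cases h : g = 0
  · simp [h, ordAlong_zero hp]
  · rw [ordAlong_algebraMap hp h]; positivity

theorem ordAlong_pos_iff {p g : Poly} (hp : Irreducible p) :
    0 < ordAlong p (algebraMap Poly RatFun g) ↔ p ∣ g := by
  by_cases h : g = 0
  · simp [h, ordAlong_zero hp]
  · rw [ordAlong_algebraMap hp h, Int.natCast_pos, Nat.pos_iff_ne_zero, Ne, multiplicity_eq_zero,
      not_not]

theorem ordAlong_congr {p p' : Poly} (h : Associated p p') : ordAlong p = ordAlong p' := by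
  funext f
  unfold ordAlong
  rw [multiplicity_eq_of_associated_left h, multiplicity_eq_of_associated_left h]

theorem x_ne_zero (j : Fin 4) : x j ≠ 0 := algebraMap_poly_ne_zero (X_ne_zero j)

theorem irreducible_X (c : Fin 4) : Irreducible (X c : Poly) := X_prime.irreducible

/-! ## Substitutions -/

/-- Algebraic independence of a quadruple of rational functions. -/
def Dominant (y : Fin 4 → RatFun) : Prop := Function.Injective (aeval y : Poly →ₐ[ℂ] RatFun)

theorem subst_algebraMap {y : Fin 4 → RatFun} (h : Dominant y) (p : Poly) :
    subst y (algebraMap Poly RatFun p) = aeval y p := by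
  have h' : Function.Injective (aeval y : Poly →ₐ[ℂ] RatFun) := h
  unfold subst
  rw [dif_pos h']
  exact IsFractionRing.lift_algebraMap h' p

theorem subst_x {y : Fin 4 → RatFun} (h : Dominant y) (j : Fin 4) : subst y (x j) = y j := by
  unfold x
  rw [subst_algebraMap h, aeval_X]

theorem algebraMap_eq_aeval (p : Poly) : algebraMap Poly RatFun p = aeval x p := by
  have : (Algebra.ofId Poly RatFun).restrictScalars ℂ = aeval x := by
    ext j
    simp [x, Algebra.ofId_apply]
  exact DFunLike.congr_fun this p

theorem algHom_ext {φ ψ : RatFun →ₐ[ℂ] RatFun} (h : ∀ j, φ (x j) = ψ (x j)) : φ = ψ := by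
  have h1 : ∀ p : Poly, φ (algebraMap Poly RatFun p) = ψ (algebraMap Poly RatFun p) := by
    intro p
    rw [algebraMap_eq_aeval, ← AlgHom.comp_apply, ← AlgHom.comp_apply, comp_aeval, comp_aeval]
    congr 2
    funext j
    exact h j
  refine AlgHom.ext fun f => ?_
  obtain ⟨n, d, -, rfl⟩ := exists_fraction f
  rw [map_div₀, map_div₀, h1, h1]

/-! ## Rational expressions -/

/-- Rational expressions in four variables. -/
inductive Ex
  | var (j : Fin 4)
  | con (c : ℂ)
  | add (e f : Ex)
  | sub (e f : Ex)
  | mul (e f : Ex)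
  | div (e f : Ex)

namespace Ex

instance : Add Ex := ⟨Ex.add⟩
instance : Sub Ex := ⟨Ex.sub⟩
instance : Mul Ex := ⟨Ex.mul⟩
instance : _root_.Div Ex := ⟨Ex.div⟩
instance : Coe ℂ Ex := ⟨Ex.con⟩
instance : One Ex := ⟨Ex.con 1⟩

variable {F F' : Type*} [Field F] [Algebra ℂ F] [Field F'] [Algebra ℂ F']

/-- The value of an expression. -/
def eval (u : Fin 4 → F) : Ex → F
  | var j => u j
  | con c => algebraMap ℂ F c
  | add e f => eval u e + eval u f
  | sub e f => eval u e - eval u f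
  | mul e f => eval u e * eval u f
  | div e f => eval u e / eval u f

/-- No denominator of the expression vanishes. -/
def Def (u : Fin 4 → F) : Ex → Prop
  | var _ => True
  | con _ => True
  | add e f => Def u e ∧ Def u f
  | sub e f => Def u e ∧ Def u f
  | mul e f => Def u e ∧ Def u f
  | div e f => Def u e ∧ Def u f ∧ eval u f ≠ 0

variable (u : Fin 4 → F) (e f : Ex)

@[simp] theorem eval_var (j : Fin 4) : (var j).eval u = u j := rfl
@[simp] theorem eval_con (c : ℂ) : (con c).eval u = algebraMap ℂ F c := rfl
@[simp] theorem eval_one : (1 : Ex).eval u = 1 := map_one (algebraMap ℂ F)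
@[simp] theorem eval_add : (e + f).eval u = e.eval u + f.eval u := rfl
@[simp] theorem eval_sub : (e - f).eval u = e.eval u - f.eval u := rfl
@[simp] theorem eval_mul : (e * f).eval u = e.eval u * f.eval u := rfl
@[simp] theorem eval_div : (e / f).eval u = e.eval u / f.eval u := rfl
@[simp] theorem def_var (j : Fin 4) : (var j).Def u := trivial
@[simp] theorem def_con (c : ℂ) : (con c).Def u := trivial
@[simp] theorem def_one : (1 : Ex).Def u := trivial
@[simp] theorem def_add : (e + f).Def u ↔ e.Def u ∧ f.Def u := Iff.rfl
@[simp] theorem def_sub : (e - f).Def u ↔ e.Def u ∧ f.Def u := Iff.rfl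
@[simp] theorem def_mul : (e * f).Def u ↔ e.Def u ∧ f.Def u := Iff.rfl
@[simp] theorem def_div : (e / f).Def u ↔ e.Def u ∧ f.Def u ∧ f.eval u ≠ 0 := Iff.rfl

/-- One expression serves in the variables, in a chart, on a hyperplane and at a point of `ℂ⁴`.
Commuting with homomorphisms turns substitution into evaluation. -/
theorem map_eval (θ : F →ₐ[ℂ] F') : θ (e.eval u) = e.eval (fun j => θ (u j)) := by
  induction e with
  | var j => rfl
  | con c => exact θ.commutes c
  | add e f ihe ihf => exact (map_add θ _ _).trans (congrArg₂ _ ihe ihf)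
  | sub e f ihe ihf => exact (map_sub θ _ _).trans (congrArg₂ _ ihe ihf)
  | mul e f ihe ihf => exact (map_mul θ _ _).trans (congrArg₂ _ ihe ihf)
  | div e f ihe ihf => exact (map_div₀ θ _ _).trans (congrArg₂ _ ihe ihf)

theorem eval_mem {L : IntermediateField ℂ F} {u : Fin 4 → F} (h : ∀ j, u j ∈ L) (e : Ex) :
    e.eval u ∈ L := by
  induction e with
  | var j => exact h j
  | con c => exact L.algebraMap_mem c
  | add e f ihe ihf => exact L.add_mem ihe ihf
  | sub e f ihe ihf => exact L.sub_mem ihe ihf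
  | mul e f ihe ihf => exact L.mul_mem ihe ihf
  | div e f ihe ihf => exact L.div_mem ihe ihf

end Ex

theorem algebraicIndependent_x : AlgebraicIndependent ℂ x := by
  have h : AlgebraicIndependent ℂ (fun j : Fin 4 => (X j : Poly)) := algebraicIndependent_X _ _
  exact h.map' (f := (Algebra.ofId Poly RatFun).restrictScalars ℂ)
    (FaithfulSMul.algebraMap_injective Poly RatFun)

theorem x_mem_adjoin_range : IntermediateField.adjoin ℂ (Set.range x) = ⊤ := by
  rw [eq_top_iff]
  rintro f -
  obtain ⟨n, d, -, rfl⟩ := exists_fraction f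
  have h : ∀ p : Poly, algebraMap Poly RatFun p ∈ IntermediateField.adjoin ℂ (Set.range x) := by
    intro p
    rw [algebraMap_eq_aeval]
    exact IntermediateField.algebra_adjoin_le_adjoin _ _
      (by rw [Algebra.adjoin_range_eq_range_aeval]; exact ⟨p, rfl⟩)
  exact div_mem (h n) (h d)

theorem four_le_trdeg : Cardinal.mk (Fin 4) ≤ Algebra.trdeg ℂ RatFun :=
  algebraicIndependent_x.cardinalMk_le_trdeg

/-- Four rational functions that generate the field are algebraically independent. -/
theorem dominant_of_mem_adjoin {y : Fin 4 → RatFun}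
    (h : ∀ j, x j ∈ IntermediateField.adjoin ℂ (Set.range y)) : Dominant y := by
  have htop : IntermediateField.adjoin ℂ (Set.range y) = ⊤ := by
    rw [eq_top_iff, ← x_mem_adjoin_range]
    exact IntermediateField.adjoin_le_iff.2 (by rintro _ ⟨j, rfl⟩; exact h j)
  have halg : Algebra.IsAlgebraic (Algebra.adjoin ℂ (Set.range y)) RatFun := by
    refine ⟨fun f => ?_⟩
    have hf : f ∈ IntermediateField.adjoin ℂ (Set.range y) := htop ▸ IntermediateField.mem_top
    obtain ⟨r, hr, s, hs, rfl⟩ := (IntermediateField.mem_adjoin_iff_div).1 hf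
    exact (isAlgebraic_algebraMap (⟨r, hr⟩ : Algebra.adjoin ℂ (Set.range y))).mul
      (isAlgebraic_algebraMap (⟨s, hs⟩ : Algebra.adjoin ℂ (Set.range y))).inv |> (by
        rw [div_eq_mul_inv]; exact ·)
  -- The field is algebraic over four elements and has transcendence degree at least four, so these
  -- elements are a transcendence basis.
  exact (Algebra.IsAlgebraic.isTranscendenceBasis_of_le_trdeg_of_finite ℂ y four_le_trdeg).1

/-- An explicit inverse certifies dominance, because the `yⱼ` then generate the field. All charts,
generators and restrictions below are handled through such an inverse. -/
theorem dominant_of_eval {y : Fin 4 → RatFun} (W : Fin 4 → Ex) (h : ∀ k, (W k).eval y = x k) :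
    Dominant y :=
  dominant_of_mem_adjoin fun k => h k ▸
    Ex.eval_mem (fun j => IntermediateField.subset_adjoin _ _ (Set.mem_range_self j)) (W k)

theorem subst_eval {y : Fin 4 → RatFun} (h : Dominant y) (e : Ex) :
    subst y (e.eval x) = e.eval y := by
  rw [Ex.map_eval]
  simp only [subst_x h]

/-! ## Restriction to a coordinate hyperplane -/

/-- The restriction of polynomials to the hyperplane `x c = 0`. -/
def restr (c : Fin 4) : Poly →ₐ[ℂ] Poly := aeval (Function.update X c 0)

theorem restr_eq_zero_iff {c : Fin 4} {p : Poly} : restr c p = 0 ↔ X c ∣ p := by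
  constructor
  · intro h
    -- Modulo `X c` a polynomial agrees with its restriction; this gives the nontrivial direction.
    have h1 : ∀ q : Poly, X c ∣ q - restr c q := by
      intro q
      induction q using MvPolynomial.induction_on with
      | C a => simp [restr]
      | add p q hp hq => rw [map_add, add_sub_add_comm]; exact dvd_add hp hq
      | mul_X p j hp =>
        rw [map_mul]
        by_cases hj : j = c
        · subst hj; simp [restr]
        · have h2 : restr c (X j) = X j := by simp [restr, hj]
          rw [h2, ← sub_mul]
          exact hp.mul_right _
    simpa [h] using h1 p
  · rintro ⟨q, rfl⟩
    simp [restr]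

/-- `Red c f g`: the rational function `f` is regular at the generic point of `x c = 0`, where its
value is `g`. -/
def Red (c : Fin 4) (f g : RatFun) : Prop :=
  ∃ n d : Poly, restr c d ≠ 0 ∧ f = algebraMap Poly RatFun n / algebraMap Poly RatFun d ∧
    g = algebraMap Poly RatFun (restr c n) / algebraMap Poly RatFun (restr c d)

namespace Red

variable {c : Fin 4} {f g f' g' : RatFun}

theorem of_poly (p : Poly) : Red c (algebraMap Poly RatFun p) (algebraMap Poly RatFun (restr c p)) :=
  ⟨p, 1, by simp, by simp, by simp⟩

theorem con (a : ℂ) : Red c (algebraMap ℂ RatFun a) (algebraMap ℂ RatFun a) := by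
  have h := of_poly (c := c) (C a)
  have hC : C a = algebraMap ℂ Poly a := rfl
  rwa [hC, AlgHom.commutes, ← IsScalarTower.algebraMap_apply] at h

theorem var (j : Fin 4) : Red c (x j) (Function.update x c 0 j) := by
  have h := of_poly (c := c) (X j)
  unfold x
  convert h using 1
  rw [restr, aeval_X]
  by_cases hj : j = c
  · subst hj; simp
  · simp [hj]

theorem add (h : Red c f g) (h' : Red c f' g') : Red c (f + f') (g + g') := by
  obtain ⟨n, d, hd, rfl, rfl⟩ := h
  obtain ⟨n', d', hd', rfl, rfl⟩ := h'
  have e1 := algebraMap_poly_ne_zero hd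
  have e2 := algebraMap_poly_ne_zero hd'
  have e3 := algebraMap_poly_ne_zero (p := d) (by rintro rfl; simp at hd)
  have e4 := algebraMap_poly_ne_zero (p := d') (by rintro rfl; simp at hd')
  refine ⟨n * d' + d * n', d * d', by simp [hd, hd'], ?_, ?_⟩ <;>
  · simp only [map_add, map_mul]
    field_simp

theorem mul (h : Red c f g) (h' : Red c f' g') : Red c (f * f') (g * g') := by
  obtain ⟨n, d, hd, rfl, rfl⟩ := h
  obtain ⟨n', d', hd', rfl, rfl⟩ := h'
  refine ⟨n * n', d * d', by simp [hd, hd'], ?_, ?_⟩ <;>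
  · simp only [map_mul, div_mul_div_comm]

theorem sub (h : Red c f g) (h' : Red c f' g') : Red c (f - f') (g - g') := by
  have h1 := h.add ((con (-1)).mul h')
  simpa [sub_eq_add_neg] using h1

theorem inv (h : Red c f g) (hg : g ≠ 0) : Red c f⁻¹ g⁻¹ := by
  obtain ⟨n, d, hd, rfl, rfl⟩ := h
  refine ⟨d, n, ?_, by rw [inv_div], by rw [inv_div]⟩
  intro h0
  rw [h0] at hg
  simp at hg

theorem div (h : Red c f g) (h' : Red c f' g') (hg : g' ≠ 0) : Red c (f / f') (g / g') := by
  rw [div_eq_mul_inv, div_eq_mul_inv]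
  exact h.mul (h'.inv hg)

theorem ne_zero (h : Red c f g) (hg : g ≠ 0) : f ≠ 0 := by
  rintro rfl
  obtain ⟨n, d, hd, h1, rfl⟩ := h
  apply hg
  have e3 := algebraMap_poly_ne_zero (p := d) (by rintro rfl; simp at hd)
  have h2 : algebraMap Poly RatFun n = 0 := by
    rcases div_eq_zero_iff.1 h1.symm with h2 | h2
    · exact h2
    · exact absurd h2 e3
  rw [FaithfulSMul.algebraMap_eq_zero_iff] at h2
  simp [h2]

theorem ordAlong_eq_zero (h : Red c f g) (hg : g ≠ 0) : ordAlong (X c) f = 0 := by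
  obtain ⟨n, d, hd, rfl, rfl⟩ := h
  have hn : restr c n ≠ 0 := by intro h0; simp [h0] at hg
  have hp := irreducible_X c
  have hn' : ¬ X c ∣ n := fun h0 => hn (restr_eq_zero_iff.2 h0)
  have hd' : ¬ X c ∣ d := fun h0 => hd (restr_eq_zero_iff.2 h0)
  rw [ordAlong_div hp (by rintro rfl; simp at hn) (by rintro rfl; simp at hd),
    multiplicity_eq_zero.2 hn', multiplicity_eq_zero.2 hd']
  rfl

/-- Induction on the expression: regularity at the generic point of the hyperplane only asks that
each denominator stay nonzero after setting `x c = 0`, a condition that `simp` can unfold. -/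
theorem eval {e : Ex} (h : e.Def (Function.update x c 0)) :
    Red c (e.eval x) (e.eval (Function.update x c 0)) := by
  induction e with
  | var j => exact var j
  | con a => exact con a
  | add e f ihe ihf => exact (ihe h.1).add (ihf h.2)
  | sub e f ihe ihf => exact (ihe h.1).sub (ihf h.2)
  | mul e f ihe ihf => exact (ihe h.1).mul (ihf h.2)
  | div e f ihe ihf => exact (ihe h.1).div (ihf h.2.1) h.2.2

theorem aeval {y z : Fin 4 → RatFun} (h : ∀ j, Red c (y j) (z j)) (p : Poly) :
    Red c (MvPolynomial.aeval y p) (MvPolynomial.aeval z p) := by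
  induction p using MvPolynomial.induction_on with
  | C a => simpa [MvPolynomial.aeval_C] using con a
  | add p q hp hq => simpa using hp.add hq
  | mul_X p j hp => simpa using hp.mul (h j)

end Red

/-- The order along `x c = 0` of the pull-back of a function under a dominant rational map that
maps the hyperplane `x c = 0` dominantly to `x c' = 0`, without ramification. -/
theorem ordAlong_subst {c c' : Fin 4} {y z : Fin 4 → RatFun} {u u₀ : RatFun}
    (h : ∀ j, j ≠ c' → Red c (y j) (z j)) (hc : y c' = x c * u) (hu : Red c u u₀) (hu₀ : u₀ ≠ 0)
    (hz : Dominant (Function.update z c' (x c))) :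
    Dominant y ∧ ∀ f, ordAlong (X c) (subst y f) = ordAlong (X c') f := by
  have hp := irreducible_X c
  have hp' := irreducible_X c'
  have hy0 : Red c (y c') 0 := by
    have h1 := (Red.var (c := c) c).mul hu
    rw [hc]
    simpa using h1
  have hred : ∀ j, Red c (y j) (Function.update z c' 0 j) := by
    intro j
    by_cases hj : j = c'
    · subst hj; simpa using hy0
    · simpa [hj] using h j hj
  -- A polynomial prime to `X c'` does not vanish on the target hyperplane, hence pulls back to a
  -- unit at the generic point of the source hyperplane.
  have hunit : ∀ g : Poly, ¬ X c' ∣ g → Red c (aeval y g) (aeval (Function.update z c' 0) g) ∧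
      aeval (Function.update z c' 0) g ≠ 0 := by
    intro g hg
    refine ⟨Red.aeval hred g, ?_⟩
    rw [← restr_eq_zero_iff] at hg
    -- After restriction the variable `c'` no longer occurs, so any value may be inserted for it.
    -- The choice `x c` completes the three remaining components to a quadruple whose independence
    -- is `hz`.
    have h2 : aeval (Function.update z c' 0) g =
        aeval (Function.update z c' (x c)) (restr c' g) := by
      rw [restr, ← AlgHom.comp_apply, comp_aeval]
      congr 2
      funext j
      by_cases hj : j = c'
      · subst hj; simp
      · simp [hj]
    rw [h2]
    exact fun h0 => hg (hz (h0.trans (map_zero _).symm))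
  have hyc : y c' ≠ 0 := by
    rw [hc]
    exact mul_ne_zero (algebraMap_poly_ne_zero hp.ne_zero) (hu.ne_zero hu₀)
  -- Dominance of `y` itself is not assumed: a polynomial relation is split into a power of `X c'`
  -- and a factor prime to it, and neither pulls back to zero.
  have hdom : Dominant y := by
    rw [Dominant, injective_iff_map_eq_zero]
    intro g hg
    by_contra hg0
    obtain ⟨k, hk, hk'⟩ :=
      (finiteMultiplicity_of_irreducible hp' hg0).exists_eq_pow_mul_and_not_dvd
    rw [hk, map_mul, map_pow, aeval_X] at hg
    rcases mul_eq_zero.1 hg with h1 | h1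
    · exact pow_ne_zero _ hyc h1
    · exact (hunit k hk').1.ne_zero (hunit k hk').2 h1
  refine ⟨hdom, ?_⟩
  have h3 : ordAlong (X c) ∘ subst y = ordAlong (X c') := by
    refine ((isOrd_ordAlong hp).comp _).eq_ordAlong hp' ?_ ?_
    · have hxc : ordAlong (X c) (x c) = 1 := ordAlong_self hp
      rw [Function.comp_apply, subst_algebraMap hdom, aeval_X, hc, (isOrd_ordAlong hp).mul
        (x_ne_zero c) (hu.ne_zero hu₀), hu.ordAlong_eq_zero hu₀, hxc, add_zero]
    · intro g hg
      rw [Function.comp_apply, subst_algebraMap hdom]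
      exact (hunit g hg).1.ordAlong_eq_zero (hunit g hg).2
  exact fun f => congrFun h3 f

end

section

/-! ## Charts and Bäcklund transformations as rational expressions -/

notation "y₀" => Ex.var 0
notation "y₁" => Ex.var 1
notation "y₂" => Ex.var 2
notation "y₃" => Ex.var 3

/-- The values of a tuple of expressions. -/
def Ex.evals {F : Type*} [Field F] [Algebra ℂ F] (P : Fin 4 → Ex) (u : Fin 4 → F) : Fin 4 → F :=
  fun j => (P j).eval u

theorem Ex.evals_apply {F : Type*} [Field F] [Algebra ℂ F] (P : Fin 4 → Ex) (u : Fin 4 → F)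
    (j : Fin 4) : Ex.evals P u j = (P j).eval u := rfl

/-- A single complex point at which the expression is defined and nonzero suffices, since the
numerator of a suitable fraction is then nonzero there. The points `v` supplied below are such
witnesses for the denominators. -/
theorem Ex.ne_zero (e : Ex) (v : Fin 4 → ℂ) (hd : e.Def v) (h : e.eval v ≠ 0) : e.eval x ≠ 0 := by
  have key : ∀ e : Ex, e.Def v → ∃ n d : Poly, MvPolynomial.eval v d ≠ 0 ∧
      e.eval x = algebraMap Poly RatFun n / algebraMap Poly RatFun d ∧
      e.eval v = MvPolynomial.eval v n / MvPolynomial.eval v d := by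
    have hne : ∀ d : Poly, MvPolynomial.eval v d ≠ 0 → algebraMap Poly RatFun d ≠ 0 :=
      fun d hd => algebraMap_poly_ne_zero (by rintro rfl; simp at hd)
    intro e he
    induction e with
    | var j => exact ⟨X j, 1, by simp, by simp [x], by simp⟩
    | con c =>
      refine ⟨C c, 1, by simp, ?_, by simp [Ex.eval]⟩
      have hC : C c = algebraMap ℂ Poly c := rfl
      rw [hC, ← IsScalarTower.algebraMap_apply]
      simp [Ex.eval]
    | add e f ihe ihf =>
      obtain ⟨n, d, hd, h1, h2⟩ := ihe he.1
      obtain ⟨n', d', hd', h1', h2'⟩ := ihf he.2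
      refine ⟨n * d' + d * n', d * d', by simp [hd, hd'], ?_, ?_⟩
      · have := hne _ hd
        have := hne _ hd'
        simp only [map_add, map_mul]
        exact (congrArg₂ (· + ·) h1 h1').trans (div_add_div _ _ (hne _ hd) (hne _ hd'))
      · simp only [map_add, map_mul]
        exact (congrArg₂ (· + ·) h2 h2').trans (div_add_div _ _ hd hd')
    | sub e f ihe ihf =>
      obtain ⟨n, d, hd, h1, h2⟩ := ihe he.1
      obtain ⟨n', d', hd', h1', h2'⟩ := ihf he.2
      refine ⟨n * d' - d * n', d * d', by simp [hd, hd'], ?_, ?_⟩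
      · simp only [map_sub, map_mul]
        exact (congrArg₂ (· - ·) h1 h1').trans (div_sub_div _ _ (hne _ hd) (hne _ hd'))
      · simp only [map_sub, map_mul]
        exact (congrArg₂ (· - ·) h2 h2').trans (div_sub_div _ _ hd hd')
    | mul e f ihe ihf =>
      obtain ⟨n, d, hd, h1, h2⟩ := ihe he.1
      obtain ⟨n', d', hd', h1', h2'⟩ := ihf he.2
      refine ⟨n * n', d * d', by simp [hd, hd'], ?_, ?_⟩
      · simp only [map_mul]
        exact (congrArg₂ (· * ·) h1 h1').trans (div_mul_div_comm _ _ _ _)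
      · simp only [map_mul]
        exact (congrArg₂ (· * ·) h2 h2').trans (div_mul_div_comm _ _ _ _)
    | div e f ihe ihf =>
      obtain ⟨n, d, hd, h1, h2⟩ := ihe he.1
      obtain ⟨n', d', hd', h1', h2'⟩ := ihf he.2.1
      have hn' : MvPolynomial.eval v n' ≠ 0 := fun h0 => he.2.2 (by rw [h2', h0, zero_div])
      refine ⟨n * d', d * n', by simp [hd, hn'], ?_, ?_⟩
      · simp only [map_mul]
        exact (congrArg₂ (· / ·) h1 h1').trans (div_div_div_eq _ _ _ _)
      · simp only [map_mul]
        exact (congrArg₂ (· / ·) h2 h2').trans (div_div_div_eq _ _ _ _)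
  obtain ⟨n, d, -, h1, h2⟩ := key e hd
  rw [h1]
  have hd0 : MvPolynomial.eval v d ≠ 0 := fun h0 => h (by rw [h2, h0, div_zero])
  have hn0 : MvPolynomial.eval v n ≠ 0 := fun h0 => h (by rw [h2, h0, zero_div])
  exact div_ne_zero (algebraMap_poly_ne_zero (by rintro rfl; simp at hn0))
    (algebraMap_poly_ne_zero (by rintro rfl; simp at hd0))

/-- The action of `sᵢ` on the variables. -/
def sEx (i : Fin 6) (A : Params) : Fin 4 → Ex :=
  match i with
  | 0 => ![y₀, y₁, y₂ - A.a 0 * y₀ / (y₀ - y₁), y₃ + A.a 0 * y₁ / (y₀ - y₁)]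
  | 1 => ![y₀ * (1 + A.a 1 / y₂), y₁, y₂ + A.a 1, y₃]
  | 2 => ![y₀, y₁, y₂ - A.a 2 * y₀ / (y₀ - A.t), y₃]
  | 3 => ![y₀ + A.a 3 * y₀ / (y₂ + y₃ - A.a 3 + A.η), y₁ + A.a 3 * y₁ / (y₂ + y₃ - A.a 3 + A.η),
      y₂, y₃]
  | 4 => ![y₀, y₁, y₂, y₃ - A.a 4 * y₁ / (y₁ - 1)]
  | 5 => ![y₀, y₁ * (1 + A.a 5 / y₃), y₂, y₃ + A.a 5]

theorem evals_sEx (i : Fin 6) (A : Params) : Ex.evals (sEx i A) x = sVar i A := by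
  funext j
  fin_cases i <;> fin_cases j <;> simp [sEx, sVar, Ex.evals, const]

/-- The charts of `𝒳_A`. -/
def chartEx (A : Params) : Comp → Fin 4 → Ex
  | Sum.inl j => Function.update Ex.var j (1 / Ex.var j)
  | Sum.inr k =>
    match k with
    | 1 => ![y₀, y₁, y₀ * y₂, y₃]
    | 2 => ![1 / y₀, y₁, y₀ * y₂ - A.a 1, y₃]
    | 3 => ![y₀, y₁, y₂, y₁ * y₃]
    | 4 => ![y₀, 1 / y₁, y₂, y₁ * y₃ - A.a 5]
    | 5 => ![y₀, y₀ * y₁, y₀ * y₂ - y₃ + A.a 3 - A.η, y₃]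
    | 6 => ![1 / y₀, 1 / (y₀ * y₁), y₀ * y₂ - y₃ - A.η, y₃]
    | 7 => ![A.t + y₂ * y₀, y₁, 1 / y₂, y₃]
    | 8 => ![A.t + y₂ * (A.a 2 * A.t + y₂ * y₀), y₁, 1 / y₂, y₃]
    | 9 => ![y₀, 1 + y₃ * y₁, y₂, 1 / y₃]
    | 10 => ![y₀, 1 + y₃ * (A.a 4 + y₃ * y₁), y₂, 1 / y₃]
    | 11 => ![y₁ + y₂ * y₀, y₁, 1 / y₂, 1 / (y₂ * y₃)]
    | 0 => ![y₁ + y₂ * (A.a 0 * y₁ + y₂ * y₀), y₁, 1 / y₂, 1 / (y₂ * (y₂ * y₃ - 1))]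

theorem evals_chartEx (A : Params) (b : Comp) : Ex.evals (chartEx A b) x = chart A b := by
  funext j
  rcases b with k | k
  · by_cases h : j = k
    · subst h; simp [chartEx, chart, Ex.evals]
    · simp [chartEx, chart, Ex.evals, h]
  · fin_cases k <;> fin_cases j <;> simp [chartEx, chart, Ex.evals, const]

/-- The coordinates of the charts of `𝒳_A` as rational functions of `q₁, q₂, r₁, r₂`. -/
def coordEx (A : Params) : Comp → Fin 4 → Ex
  | Sum.inl j => Function.update Ex.var j (1 / Ex.var j)
  | Sum.inr k =>
    match k with
    | 1 => ![y₀, y₁, y₂ / y₀, y₃]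
    | 2 => ![1 / y₀, y₁, (y₂ + A.a 1) * y₀, y₃]
    | 3 => ![y₀, y₁, y₂, y₃ / y₁]
    | 4 => ![y₀, 1 / y₁, y₂, (y₃ + A.a 5) * y₁]
    | 5 => ![y₀, y₁ / y₀, (y₂ + y₃ - A.a 3 + A.η) / y₀, y₃]
    | 6 => ![1 / y₀, y₀ / y₁, (y₂ + y₃ + A.η) * y₀, y₃]
    | 7 => ![(y₀ - A.t) * y₂, y₁, 1 / y₂, y₃]
    | 8 => ![((y₀ - A.t) * y₂ - A.a 2 * A.t) * y₂, y₁, 1 / y₂, y₃]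
    | 9 => ![y₀, (y₁ - 1) * y₃, y₂, 1 / y₃]
    | 10 => ![y₀, ((y₁ - 1) * y₃ - A.a 4) * y₃, y₂, 1 / y₃]
    | 11 => ![(y₀ - y₁) * y₂, y₁, 1 / y₂, y₂ / y₃]
    | 0 => ![((y₀ - y₁) * y₂ - A.a 0 * y₁) * y₂, y₁, 1 / y₂, (y₂ / y₃ + 1) * y₂]

/-- The charts are birational, with inverse `coordEx`; this is the source of their dominance. -/
theorem coordEx_chart (A : Params) (b : Comp) (j : Fin 4) :
    (coordEx A b j).eval (Ex.evals (chartEx A b) x) = x j := by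
  have h0 := x_ne_zero 0
  have h1 := x_ne_zero 1
  have h2 := x_ne_zero 2
  have h3 := x_ne_zero 3
  have h4 : x 2 * x 3 - 1 ≠ 0 := by
    simpa using (y₂ * y₃ - 1).ne_zero 0 (by simp) (by simp)
  rcases b with k | k
  · by_cases h : j = k
    · subst h; simp [chartEx, coordEx, Ex.evals]
    · simp [chartEx, coordEx, Ex.evals, h]
  · fin_cases k <;> fin_cases j <;> simp [chartEx, coordEx, Ex.evals] <;> field_simp <;> ring

theorem dominant_chart (A : Params) (b : Comp) : Dominant (Ex.evals (chartEx A b) x) :=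
  dominant_of_eval (coordEx A b) (coordEx_chart A b)

end

/-! ### Nonvanishing of denominators, involutivity of the generators, changes of charts -/

section

notation "κ" => algebraMap ℂ RatFun

theorem algebraMap_C (c : ℂ) : algebraMap Poly RatFun (C c) = κ c :=
  (IsScalarTower.algebraMap_apply ℂ Poly RatFun c).symm

theorem κ_ne_zero {c : ℂ} (hc : c ≠ 0) : κ c ≠ 0 := by simpa using hc

theorem x_sub_x_ne_zero {i j : Fin 4} (h : i ≠ j) : x i - x j ≠ 0 :=
  (Ex.var i - Ex.var j).ne_zero (Pi.single i 1) (by simp) (by simp [h.symm])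

theorem x_add_const_ne_zero (j : Fin 4) (c : ℂ) : x j + κ c ≠ 0 :=
  (Ex.var j + c).ne_zero (Pi.single j (1 - c)) (by simp) (by simp)

theorem x_sub_const_ne_zero (j : Fin 4) (c : ℂ) : x j - κ c ≠ 0 :=
  (Ex.var j - c).ne_zero (Pi.single j (1 + c)) (by simp) (by simp)

theorem x_sub_one_ne_zero (j : Fin 4) : x j - 1 ≠ 0 := by
  simpa using x_sub_const_ne_zero j 1

theorem r_sum_ne_zero (c : ℂ) : x 2 + x 3 + κ c ≠ 0 :=
  (y₂ + y₃ + c).ne_zero ![0, 0, 1 - c, 0] (by simp) (by simp)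

theorem sParam_a (i : Fin 6) (A : Params) (j : Fin 6) : (sParam i A).a j =
    if j = i then -A.a i else if j = i + 1 ∨ j = i - 1 then A.a j + A.a i else A.a j := rfl

theorem sParam_t (i : Fin 6) (A : Params) : (sParam i A).t = A.t := rfl

theorem sParam_zero_η (A : Params) : (sParam 0 A).η = A.η + A.a 0 := by simp [sParam]

theorem sParam_one_η (A : Params) : (sParam 1 A).η = A.η - A.a 1 := by simp [sParam]; ring

theorem sParam_two_η (A : Params) : (sParam 2 A).η = A.η + A.a 2 := by simp [sParam]

theorem sParam_three_η (A : Params) : (sParam 3 A).η = A.η - A.a 3 := by simp [sParam]; ring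

theorem sParam_four_η (A : Params) : (sParam 4 A).η = A.η + A.a 4 := by
  simp [sParam, show (-1 : ℂ) ^ 4 = 1 by norm_num]

theorem sParam_five_η (A : Params) : (sParam 5 A).η = A.η - A.a 5 := by
  simp [sParam, show (-1 : ℂ) ^ 5 = -1 by norm_num]; ring

/-- Changing the sign of `aᵢ` inverts the formulas. For `s₃` the shift of `η` is also needed: it
turns the denominator `r₁ + r₂ - a₃ + η` into `r₁ + r₂ + η`, the numerator of the factor `q̄ⱼ / qⱼ`.
-/
theorem sEx_sEx (i : Fin 6) (A : Params) (j : Fin 4) :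
    (sEx i (sParam i A) j).eval (Ex.evals (sEx i A) x) = x j := by
  have h2 := x_ne_zero 2
  have h3 := x_ne_zero 3
  have h4 : x 0 - x 1 ≠ 0 := x_sub_x_ne_zero (by simp)
  have h5 := x_sub_const_ne_zero 0 A.t
  have h6 := x_sub_one_ne_zero 1
  have h7 := x_add_const_ne_zero 2 (A.a 1)
  have h8 := x_add_const_ne_zero 3 (A.a 5)
  have h9 : x 2 + x 3 - κ (A.a 3) + κ A.η ≠ 0 := by
    have h := r_sum_ne_zero (A.η - A.a 3)
    rw [map_sub] at h
    convert h using 1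
    ring
  have h10 := r_sum_ne_zero A.η
  fin_cases i <;> fin_cases j <;> simp [sEx, Ex.evals, sParam_a, sParam_t, sParam_three_η] <;>
    field_simp <;> ring

theorem dominant_sVar (i : Fin 6) (A : Params) : Dominant (Ex.evals (sEx i A) x) :=
  dominant_of_eval (sEx i (sParam i A)) (sEx_sEx i A)

theorem sPull_eq (i : Fin 6) (A : Params) : sPull i A = subst (Ex.evals (sEx i A) x) := by
  rw [evals_sEx]; rfl

/-- A change of charts. The functions `V` are the coordinates of the target chart as functions on
the source chart, but for the equation of the divisor, which is `x c * V c'`; the functions `W` are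
inverse to the restriction of the coordinates to the divisor. -/
theorem transition {c c' : Fin 4} {P s Q : Fin 4 → Ex} (V W : Fin 4 → Ex)
    (hP : Dominant (Ex.evals P x)) (hs : Dominant (Ex.evals s x)) (hQ : Dominant (Ex.evals Q x))
    (h : ∀ j, (s j).eval (Ex.evals P x) =
      (Q j).eval (Function.update (Ex.evals V x) c' (x c * (V c').eval x)))
    (hV : ∀ j, (V j).Def (Function.update x c 0))
    (hV' : (V c').eval (Function.update x c 0) ≠ 0)
    (hW : ∀ k, (W k).eval
      (Function.update (Ex.evals V (Function.update x c 0)) c' (x c)) = x k) (f : RatFun) :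
    ordAlong (X c) (subst (Ex.evals P x) (subst (Ex.evals s x) f)) =
      ordAlong (X c') (subst (Ex.evals Q x) f) := by
  have hy := ordAlong_subst (c := c) (c' := c')
    (y := Function.update (Ex.evals V x) c' (x c * (V c').eval x))
    (z := Ex.evals V (Function.update x c 0)) (u := (V c').eval x)
    (fun j hj => by
      rw [Function.update_of_ne hj]
      exact Red.eval (hV j)) (by simp) (Red.eval (hV c')) hV' (dominant_of_eval W hW)
  rw [← hy.2]
  congr 1
  -- It remains to see that the two composite comorphisms coincide, which is tested on the four
  -- variables.
  rw [← AlgHom.comp_apply, ← AlgHom.comp_apply]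
  congr 1
  refine algHom_ext fun j => ?_
  rw [AlgHom.comp_apply, AlgHom.comp_apply, subst_x hs, subst_x hQ]
  rw [Ex.evals_apply, Ex.evals_apply, subst_eval hP, subst_eval hy.1]
  exact h j

end

/-! ### Order functions of the boundary and of graph hypersurfaces -/

section

theorem isOrd_boundaryOrd (A : Params) (b : Comp) : IsOrd (boundaryOrd A b) :=
  (isOrd_ordAlong (irreducible_X (chartEq b))).comp (subst (chart A b))

theorem boundaryOrd_apply (A : Params) (b : Comp) (f : RatFun) : boundaryOrd A b f =
    ordAlong (X (chartEq b)) (subst (Ex.evals (chartEx A b) x) f) := by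
  rw [evals_chartEx]; rfl

/-- The coordinates of `ℂ⁴` adapted to the hypersurface `x c = l`. -/
def graphChart (c : Fin 4) (l : Ex) : Fin 4 → Ex := Function.update Ex.var c (Ex.var c + l)

section graph

variable {c : Fin 4} {L : Poly}

/-- The substitution `X c ↦ X c + L`. -/
def shift (c : Fin 4) (L : Poly) : Poly →ₐ[ℂ] Poly := aeval (Function.update X c (X c + L))

/-- The hypothesis `hL` says that `L` does not involve the variable `c`. The shear along `x c`
therefore fixes `L`, and opposite shears cancel. -/
theorem shift_comp_shift (hL : ∀ q : Poly, aeval (Function.update X c q) L = L) {M : Poly}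
    (hM : M + L = 0) : (shift c M).comp (shift c L) = AlgHom.id ℂ Poly := by
  refine MvPolynomial.algHom_ext fun j => ?_
  rw [AlgHom.comp_apply, shift, shift, aeval_X]
  by_cases hj : j = c
  · subst hj
    simp only [Function.update_self, map_add, aeval_X, hL]
    rw [add_assoc, hM, add_zero]
    rfl
  · simp [hj]

/-- The translation `x c ↦ x c + L` of `ℂ⁴`. -/
def shiftEquiv (hL : ∀ q : Poly, aeval (Function.update X c q) L = L) : Poly ≃ₐ[ℂ] Poly :=
  AlgEquiv.ofAlgHom (shift c L) (shift c (-L))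
    (shift_comp_shift (fun q => by rw [map_neg, hL]) (add_neg_cancel L))
    (shift_comp_shift hL (neg_add_cancel L))

theorem shiftEquiv_apply (hL : ∀ q : Poly, aeval (Function.update X c q) L = L) (p : Poly) :
    shiftEquiv hL p = aeval (Function.update X c (X c + L)) p := rfl

theorem shiftEquiv_graph (hL : ∀ q : Poly, aeval (Function.update X c q) L = L) :
    shiftEquiv hL (X c - L) = X c := by
  rw [shiftEquiv_apply, map_sub, hL, aeval_X]
  simp

theorem irreducible_graph (hL : ∀ q : Poly, aeval (Function.update X c q) L = L) :
    Irreducible (X c - L) := by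
  rw [← MulEquiv.irreducible_iff (shiftEquiv hL : Poly ≃* Poly)]
  exact (shiftEquiv_graph hL).symm ▸ irreducible_X c

theorem dominant_graphChart (hL : ∀ q : Poly, aeval (Function.update X c q) L = L) {l : Ex}
    (hl : l.eval x = algebraMap Poly RatFun L) : Dominant (Ex.evals (graphChart c l) x) := by
  have h : ∀ p : Poly, aeval (Ex.evals (graphChart c l) x) p =
      algebraMap Poly RatFun (shiftEquiv hL p) := by
    intro p
    rw [shiftEquiv_apply, algebraMap_eq_aeval, ← AlgHom.comp_apply, comp_aeval]
    congr 2
    funext j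
    by_cases hj : j = c
    · subst hj
      simp [graphChart, Ex.evals, hl, ← algebraMap_eq_aeval, x]
    · simp [graphChart, Ex.evals, hj]
  intro p q hpq
  rw [h, h] at hpq
  exact (shiftEquiv hL).injective (FaithfulSMul.algebraMap_injective _ _ hpq)

/-- A shear of `ℂ⁴` straightens the graph `x c = L` to a coordinate hyperplane. Every hypersurface
exchanged with an exceptional divisor has this form, so the chart method applies to it as well. -/
theorem ordAlong_graph (hL : ∀ q : Poly, aeval (Function.update X c q) L = L) {l : Ex}
    (hl : l.eval x = algebraMap Poly RatFun L) (f : RatFun) :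
    ordAlong (X c - L) f = ordAlong (X c) (subst (Ex.evals (graphChart c l) x) f) := by
  have hd := dominant_graphChart hL hl
  have h : ∀ p : Poly, subst (Ex.evals (graphChart c l) x) (algebraMap Poly RatFun p) =
      algebraMap Poly RatFun (shiftEquiv hL p) := by
    intro p
    rw [subst_algebraMap hd, shiftEquiv_apply, algebraMap_eq_aeval, ← AlgHom.comp_apply, comp_aeval]
    congr 2
    funext j
    by_cases hj : j = c
    · subst hj
      simp [graphChart, Ex.evals, hl, ← algebraMap_eq_aeval, x]
    · simp [graphChart, Ex.evals, hj]
  have hw : ordAlong (X c) ∘ subst (Ex.evals (graphChart c l) x) = ordAlong (X c - L) := by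
    refine ((isOrd_ordAlong (irreducible_X c)).comp _).eq_ordAlong (irreducible_graph hL) ?_ ?_
    · rw [Function.comp_apply, h, shiftEquiv_graph hL]
      exact ordAlong_self (irreducible_X c)
    · intro g hg
      rw [Function.comp_apply, h]
      refine ordAlong_eq_zero (irreducible_X c) fun hdvd => hg ?_
      rw [← shiftEquiv_graph hL] at hdvd
      exact (map_dvd_iff (shiftEquiv hL)).1 hdvd
  exact (congrFun hw f).symm

end graph

section transitions

variable {i : Fin 6} {A : Params}

/-- This and the next two are `transition` for the possible kinds of source and target: boundary to
boundary, boundary to a hypersurface of `ℂ⁴`, and back. -/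
theorem boundaryOrd_sPull {b : Comp} (b' : Comp) (V W : Fin 4 → Ex)
    (h : ∀ j, (sEx i A j).eval (Ex.evals (chartEx A b) x) = (chartEx (sParam i A) b' j).eval
      (Function.update (Ex.evals V x) (chartEq b') (x (chartEq b) * (V (chartEq b')).eval x)))
    (hV : ∀ j, (V j).Def (Function.update x (chartEq b) 0))
    (hV' : (V (chartEq b')).eval (Function.update x (chartEq b) 0) ≠ 0)
    (hW : ∀ k, (W k).eval (Function.update (Ex.evals V (Function.update x (chartEq b) 0))
      (chartEq b') (x (chartEq b))) = x k) :
    boundaryOrd A b ∘ sPull i A = boundaryOrd (sParam i A) b' := by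
  funext f
  rw [Function.comp_apply, sPull_eq, boundaryOrd_apply, boundaryOrd_apply]
  exact transition V W (dominant_chart A b) (dominant_sVar i A) (dominant_chart _ b') h hV hV' hW f

theorem boundaryOrd_sPull_graph {b : Comp} {c : Fin 4} {L : Poly} (l : Ex) (V W : Fin 4 → Ex)
    (hL : ∀ q : Poly, aeval (Function.update X c q) L = L) (hl : l.eval x = algebraMap Poly RatFun L)
    (h : ∀ j, (sEx i A j).eval (Ex.evals (chartEx A b) x) = (graphChart c l j).eval
      (Function.update (Ex.evals V x) c (x (chartEq b) * (V c).eval x)))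
    (hV : ∀ j, (V j).Def (Function.update x (chartEq b) 0))
    (hV' : (V c).eval (Function.update x (chartEq b) 0) ≠ 0)
    (hW : ∀ k, (W k).eval (Function.update (Ex.evals V (Function.update x (chartEq b) 0))
      c (x (chartEq b))) = x k) :
    boundaryOrd A b ∘ sPull i A = ordAlong (X c - L) := by
  funext f
  rw [Function.comp_apply, sPull_eq, boundaryOrd_apply, ordAlong_graph hL hl]
  exact transition V W (dominant_chart A b) (dominant_sVar i A) (dominant_graphChart hL hl)
    h hV hV' hW f

theorem ordAlong_graph_sPull {b' : Comp} {c : Fin 4} {L : Poly} (l : Ex) (V W : Fin 4 → Ex)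
    (hL : ∀ q : Poly, aeval (Function.update X c q) L = L) (hl : l.eval x = algebraMap Poly RatFun L)
    (h : ∀ j, (sEx i A j).eval (Ex.evals (graphChart c l) x) = (chartEx (sParam i A) b' j).eval
      (Function.update (Ex.evals V x) (chartEq b') (x c * (V (chartEq b')).eval x)))
    (hV : ∀ j, (V j).Def (Function.update x c 0))
    (hV' : (V (chartEq b')).eval (Function.update x c 0) ≠ 0)
    (hW : ∀ k, (W k).eval (Function.update (Ex.evals V (Function.update x c 0))
      (chartEq b') (x c)) = x k) :
    ordAlong (X c - L) ∘ sPull i A = boundaryOrd (sParam i A) b' := by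
  funext f
  rw [Function.comp_apply, sPull_eq, boundaryOrd_apply, ordAlong_graph hL hl]
  exact transition V W (dominant_graphChart hL hl) (dominant_sVar i A) (dominant_chart _ b')
    h hV hV' hW f

end transitions

end

/-! ### The generator `s₂`, which exchanges `ℰ₈` with `q₁ = t` -/

section

/-- For each divisor these are the functions `V` of `transition`, and `bwd₂` supplies `W`. The
component at the equation of the divisor is only the unit cofactor, often `1`. The default serves
`8`, which is moved, and `0`, which is treated by itself; it carries no content. -/
def fwd₂ (A : Params) : Comp → Fin 4 → Ex
  | Sum.inl 0 => ![1, y₁, y₂ - A.a 2 / (1 - A.t * y₀), y₃]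
  | Sum.inl 1 => ![y₀, 1, y₂ - A.a 2 * y₀ / (y₀ - A.t), y₃]
  | Sum.inl 2 => ![y₀, y₁, (y₀ - A.t) / (y₀ - A.t - A.a 2 * y₀ * y₂), y₃]
  | Sum.inl 3 => ![y₀, y₁, y₂ - A.a 2 * y₀ / (y₀ - A.t), 1]
  | Sum.inr k =>
    match k with
    | 1 => ![1, y₁, y₂ - A.a 2 / (y₀ - A.t), y₃]
    | 2 => ![1, y₁, y₂ - A.a 2 * A.t / (1 - A.t * y₀), y₃]
    | 3 | 4 => ![y₀, 1, y₂ - A.a 2 * y₀ / (y₀ - A.t), y₃]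
    | 5 => ![1, y₁, y₂ - A.a 2 / (y₀ - A.t), y₃]
    | 6 => ![1, y₁, y₂ - A.a 2 * A.t / (1 - A.t * y₀), y₃]
    | 7 =>
      let n : Ex := y₀ - A.a 2 * A.t - A.a 2 * y₀ * y₂
      ![n, y₁, y₀ / n, y₃]
    | 9 | 10 => ![y₀, y₁, y₂ - A.a 2 * y₀ / (y₀ - A.t), 1]
    | 11 =>
      let q : Ex := y₁ + y₂ * y₀
      let m : Ex := (q - A.t - A.a 2 * q * y₂) / (q - A.t)
      ![y₀ * m, y₁, 1 / m, y₃ * m]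
    | _ => Ex.var

def bwd₂ (A : Params) : Comp → Fin 4 → Ex
  | Sum.inl 0 => ![y₀, y₁, y₂ + A.a 2, y₃]
  | Sum.inl 1 | Sum.inl 3 => ![y₀, y₁, y₂ + A.a 2 * y₀ / (y₀ - A.t), y₃]
  | Sum.inl 2 => Ex.var
  | Sum.inr k =>
    match k with
    | 1 | 5 => ![y₀, y₁, y₂ - A.a 2 / A.t, y₃]
    | 2 | 6 => ![y₀, y₁, y₂ + A.a 2 * A.t, y₃]
    | 3 | 4 | 9 | 10 => ![y₀, y₁, y₂ + A.a 2 * y₀ / (y₀ - A.t), y₃]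
    | 7 => ![y₀ + A.a 2 * A.t, y₁, y₂, y₃]
    | _ => Ex.var

/-- Since `t ≠ 0`, the function `f = a₂ q₁ / (q₁ - t)` is regular at the generic point of this
divisor, where `r₁` has a pole. Replacing `r₁` by `r₁ - f` thus preserves the divisor. -/
theorem boundaryOrd_sPull_two_twelve {A : Params} (ht : A.t ≠ 0) :
    boundaryOrd A (Sum.inr 0) ∘ sPull 2 A = boundaryOrd (sParam 2 A) (Sum.inr 0) := by
  have h2 := x_ne_zero 2
  have h5 := x_sub_const_ne_zero 1 A.t
  have h12 : x 1 + x 2 * (κ (A.a 0) * x 1 + x 2 * x 0) - κ A.t ≠ 0 :=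
    (y₁ + y₂ * (A.a 0 * y₁ + y₂ * y₀) - A.t).ne_zero 0 (by simp) (by simp [ht])
  have h13 : 1 - κ (A.a 2) * (x 1 + x 2 * (κ (A.a 0) * x 1 + x 2 * x 0)) /
      (x 1 + x 2 * (κ (A.a 0) * x 1 + x 2 * x 0) - κ A.t) * x 2 ≠ 0 := by
    simpa using (1 - A.a 2 * (y₁ + y₂ * (A.a 0 * y₁ + y₂ * y₀)) /
      (y₁ + y₂ * (A.a 0 * y₁ + y₂ * y₀) - A.t) * y₂).ne_zero 0 (by simp [ht]) (by simp)
  let q : Ex := y₁ + y₂ * (A.a 0 * y₁ + y₂ * y₀)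
  let f : Ex := A.a 2 * q / (q - A.t)
  refine boundaryOrd_sPull (Sum.inr 0) ![(y₀ - f * (A.a 0 * y₁ + y₂ * y₀)) * (1 - f * y₂), y₁,
      1 / (1 - f * y₂), (y₃ - f * (y₂ * y₃ - 1)) * (1 - f * y₂)]
    ![y₀ + A.a 2 * A.a 0 * y₁ * y₁ / (y₁ - A.t), y₁, y₂, y₃ - A.a 2 * y₁ / (y₁ - A.t)] ?_ ?_ ?_ ?_
  · intro j
    fin_cases j <;> simp [-mul_inv_rev, sEx, Ex.evals, chartEx, chartEq, sParam_a, f, q]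
    -- The identities hold for an arbitrary correction `g` of `r₁`. Making it opaque removes the
    -- nested denominators.
    all_goals generalize κ (A.a 2) * (x 1 + x 2 * (κ (A.a 0) * x 1 + x 2 * x 0)) /
      (x 1 + x 2 * (κ (A.a 0) * x 1 + x 2 * x 0) - κ A.t) = g at h13 ⊢
    all_goals field_simp (disch := first | assumption | exact ne_of_eq_of_ne (by ring1) h13)
    all_goals ring
  · intro j
    fin_cases j <;> simp [chartEq, f, q, h5]
  · simp [chartEq, f, q]
  · intro j
    fin_cases j <;> simp [chartEq, Ex.evals, f, q] <;> field_simp <;> ring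

set_option maxHeartbeats 4000000 in
theorem boundaryOrd_sPull_two_aux {A : Params} (ht : A.t ≠ 0) (b : Comp) (hb : b ≠ Sum.inr 8)
    (hb0 : b ≠ Sum.inr 0) :
    boundaryOrd A b ∘ sPull 2 A = boundaryOrd (sParam 2 A) b := by
  have h0 := x_ne_zero 0
  have h1 := x_ne_zero 1
  have h2 := x_ne_zero 2
  have h3 := x_ne_zero 3
  have h4 := x_sub_const_ne_zero 0 A.t
  have h5 := x_sub_const_ne_zero 1 A.t
  have h6 : 1 - κ A.t * x 0 ≠ 0 := by simpa using (1 - A.t * y₀).ne_zero 0 (by simp) (by simp)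
  have h7 : x 0 - κ A.t - κ (A.a 2) * x 0 * x 2 ≠ 0 :=
    (y₀ - A.t - A.a 2 * y₀ * y₂).ne_zero 0 (by simp) (by simp [ht])
  have h8 : x 0 - κ (A.a 2) * κ A.t - κ (A.a 2) * x 0 * x 2 ≠ 0 :=
    (y₀ - A.a 2 * A.t - A.a 2 * y₀ * y₂).ne_zero ![A.a 2 * A.t + 1, 0, 0, 0] (by simp) (by simp)
  have h9 : x 0 - κ (A.a 2) * κ A.t ≠ 0 :=
    (y₀ - A.a 2 * A.t).ne_zero ![A.a 2 * A.t + 1, 0, 0, 0] (by simp) (by simp)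
  have h10 : x 1 + x 2 * x 0 - κ A.t ≠ 0 :=
    (y₁ + y₂ * y₀ - A.t).ne_zero 0 (by simp) (by simp [ht])
  have h11 : x 1 + x 2 * x 0 - κ A.t - κ (A.a 2) * (x 1 + x 2 * x 0) * x 2 ≠ 0 :=
    (y₁ + y₂ * y₀ - A.t - A.a 2 * (y₁ + y₂ * y₀) * y₂).ne_zero 0 (by simp) (by simp [ht])
  refine boundaryOrd_sPull b (fwd₂ A b) (bwd₂ A b) ?_ ?_ ?_ ?_
  · intro j
    rcases b with k | k <;> fin_cases k <;> fin_cases j <;> first | exact absurd rfl hb | exact absurd rfl hb0 | skip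
    all_goals simp [sEx, Ex.evals, chartEx, chartEq, sParam_a, sParam_t, sParam_two_η, fwd₂]
    -- Denominators occur in normal forms that differ from the stated hypotheses, so they are
    -- matched up to `ring1`.
    all_goals field_simp (disch := first
      | assumption | exact ne_of_eq_of_ne (by ring1) h6 | exact ne_of_eq_of_ne (by ring1) h7
      | exact ne_of_eq_of_ne (by ring1) h8 | exact ne_of_eq_of_ne (by ring1) h10
      | exact ne_of_eq_of_ne (by ring1) h11)
    all_goals ring
  · intro j
    rcases b with k | k <;> fin_cases k <;> fin_cases j <;> first | exact absurd rfl hb | exact absurd rfl hb0 | skip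
    all_goals simp [chartEq, fwd₂, *]
  · rcases b with k | k <;> fin_cases k <;>  first | exact absurd rfl hb | exact absurd rfl hb0 | skip
    all_goals simp [chartEq, fwd₂, *]
  · intro j
    rcases b with k | k <;> fin_cases k <;> fin_cases j <;> first | exact absurd rfl hb | exact absurd rfl hb0 | skip
    all_goals simp [chartEq, Ex.evals, fwd₂, bwd₂, *]
    all_goals field_simp
    all_goals ring

theorem boundaryOrd_sPull_two {A : Params} (ht : A.t ≠ 0) (b : Comp) (hb : b ≠ Sum.inr 8) :
    boundaryOrd A b ∘ sPull 2 A = boundaryOrd (sParam 2 A) b := by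
  by_cases hb0 : b = Sum.inr 0
  · rw [hb0, boundaryOrd_sPull_two_twelve ht]
  · exact boundaryOrd_sPull_two_aux ht b hb hb0

/-- Along this divisor `(q₁ - t) r₁ = a₂ t`, which is the centre `C₈`. Hence the poles of `r₁` and
of `a₂ q₁ / (q₁ - t)` cancel, `r̄₁` is finite, and the image is `q₁ = t`. The free coordinate `y₀`
becomes an affine function of `r̄₁`, invertible because `a₂ t ≠ 0`. -/
theorem boundaryOrd_sPull_two_eight {A : Params} (ha : A.a 2 ≠ 0) (ht : A.t ≠ 0) :
    boundaryOrd A (Sum.inr 8) ∘ sPull 2 A = ordAlong (X 0 - C A.t) := by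
  have ha' := κ_ne_zero ha
  have ht' := κ_ne_zero ht
  have h2 := x_ne_zero 2
  have h5 : κ (A.a 2) * κ A.t + x 2 * x 0 ≠ 0 :=
    (A.a 2 * A.t + y₂ * y₀).ne_zero 0 (by simp) (by simp [ha, ht])
  refine boundaryOrd_sPull_graph A.t ![A.a 2 * A.t + y₂ * y₀, y₁,
    (y₀ - A.a 2 * (A.a 2 * A.t + y₂ * y₀)) / (A.a 2 * A.t + y₂ * y₀), y₃]
    ![(y₂ + A.a 2) * A.a 2 * A.t, y₁, y₀, y₃] (by simp) (by simp [algebraMap_C]) ?_ ?_ ?_ ?_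
  · intro j
    fin_cases j <;> simp [sEx, Ex.evals, chartEx, chartEq, graphChart]
    · ring
    · field_simp
      ring
  · intro j
    fin_cases j <;> simp [chartEq, ha, ht]
  · simp [chartEq, ha, ht]
  · intro j
    fin_cases j <;> simp [chartEq, Ex.evals]
    field_simp
    ring

/-- On `q₁ = t` the new `r̄₁` has a pole with `(q₁ - t) r̄₁ = -a₂ t`, and `-a₂` is the new value of
`a₂`. -/
theorem ordAlong_sPull_two {A : Params} (ha : A.a 2 ≠ 0) (ht : A.t ≠ 0) :
    ordAlong (X 0 - C A.t) ∘ sPull 2 A = boundaryOrd (sParam 2 A) (Sum.inr 8) := by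
  have ha' := κ_ne_zero ha
  have ht' := κ_ne_zero ht
  have h0 := x_ne_zero 0
  have h5 : x 0 * x 2 - κ (A.a 2) * (x 0 + κ A.t) ≠ 0 :=
    (y₀ * y₂ - A.a 2 * (y₀ + A.t)).ne_zero 0 (by simp) (by simp [ha, ht])
  refine ordAlong_graph_sPull A.t ![(y₂ - A.a 2) * (y₀ * y₂ - A.a 2 * (y₀ + A.t)), y₁,
    1 / (y₀ * y₂ - A.a 2 * (y₀ + A.t)), y₃]
    ![y₂, y₁, A.a 2 - y₀ / (A.a 2 * A.t), y₃] (by simp) (by simp [algebraMap_C]) ?_ ?_ ?_ ?_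
  · intro j
    fin_cases j <;> simp [sEx, Ex.evals, chartEx, chartEq, graphChart, sParam_a, sParam_t]
    · field_simp (disch := first | assumption | exact ne_of_eq_of_ne (by ring1) h5)
      ring
    · field_simp
  · intro j
    fin_cases j <;> simp [ha, ht]
  · simp [chartEq, ha, ht]
  · intro j
    fin_cases j <;> simp [chartEq, Ex.evals]
    field_simp
    ring

end

/-! ### The generator `s₄`, which exchanges `ℰ₁₀` with `q₂ = 1` -/

section

/-- The shifts of `a₃` and `η` fit the centres `C₅` and `C₆`: `r₂` is unchanged where `q₂ = 0`,
while it drops by `a₄` where `q₂ = ∞`. The default is a placeholder for `10` and `0`. -/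
def fwd₄ (A : Params) : Comp → Fin 4 → Ex
  | Sum.inl 0 => ![1, y₁, y₂, y₃ - A.a 4 * y₁ / (y₁ - 1)]
  | Sum.inl 2 => ![y₀, y₁, 1, y₃ - A.a 4 * y₁ / (y₁ - 1)]
  | Sum.inl 1 => ![y₀, 1, y₂, y₃ - A.a 4 / (1 - y₁)]
  | Sum.inl 3 => ![y₀, y₁, y₂, (y₁ - 1) / (y₁ - 1 - A.a 4 * y₁ * y₃)]
  | Sum.inr k =>
    match k with
    | 1 | 2 => ![1, y₁, y₂, y₃ - A.a 4 * y₁ / (y₁ - 1)]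
    | 3 => ![y₀, 1, y₂, y₃ - A.a 4 / (y₁ - 1)]
    | 4 => ![y₀, 1, y₂, y₃ - A.a 4 / (1 - y₁)]
    | 5 => ![1, y₁, y₂ - A.a 4 * y₁ / (y₀ * y₁ - 1), y₃ - A.a 4 * y₀ * y₁ / (y₀ * y₁ - 1)]
    | 6 => ![1, y₁, y₂ - A.a 4 * y₁ / (1 - y₀ * y₁), y₃ - A.a 4 / (1 - y₀ * y₁)]
    | 7 | 8 => ![y₀, y₁, 1, y₃ - A.a 4 * y₁ / (y₁ - 1)]
    | 9 => ![y₀, y₁ - A.a 4 - A.a 4 * y₁ * y₃, y₂, y₁ / (y₁ - A.a 4 - A.a 4 * y₁ * y₃)]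
    | 11 => ![y₀, y₁, 1, y₃ * (y₁ - 1) / (y₁ - 1 - A.a 4 * y₁ * y₂ * y₃)]
    | _ => Ex.var

def bwd₄ (A : Params) : Comp → Fin 4 → Ex
  | Sum.inl 0 | Sum.inl 2 => ![y₀, y₁, y₂, y₃ + A.a 4 * y₁ / (y₁ - 1)]
  | Sum.inl 1 => ![y₀, y₁, y₂, y₃ + A.a 4]
  | Sum.inl 3 => Ex.var
  | Sum.inr k =>
    match k with
    | 1 | 2 | 7 | 8 => ![y₀, y₁, y₂, y₃ + A.a 4 * y₁ / (y₁ - 1)]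
    | 3 => ![y₀, y₁, y₂, y₃ - A.a 4]
    | 4 => ![y₀, y₁, y₂, y₃ + A.a 4]
    | 5 => ![y₀, y₁, y₂ - A.a 4 * y₁, y₃]
    | 6 => ![y₀, y₁, y₂ + A.a 4 * y₁, y₃ + A.a 4]
    | 9 => ![y₀, y₁ + A.a 4, y₂, y₃]
    | _ => Ex.var

set_option maxHeartbeats 4000000 in
theorem boundaryOrd_sPull_four_aux {A : Params} (b : Comp) (hb : b ≠ Sum.inr 10)
    (hb0 : b ≠ Sum.inr 0) : boundaryOrd A b ∘ sPull 4 A = boundaryOrd (sParam 4 A) b := by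
  have h0 := x_ne_zero 0
  have h1 := x_ne_zero 1
  have h2 := x_ne_zero 2
  have h3 := x_ne_zero 3
  have h4 := x_sub_one_ne_zero 1
  have h5 : 1 - x 1 ≠ 0 := by simpa using (1 - y₁).ne_zero 0 (by simp) (by simp)
  have h6 : x 0 * x 1 - 1 ≠ 0 := by simpa using (y₀ * y₁ - 1).ne_zero 0 (by simp) (by simp)
  have h7 : 1 - x 0 * x 1 ≠ 0 := by simpa using (1 - y₀ * y₁).ne_zero 0 (by simp) (by simp)
  have h8 : x 1 - 1 - κ (A.a 4) * x 1 * x 3 ≠ 0 := by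
    simpa using (y₁ - 1 - A.a 4 * y₁ * y₃).ne_zero 0 (by simp) (by simp)
  have h9 : x 1 - κ (A.a 4) - κ (A.a 4) * x 1 * x 3 ≠ 0 :=
    (y₁ - A.a 4 - A.a 4 * y₁ * y₃).ne_zero ![0, A.a 4 + 1, 0, 0] (by simp) (by simp)
  have h10 : x 1 - κ (A.a 4) ≠ 0 := x_sub_const_ne_zero 1 (A.a 4)
  have h11 : x 1 - 1 - κ (A.a 4) * x 1 * x 2 * x 3 ≠ 0 := by
    simpa using (y₁ - 1 - A.a 4 * y₁ * y₂ * y₃).ne_zero 0 (by simp) (by simp)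
  refine boundaryOrd_sPull b (fwd₄ A b) (bwd₄ A b) ?_ ?_ ?_ ?_
  · intro j
    rcases b with k | k <;> fin_cases k <;> fin_cases j <;>
      first | exact absurd rfl hb | exact absurd rfl hb0 | skip
    all_goals simp [sEx, Ex.evals, chartEx, chartEq, sParam_a, sParam_t, sParam_four_η, fwd₄]
    all_goals field_simp (disch := first
      | assumption | exact ne_of_eq_of_ne (by ring1) h5
      | exact ne_of_eq_of_ne (by ring1) h6 | exact ne_of_eq_of_ne (by ring1) h7
      | exact ne_of_eq_of_ne (by ring1) h8 | exact ne_of_eq_of_ne (by ring1) h9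
      | exact ne_of_eq_of_ne (by ring1) h11)
    all_goals ring
  · intro j
    rcases b with k | k <;> fin_cases k <;> fin_cases j <;>
      first | exact absurd rfl hb | exact absurd rfl hb0 | skip
    all_goals simp [chartEq, fwd₄, *]
  · rcases b with k | k <;> fin_cases k <;>
      first | exact absurd rfl hb | exact absurd rfl hb0 | skip
    all_goals simp [chartEq, fwd₄, *]
  · intro j
    rcases b with k | k <;> fin_cases k <;> fin_cases j <;>
      first | exact absurd rfl hb | exact absurd rfl hb0 | skip
    all_goals simp [chartEq, Ex.evals, fwd₄, bwd₄, *]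
    all_goals field_simp
    all_goals ring

theorem boundaryOrd_sPull_four_twelve {A : Params} :
    boundaryOrd A (Sum.inr 0) ∘ sPull 4 A = boundaryOrd (sParam 4 A) (Sum.inr 0) := by
  have h2 := x_ne_zero 2
  have h5 := x_sub_one_ne_zero 1
  have h14 : x 2 * x 3 - 1 ≠ 0 := by simpa using (y₂ * y₃ - 1).ne_zero 0 (by simp) (by simp)
  have h13 : 1 - κ (A.a 4) * x 1 / (x 1 - 1) * (x 2 * (x 2 * x 3 - 1)) ≠ 0 := by
    simpa using (1 - A.a 4 * y₁ / (y₁ - 1) * (y₂ * (y₂ * y₃ - 1))).ne_zero 0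
      (by simp) (by simp)
  let f : Ex := A.a 4 * y₁ / (y₁ - 1)
  refine boundaryOrd_sPull (Sum.inr 0) ![y₀, y₁, 1,
      (y₃ - f * (y₂ * y₃ - 1)) / (1 - f * (y₂ * (y₂ * y₃ - 1)))]
    ![y₀, y₁, y₂, y₃ - A.a 4 * y₁ / (y₁ - 1)] ?_ ?_ ?_ ?_
  · intro j
    fin_cases j <;> simp [-mul_inv_rev, sEx, Ex.evals, chartEx, chartEq, sParam_a, f]
    generalize κ (A.a 4) * x 1 / (x 1 - 1) = g at h13 ⊢
    field_simp (disch := first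
      | assumption | exact ne_of_eq_of_ne (by ring1) h13 | exact ne_of_eq_of_ne (by ring1) h14)
    ring
  · intro j
    fin_cases j <;> simp [chartEq, f, h5]
  · simp [chartEq]
  · intro j
    fin_cases j <;> simp [chartEq, Ex.evals, f]

theorem boundaryOrd_sPull_four {A : Params} (b : Comp) (hb : b ≠ Sum.inr 10) :
    boundaryOrd A b ∘ sPull 4 A = boundaryOrd (sParam 4 A) b := by
  by_cases hb0 : b = Sum.inr 0
  · rw [hb0, boundaryOrd_sPull_four_twelve]
  · exact boundaryOrd_sPull_four_aux b hb hb0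

/-- Along this divisor `(q₂ - 1) r₂ = a₄`, so the two poles in `r̄₂` cancel. -/
theorem boundaryOrd_sPull_four_ten {A : Params} (ha : A.a 4 ≠ 0) :
    boundaryOrd A (Sum.inr 10) ∘ sPull 4 A = ordAlong (X 1 - C 1) := by
  have ha' := κ_ne_zero ha
  have h3 := x_ne_zero 3
  have h5 : κ (A.a 4) + x 3 * x 1 ≠ 0 := (A.a 4 + y₃ * y₁).ne_zero 0 (by simp) (by simp [ha])
  refine boundaryOrd_sPull_graph 1 ![y₀, A.a 4 + y₃ * y₁, y₂,
    (y₁ - A.a 4 * (A.a 4 + y₃ * y₁)) / (A.a 4 + y₃ * y₁)]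
    ![y₀, (y₃ + A.a 4) * A.a 4, y₂, y₁] (by simp) (by simp) ?_ ?_ ?_ ?_
  · intro j
    fin_cases j <;> simp [sEx, Ex.evals, chartEx, chartEq, graphChart]
    · ring
    · field_simp
      ring
  · intro j
    fin_cases j <;> simp [chartEq, ha]
  · simp [chartEq, ha]
  · intro j
    fin_cases j <;> simp [chartEq, Ex.evals]
    field_simp
    ring

theorem ordAlong_sPull_four {A : Params} (ha : A.a 4 ≠ 0) :
    ordAlong (X 1 - C 1) ∘ sPull 4 A = boundaryOrd (sParam 4 A) (Sum.inr 10) := by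
  have ha' := κ_ne_zero ha
  have h1 := x_ne_zero 1
  have h5 : x 1 * x 3 - κ (A.a 4) * (x 1 + 1) ≠ 0 := by
    simpa using (y₁ * y₃ - A.a 4 * (y₁ + 1)).ne_zero 0 (by simp) (by simp [ha])
  refine ordAlong_graph_sPull 1 ![y₀, (y₃ - A.a 4) * (y₁ * y₃ - A.a 4 * (y₁ + 1)), y₂,
    1 / (y₁ * y₃ - A.a 4 * (y₁ + 1))]
    ![y₀, y₃, y₂, A.a 4 - y₁ / A.a 4] (by simp) (by simp) ?_ ?_ ?_ ?_
  · intro j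
    fin_cases j <;> simp [sEx, Ex.evals, chartEx, chartEq, graphChart, sParam_a]
    · field_simp (disch := first | assumption | exact ne_of_eq_of_ne (by ring1) h5)
      ring
    · field_simp
  · intro j
    fin_cases j <;> simp [ha]
  · simp [chartEq, ha]
  · intro j
    fin_cases j <;> simp [chartEq, Ex.evals]
    field_simp
    ring

end

/-! ### The generator `s₁`, which exchanges `ℰ₁` and `ℰ₂` with hypersurfaces `r₁ = const` -/

section

/-- The factor `q̄₁ / q₁ = (r₁ + a₁) / r₁` is a generic unit on all divisors but `1` and `2`, for
which the default is a placeholder. -/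
def fwd₁ (A : Params) : Comp → Fin 4 → Ex
  | Sum.inl 0 => ![y₂ / (y₂ + A.a 1), y₁, y₂ + A.a 1, y₃]
  | Sum.inl 1 => ![y₀ * (y₂ + A.a 1) / y₂, 1, y₂ + A.a 1, y₃]
  | Sum.inl 2 => ![y₀ * (1 + A.a 1 * y₂), y₁, 1 / (1 + A.a 1 * y₂), y₃]
  | Sum.inl 3 => ![y₀ * (y₂ + A.a 1) / y₂, y₁, y₂ + A.a 1, 1]
  | Sum.inr k =>
    match k with
    | 3 | 4 => ![y₀ * (y₂ + A.a 1) / y₂, 1, y₂ + A.a 1, y₃]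
    | 5 =>
      let r : Ex := y₀ * y₂ - y₃ + A.a 3 - A.η
      ![(r + A.a 1) / r, y₁ * r / (r + A.a 1), y₂ * r / (r + A.a 1), y₃]
    | 6 =>
      let r : Ex := y₀ * y₂ - y₃ - A.η
      ![r / (r + A.a 1), y₁ * (r + A.a 1) / r, y₂ * (r + A.a 1) / r, y₃]
    | 7 => ![(y₀ + A.a 1 * (A.t + y₂ * y₀)) * (1 + A.a 1 * y₂), y₁, 1 / (1 + A.a 1 * y₂), y₃]
    | 8 =>
      let v : Ex := A.a 2 * A.t + y₂ * y₀
      ![(y₀ + A.a 1 * v + A.a 1 * (v + A.a 1 * (A.t + y₂ * v))) * (1 + A.a 1 * y₂), y₁,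
        1 / (1 + A.a 1 * y₂), y₃]
    | 9 | 10 => ![y₀ * (y₂ + A.a 1) / y₂, y₁, y₂ + A.a 1, 1]
    | 11 => ![(y₀ + A.a 1 * (y₁ + y₂ * y₀)) * (1 + A.a 1 * y₂), y₁, 1 / (1 + A.a 1 * y₂),
        y₃ * (1 + A.a 1 * y₂)]
    | 0 =>
      let w : Ex := A.a 0 * y₁ + y₂ * y₀
      ![(y₀ + A.a 1 * w + A.a 1 * (w + A.a 1 * (y₁ + y₂ * w))) * (1 + A.a 1 * y₂), y₁,
        1 / (1 + A.a 1 * y₂), (y₃ + A.a 1 * (y₂ * y₃ - 1)) * (1 + A.a 1 * y₂)]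
    | _ => Ex.var

def bwd₁ (A : Params) : Comp → Fin 4 → Ex
  | Sum.inl 0 => ![y₀, y₁, y₂ - A.a 1, y₃]
  | Sum.inl 2 => Ex.var
  | Sum.inl _ => ![y₀ * (y₂ - A.a 1) / y₂, y₁, y₂ - A.a 1, y₃]
  | Sum.inr k =>
    match k with
    | 3 | 4 | 9 | 10 => ![y₀ * (y₂ - A.a 1) / y₂, y₁, y₂ - A.a 1, y₃]
    | 5 =>
      let r : Ex := A.a 3 - A.η - y₃
      ![y₀, y₁ * (r + A.a 1) / r, y₂ * (r + A.a 1) / r, y₃]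
    | 6 =>
      let r : Ex := (0 : ℂ) - A.η - y₃
      ![y₀, y₁ * r / (r + A.a 1), y₂ * r / (r + A.a 1), y₃]
    | 7 => ![y₀ - A.a 1 * A.t, y₁, y₂, y₃]
    | 8 => ![y₀ - (A.a 1 * A.a 2 * A.t + A.a 1 * (A.a 2 * A.t + A.a 1 * A.t)), y₁, y₂, y₃]
    | 11 => ![y₀ - A.a 1 * y₁, y₁, y₂, y₃]
    | 0 => ![y₀ - (A.a 1 * A.a 0 * y₁ + A.a 1 * (A.a 0 * y₁ + A.a 1 * y₁)), y₁, y₂, y₃ + A.a 1]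
    | _ => Ex.var

set_option maxHeartbeats 4000000 in
theorem boundaryOrd_sPull_one_aux {A : Params} (b : Comp) (hb : b ≠ Sum.inr 1) (hb0 : b ≠ Sum.inr 2)
    (hb1 : b ≠ Sum.inr 0) :
    boundaryOrd A b ∘ sPull 1 A = boundaryOrd (sParam 1 A) b := by
  have h0 := x_ne_zero 0
  have h1 := x_ne_zero 1
  have h2 := x_ne_zero 2
  have h3 := x_ne_zero 3
  have h4 := x_add_const_ne_zero 2 (A.a 1)
  have h5 : 1 + κ (A.a 1) * x 2 ≠ 0 := by
    simpa using (1 + A.a 1 * y₂).ne_zero 0 (by simp) (by simp)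
  have h6 : x 2 * x 3 - 1 ≠ 0 := by simpa using (y₂ * y₃ - 1).ne_zero 0 (by simp) (by simp)
  have h7 : x 0 * x 2 - x 3 + κ (A.a 3) - κ A.η ≠ 0 :=
    (y₀ * y₂ - y₃ + A.a 3 - A.η).ne_zero ![0, 0, 0, A.a 3 - A.η - 1] (by simp)
      (by simp; ring_nf; simp)
  have h8 : x 0 * x 2 - x 3 + κ (A.a 3) - κ A.η + κ (A.a 1) ≠ 0 :=
    (y₀ * y₂ - y₃ + A.a 3 - A.η + A.a 1).ne_zero ![0, 0, 0, A.a 3 - A.η + A.a 1 - 1] (by simp)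
      (by simp; ring_nf; simp)
  have h9 : x 0 * x 2 - x 3 - κ A.η ≠ 0 :=
    (y₀ * y₂ - y₃ - A.η).ne_zero ![0, 0, 0, - A.η - 1] (by simp) (by simp)
  have h10 : x 0 * x 2 - x 3 - κ A.η + κ (A.a 1) ≠ 0 :=
    (y₀ * y₂ - y₃ - A.η + A.a 1).ne_zero ![0, 0, 0, - A.η + A.a 1 - 1] (by simp)
      (by simp; ring_nf; simp)
  have h11 : -x 3 + κ (A.a 3) - κ A.η ≠ 0 := by
    simpa using ((0 : ℂ) - y₃ + A.a 3 - A.η).ne_zero ![0, 0, 0, A.a 3 - A.η - 1] (by simp)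
      (by simp; ring_nf; simp)
  have h12 : -x 3 + κ (A.a 3) - κ A.η + κ (A.a 1) ≠ 0 := by
    simpa using ((0 : ℂ) - y₃ + A.a 3 - A.η + A.a 1).ne_zero ![0, 0, 0, A.a 3 - A.η + A.a 1 - 1] (by simp)
      (by simp; ring_nf; simp)
  have h13 : -x 3 - κ A.η ≠ 0 := by
    simpa using ((0 : ℂ) - y₃ - A.η).ne_zero ![0, 0, 0, - A.η - 1] (by simp) (by simp)
  have h14 : -x 3 - κ A.η + κ (A.a 1) ≠ 0 := by
    simpa using ((0 : ℂ) - y₃ - A.η + A.a 1).ne_zero ![0, 0, 0, - A.η + A.a 1 - 1] (by simp)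
      (by simp; ring_nf; simp)
  refine boundaryOrd_sPull b (fwd₁ A b) (bwd₁ A b) ?_ ?_ ?_ ?_
  · intro j
    rcases b with k | k <;> fin_cases k <;> fin_cases j <;>
      first | exact absurd rfl hb | exact absurd rfl hb0 | exact absurd rfl hb1 | skip
    all_goals simp [-mul_eq_mul_left_iff, -mul_eq_mul_right_iff, sEx, Ex.evals, chartEx, chartEq, sParam_a, sParam_t, sParam_one_η, fwd₁]
    all_goals field_simp (disch := first
      | assumption | exact ne_of_eq_of_ne (by ring1) h4 | exact ne_of_eq_of_ne (by ring1) h5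
      | exact ne_of_eq_of_ne (by ring1) h7 | exact ne_of_eq_of_ne (by ring1) h8
      | exact ne_of_eq_of_ne (by ring1) h9 | exact ne_of_eq_of_ne (by ring1) h10)
    all_goals ring
  · intro j
    rcases b with k | k <;> fin_cases k <;> fin_cases j <;>
      first | exact absurd rfl hb | exact absurd rfl hb0 | exact absurd rfl hb1 | skip
    all_goals simp [chartEq, fwd₁, *]
  · rcases b with k | k <;> fin_cases k <;>
      first | exact absurd rfl hb | exact absurd rfl hb0 | exact absurd rfl hb1 | skip
    all_goals simp [chartEq, fwd₁, *]
  · intro j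
    rcases b with k | k <;> fin_cases k <;> fin_cases j <;>
      first | exact absurd rfl hb | exact absurd rfl hb0 | exact absurd rfl hb1 | skip
    all_goals simp [chartEq, Ex.evals, fwd₁, bwd₁, *]
    all_goals field_simp (disch := first
      | assumption | exact ne_of_eq_of_ne (by ring1) h11 | exact ne_of_eq_of_ne (by ring1) h12
      | exact ne_of_eq_of_ne (by ring1) h13 | exact ne_of_eq_of_ne (by ring1) h14)
    all_goals ring

theorem boundaryOrd_sPull_one_twelve {A : Params} :
    boundaryOrd A (Sum.inr 0) ∘ sPull 1 A = boundaryOrd (sParam 1 A) (Sum.inr 0) := by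
  have h2 := x_ne_zero 2
  have h5 : 1 + κ (A.a 1) * x 2 ≠ 0 := by
    simpa using (1 + A.a 1 * y₂).ne_zero 0 (by simp) (by simp)
  have h6 : x 2 * x 3 - 1 ≠ 0 := by simpa using (y₂ * y₃ - 1).ne_zero 0 (by simp) (by simp)
  let w : Ex := A.a 0 * y₁ + y₂ * y₀
  refine boundaryOrd_sPull (Sum.inr 0) ![(y₀ + A.a 1 * w + A.a 1 * (w + A.a 1 * (y₁ + y₂ * w))) *
      (1 + A.a 1 * y₂), y₁, 1 / (1 + A.a 1 * y₂), (y₃ + A.a 1 * (y₂ * y₃ - 1)) * (1 + A.a 1 * y₂)]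
    ![y₀ - (A.a 1 * A.a 0 * y₁ + A.a 1 * (A.a 0 * y₁ + A.a 1 * y₁)), y₁, y₂, y₃ + A.a 1] ?_ ?_ ?_ ?_
  · intro j
    fin_cases j <;> simp [-mul_inv_rev, sEx, Ex.evals, chartEx, chartEq, sParam_a, w]
    · field_simp (disch := first
      | assumption | exact ne_of_eq_of_ne (by ring1) h5 | exact ne_of_eq_of_ne (by ring1) h6)
      ring
    · field_simp (disch := first
      | assumption | exact ne_of_eq_of_ne (by ring1) h5 | exact ne_of_eq_of_ne (by ring1) h6)
    -- The new denominator of the fourth component is a unit multiple of the old `y₂ y₃ - 1`. Only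
    -- in this factored form can it be cleared.
    · rw [show x 2 * (1 + κ (A.a 1) * x 2)⁻¹ * ((x 3 + κ (A.a 1) * (x 2 * x 3 - 1)) *
        (1 + κ (A.a 1) * x 2)) - 1 = (x 2 * x 3 - 1) * (1 + κ (A.a 1) * x 2) by
          field_simp (disch := first | assumption | exact ne_of_eq_of_ne (by ring1) h5)
          ring]
      field_simp (disch := first
      | assumption | exact ne_of_eq_of_ne (by ring1) h5 | exact ne_of_eq_of_ne (by ring1) h6)
  · intro j
    fin_cases j <;> simp [chartEq, w]
  · simp [chartEq]
  · intro j
    fin_cases j <;> simp [chartEq, Ex.evals, w]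
    ring

theorem boundaryOrd_sPull_one {A : Params} (b : Comp) (hb : b ≠ Sum.inr 1) (hb0 : b ≠ Sum.inr 2) :
    boundaryOrd A b ∘ sPull 1 A = boundaryOrd (sParam 1 A) b := by
  by_cases hb1 : b = Sum.inr 0
  · rw [hb1, boundaryOrd_sPull_one_twelve]
  · exact boundaryOrd_sPull_one_aux b hb hb0 hb1

/-- Here `q₁ / r₁` is the inverse of a chart coordinate, so `q̄₁ = q₁ + a₁ q₁ / r₁` is finite and
not constant, while `r̄₁ = a₁`. -/
theorem boundaryOrd_sPull_one_one {A : Params} (ha : A.a 1 ≠ 0) :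
    boundaryOrd A (Sum.inr 1) ∘ sPull 1 A = ordAlong (X 2 - C (A.a 1)) := by
  have ha' := κ_ne_zero ha
  have h0 := x_ne_zero 0
  have h2 := x_ne_zero 2
  refine boundaryOrd_sPull_graph (A.a 1) ![(y₀ * y₂ + A.a 1) / y₂, y₁, y₂, y₃]
    ![y₂, y₁, A.a 1 / y₀, y₃] (by simp) (by simp [algebraMap_C]) ?_ ?_ ?_ ?_
  · intro j
    fin_cases j <;> simp [sEx, Ex.evals, chartEx, chartEq, graphChart]
    · field_simp

  · intro j
    fin_cases j <;> simp [chartEq, h2]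
  · simp [chartEq, h2]
  · intro j
    fin_cases j <;> simp [chartEq, Ex.evals, ha']

/-- The zero of `r₁ + a₁` cancels the pole of `q₁`; `q̄₁` is finite and `r̄₁ = 0`. -/
theorem boundaryOrd_sPull_one_two {A : Params} (ha : A.a 1 ≠ 0) :
    boundaryOrd A (Sum.inr 2) ∘ sPull 1 A = ordAlong (X 2) := by
  have ha' := κ_ne_zero ha
  have h0 := x_ne_zero 0
  have h2 := x_ne_zero 2
  have h5 : x 0 * x 2 - κ (A.a 1) ≠ 0 :=
    (y₀ * y₂ - A.a 1).ne_zero 0 (by simp) (by simp [ha])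
  rw [← sub_zero (X 2 : Poly)]
  refine boundaryOrd_sPull_graph (0 : ℂ) ![y₂ / (y₀ * y₂ - A.a 1), y₁, y₂, y₃]
    ![y₂, y₁, (0 : ℂ) - A.a 1 * y₀, y₃] (by simp) (by simp) ?_ ?_ ?_ ?_
  · intro j
    fin_cases j <;> simp [sEx, Ex.evals, chartEx, chartEq, graphChart]
    · field_simp (disch := first
      | assumption | exact ne_of_eq_of_ne (by ring1) h5)
      ring
  · intro j
    fin_cases j <;> simp [chartEq, ha']
  · simp [chartEq, h2]
  · intro j
    fin_cases j <;> simp [chartEq, Ex.evals]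
    field_simp

/-- On `r₁ = 0` the component `q̄₁` has a pole and `r̄₁ = a₁`, which is minus the new value of `a₁`:
this is the centre `C₂` of the target. -/
theorem ordAlong_sPull_one_zero {A : Params} (ha : A.a 1 ≠ 0) :
    ordAlong (X 2) ∘ sPull 1 A = boundaryOrd (sParam 1 A) (Sum.inr 2) := by
  have ha' := κ_ne_zero ha
  have h0 := x_ne_zero 0
  have h2 := x_ne_zero 2
  have h5 : x 2 + κ (A.a 1) ≠ 0 := x_add_const_ne_zero 2 (A.a 1)
  rw [← sub_zero (X 2 : Poly)]
  refine ordAlong_graph_sPull (0 : ℂ)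
    ![1 / (y₀ * (y₂ + A.a 1)), y₁, y₀ * (y₂ + A.a 1), y₃]
    ![y₂ / A.a 1, y₁, y₀, y₃] (by simp) (by simp) ?_ ?_ ?_ ?_
  · intro j
    fin_cases j <;> simp [sEx, Ex.evals, chartEx, chartEq, graphChart, sParam_a]
    · field_simp
    · field_simp
  · intro j
    fin_cases j <;> simp [h0, ha']
  · simp [chartEq, ha, h0]
  · intro j
    fin_cases j <;> simp [chartEq, Ex.evals, ha']

theorem ordAlong_sPull_one_neg {A : Params} (ha : A.a 1 ≠ 0) :
    ordAlong (X 2 + C (A.a 1)) ∘ sPull 1 A = boundaryOrd (sParam 1 A) (Sum.inr 1) := by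
  have ha' := κ_ne_zero ha
  have h0 := x_ne_zero 0
  have h2 := x_ne_zero 2
  have h5 : x 2 - κ (A.a 1) ≠ 0 := x_sub_const_ne_zero 2 (A.a 1)
  rw [← sub_neg_eq_add, ← C_neg]
  refine ordAlong_graph_sPull (Ex.con (-A.a 1))
    ![y₀ / (y₂ - A.a 1), y₁, (y₂ - A.a 1) / y₀, y₃]
    ![(0 : ℂ) - A.a 1 / y₂, y₁, y₀, y₃] (by simp) (by simp [algebraMap_C]) ?_ ?_ ?_ ?_
  · intro j
    fin_cases j <;> simp [sEx, Ex.evals, chartEx, chartEq, graphChart]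
    · field_simp (disch := first | assumption | exact ne_of_eq_of_ne (by ring1) h5)
      ring
    · field_simp
  · intro j
    fin_cases j <;> simp [h0, ha']
  · simp [chartEq, ha, h0]
  · intro j
    fin_cases j <;> simp [chartEq, Ex.evals]
    field_simp

end

/-! ### The generator `s₅`, which exchanges `ℰ₃` and `ℰ₄` with hypersurfaces `r₂ = const` -/

section

/-- The situation is that of `s₁` with `q₂, r₂` in place of `q₁, r₁`, except over `C₁₁` and `C₁₂`,
whose charts use `q₂` as a coordinate. The coefficient `a₀ + a₅` at `0` is the new value of `a₀`. -/
def fwd₅ (A : Params) : Comp → Fin 4 → Ex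
  | Sum.inl 0 => ![1, y₁ * (y₃ + A.a 5) / y₃, y₂, y₃ + A.a 5]
  | Sum.inl 1 => ![y₀, y₃ / (y₃ + A.a 5), y₂, y₃ + A.a 5]
  | Sum.inl 2 => ![y₀, y₁ * (y₃ + A.a 5) / y₃, 1, y₃ + A.a 5]
  | Sum.inl 3 => ![y₀, y₁ * (1 + A.a 5 * y₃), y₂, 1 / (1 + A.a 5 * y₃)]
  | Sum.inr k =>
    match k with
    | 1 | 2 | 5 => ![1, y₁ * (y₃ + A.a 5) / y₃, y₂, y₃ + A.a 5]
    | 6 => ![1, y₁ * y₃ / (y₃ + A.a 5), y₂, y₃ + A.a 5]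
    | 7 | 8 => ![y₀, y₁ * (y₃ + A.a 5) / y₃, 1, y₃ + A.a 5]
    | 9 => ![y₀, (y₁ + A.a 5 * (1 + y₁ * y₃)) * (1 + A.a 5 * y₃), y₂, 1 / (1 + A.a 5 * y₃)]
    | 10 =>
      let v : Ex := A.a 4 + y₁ * y₃
      ![y₀, (y₁ + A.a 5 * v + A.a 5 * (v + A.a 5 * (1 + y₃ * v))) * (1 + A.a 5 * y₃), y₂,
        1 / (1 + A.a 5 * y₃)]
    | 11 => ![y₀ - A.a 5 * y₁ * y₃, y₁ * (1 + A.a 5 * y₂ * y₃), 1, y₃ / (1 + A.a 5 * y₂ * y₃)]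
    | 0 =>
      let v : Ex := y₂ * y₃ - 1
      ![y₀ - A.a 5 * y₁ * y₃ - (A.a 0 + A.a 5) * A.a 5 * y₁ * v, y₁ * (1 + A.a 5 * y₂ * v), 1,
        (y₃ + A.a 5 * v) / (1 + A.a 5 * y₂ * v)]
    | _ => Ex.var

def bwd₅ (A : Params) : Comp → Fin 4 → Ex
  | Sum.inl 1 => ![y₀, y₁, y₂, y₃ - A.a 5]
  | Sum.inl 3 => Ex.var
  | Sum.inl _ => ![y₀, y₁ * (y₃ - A.a 5) / y₃, y₂, y₃ - A.a 5]
  | Sum.inr k =>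
    match k with
    | 6 => ![y₀, y₁ * y₃ / (y₃ - A.a 5), y₂, y₃ - A.a 5]
    | 9 => ![y₀, y₁ - A.a 5, y₂, y₃]
    | 10 => ![y₀, y₁ - (A.a 5 * A.a 4 + A.a 5 * (A.a 4 + A.a 5)), y₂, y₃]
    | 11 => ![y₀ + A.a 5 * y₁ * y₃, y₁, y₂, y₃]
    | 0 => ![y₀ + A.a 5 * y₁ * (y₃ + A.a 5) - (A.a 0 + A.a 5) * A.a 5 * y₁, y₁, y₂, y₃ + A.a 5]
    | 3 | 4 => Ex.var
    | _ => ![y₀, y₁ * (y₃ - A.a 5) / y₃, y₂, y₃ - A.a 5]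

set_option maxHeartbeats 4000000 in
theorem boundaryOrd_sPull_five_aux {A : Params} (b : Comp) (hb : b ≠ Sum.inr 3)
    (hb0 : b ≠ Sum.inr 4) (hb1 : b ≠ Sum.inr 0) :
    boundaryOrd A b ∘ sPull 5 A = boundaryOrd (sParam 5 A) b := by
  have h0 := x_ne_zero 0
  have h1 := x_ne_zero 1
  have h2 := x_ne_zero 2
  have h3 := x_ne_zero 3
  have h4 := x_add_const_ne_zero 3 (A.a 5)
  have h5 : 1 + κ (A.a 5) * x 3 ≠ 0 := by
    simpa using (1 + A.a 5 * y₃).ne_zero 0 (by simp) (by simp)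
  have h6 : 1 + κ (A.a 5) * x 2 * x 3 ≠ 0 := by
    simpa using (1 + A.a 5 * y₂ * y₃).ne_zero 0 (by simp) (by simp)
  refine boundaryOrd_sPull b (fwd₅ A b) (bwd₅ A b) ?_ ?_ ?_ ?_
  · intro j
    rcases b with k | k <;> fin_cases k <;> fin_cases j <;>
      first | exact absurd rfl hb | exact absurd rfl hb0 | exact absurd rfl hb1 | skip
    all_goals simp [-mul_eq_mul_left_iff, -mul_eq_mul_right_iff, sEx, Ex.evals, chartEx, chartEq,
      sParam_a, sParam_t, sParam_five_η, fwd₅]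
    all_goals field_simp (disch := first
      | assumption | exact ne_of_eq_of_ne (by ring1) h4 | exact ne_of_eq_of_ne (by ring1) h5
      | exact ne_of_eq_of_ne (by ring1) h6)
    all_goals ring
  · intro j
    rcases b with k | k <;> fin_cases k <;> fin_cases j <;>
      first | exact absurd rfl hb | exact absurd rfl hb0 | exact absurd rfl hb1 | skip
    all_goals simp [chartEq, fwd₅, *]
  · rcases b with k | k <;> fin_cases k <;>
      first | exact absurd rfl hb | exact absurd rfl hb0 | exact absurd rfl hb1 | skip
    all_goals simp [chartEq, fwd₅, *]
  · intro j
    rcases b with k | k <;> fin_cases k <;> fin_cases j <;>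
      first | exact absurd rfl hb | exact absurd rfl hb0 | exact absurd rfl hb1 | skip
    all_goals simp [chartEq, Ex.evals, fwd₅, bwd₅, *]

theorem boundaryOrd_sPull_five_twelve {A : Params} :
    boundaryOrd A (Sum.inr 0) ∘ sPull 5 A = boundaryOrd (sParam 5 A) (Sum.inr 0) := by
  have h2 := x_ne_zero 2
  have h5 : 1 + κ (A.a 5) * x 2 * (x 2 * x 3 - 1) ≠ 0 := by
    simpa using (1 + A.a 5 * y₂ * (y₂ * y₃ - 1)).ne_zero 0 (by simp) (by simp)
  have h6 : x 2 * x 3 - 1 ≠ 0 := by simpa using (y₂ * y₃ - 1).ne_zero 0 (by simp) (by simp)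
  refine boundaryOrd_sPull (Sum.inr 0) (fwd₅ A (Sum.inr 0)) (bwd₅ A (Sum.inr 0)) ?_ ?_ ?_ ?_
  · intro j
    fin_cases j <;> simp [-mul_inv_rev, -mul_eq_mul_left_iff, -mul_eq_mul_right_iff, sEx, Ex.evals, chartEx, chartEq, sParam_a, fwd₅]
    · ring
    · field_simp (disch := first
      | assumption | exact ne_of_eq_of_ne (by ring1) h5 | exact ne_of_eq_of_ne (by ring1) h6)
    -- As for `s₁`, the new `y₂ y₃ - 1` is the old one up to a unit.
    · rw [show x 2 * ((x 3 + κ (A.a 5) * (x 2 * x 3 - 1)) / (1 + κ (A.a 5) * x 2 * (x 2 * x 3 - 1)))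
        - 1 = (x 2 * x 3 - 1) / (1 + κ (A.a 5) * x 2 * (x 2 * x 3 - 1)) by
          field_simp (disch := first | assumption | exact ne_of_eq_of_ne (by ring1) h5)
          ring]
      field_simp (disch := first
      | assumption | exact ne_of_eq_of_ne (by ring1) h5 | exact ne_of_eq_of_ne (by ring1) h6)
  · intro j
    fin_cases j <;> simp [chartEq, fwd₅]
  · simp [chartEq, fwd₅]
  · intro j
    fin_cases j <;> simp [chartEq, Ex.evals, fwd₅, bwd₅]
    ring

theorem boundaryOrd_sPull_five {A : Params} (b : Comp) (hb : b ≠ Sum.inr 3) (hb0 : b ≠ Sum.inr 4) :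
    boundaryOrd A b ∘ sPull 5 A = boundaryOrd (sParam 5 A) b := by
  by_cases hb1 : b = Sum.inr 0
  · rw [hb1, boundaryOrd_sPull_five_twelve]
  · exact boundaryOrd_sPull_five_aux b hb hb0 hb1

/-- The cancellations here and in the next three are those found for `s₁`. -/
theorem boundaryOrd_sPull_five_three {A : Params} (ha : A.a 5 ≠ 0) :
    boundaryOrd A (Sum.inr 3) ∘ sPull 5 A = ordAlong (X 3 - C (A.a 5)) := by
  have ha' := κ_ne_zero ha
  have h1 := x_ne_zero 1
  have h3 := x_ne_zero 3
  refine boundaryOrd_sPull_graph (A.a 5) ![y₀, (y₁ * y₃ + A.a 5) / y₃, y₂, y₃]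
    ![y₀, y₃, y₂, A.a 5 / y₁] (by simp) (by simp [algebraMap_C]) ?_ ?_ ?_ ?_
  · intro j
    fin_cases j <;> simp [sEx, Ex.evals, chartEx, chartEq, graphChart]
    · field_simp

  · intro j
    fin_cases j <;> simp [chartEq, h3]
  · simp [chartEq, h3]
  · intro j
    fin_cases j <;> simp [chartEq, Ex.evals, ha']

theorem boundaryOrd_sPull_five_four {A : Params} (ha : A.a 5 ≠ 0) :
    boundaryOrd A (Sum.inr 4) ∘ sPull 5 A = ordAlong (X 3) := by
  have ha' := κ_ne_zero ha
  have h1 := x_ne_zero 1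
  have h3 := x_ne_zero 3
  have h5 : x 1 * x 3 - κ (A.a 5) ≠ 0 :=
    (y₁ * y₃ - A.a 5).ne_zero 0 (by simp) (by simp [ha])
  rw [← sub_zero (X 3 : Poly)]
  refine boundaryOrd_sPull_graph (0 : ℂ) ![y₀, y₃ / (y₁ * y₃ - A.a 5), y₂, y₃]
    ![y₀, y₃, y₂, (0 : ℂ) - A.a 5 * y₁] (by simp) (by simp) ?_ ?_ ?_ ?_
  · intro j
    fin_cases j <;> simp [sEx, Ex.evals, chartEx, chartEq, graphChart]
    · field_simp (disch := first
      | assumption | exact ne_of_eq_of_ne (by ring1) h5)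
      ring
  · intro j
    fin_cases j <;> simp [chartEq, ha']
  · simp [chartEq, h3]
  · intro j
    fin_cases j <;> simp [chartEq, Ex.evals]
    field_simp

theorem ordAlong_sPull_five_zero {A : Params} (ha : A.a 5 ≠ 0) :
    ordAlong (X 3) ∘ sPull 5 A = boundaryOrd (sParam 5 A) (Sum.inr 4) := by
  have ha' := κ_ne_zero ha
  have h1 := x_ne_zero 1
  have h3 := x_ne_zero 3
  have h5 : x 3 + κ (A.a 5) ≠ 0 := x_add_const_ne_zero 3 (A.a 5)
  rw [← sub_zero (X 3 : Poly)]
  refine ordAlong_graph_sPull (0 : ℂ)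
    ![y₀, 1 / (y₁ * (y₃ + A.a 5)), y₂, y₁ * (y₃ + A.a 5)]
    ![y₀, y₃ / A.a 5, y₂, y₁] (by simp) (by simp) ?_ ?_ ?_ ?_
  · intro j
    fin_cases j <;> simp [sEx, Ex.evals, chartEx, chartEq, graphChart, sParam_a]
    · field_simp
    · field_simp
  · intro j
    fin_cases j <;> simp [h1, ha']
  · simp [chartEq, ha, h1]
  · intro j
    fin_cases j <;> simp [chartEq, Ex.evals, ha']

theorem ordAlong_sPull_five_neg {A : Params} (ha : A.a 5 ≠ 0) :
    ordAlong (X 3 + C (A.a 5)) ∘ sPull 5 A = boundaryOrd (sParam 5 A) (Sum.inr 3) := by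
  have ha' := κ_ne_zero ha
  have h1 := x_ne_zero 1
  have h3 := x_ne_zero 3
  have h5 : x 3 - κ (A.a 5) ≠ 0 := x_sub_const_ne_zero 3 (A.a 5)
  rw [← sub_neg_eq_add, ← C_neg]
  refine ordAlong_graph_sPull (Ex.con (-A.a 5))
    ![y₀, y₁ / (y₃ - A.a 5), y₂, (y₃ - A.a 5) / y₁]
    ![y₀, (0 : ℂ) - A.a 5 / y₃, y₂, y₁] (by simp) (by simp [algebraMap_C]) ?_ ?_ ?_ ?_
  · intro j
    fin_cases j <;> simp [sEx, Ex.evals, chartEx, chartEq, graphChart]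
    · field_simp (disch := first | assumption | exact ne_of_eq_of_ne (by ring1) h5)
      ring
    · field_simp
  · intro j
    fin_cases j <;> simp [h1, ha']
  · simp [chartEq, ha, h1]
  · intro j
    fin_cases j <;> simp [chartEq, Ex.evals]
    field_simp

end

/-! ### The generator `s₀`, which exchanges `ℰ₁₂` with `q₁ = q₂` -/

section

/-- The two corrections add up to a constant: `r̄₁ + r̄₂ = r₁ + r₂ - a₀`. The shift of `η` by `a₀`
compensates this, which is why `y₂` is unchanged at `5` and `6`. -/
def fwd₀ (A : Params) : Comp → Fin 4 → Ex
  | Sum.inl 0 => ![1, y₁, y₂ - A.a 0 / (1 - y₀ * y₁), y₃ + A.a 0 * y₀ * y₁ / (1 - y₀ * y₁)]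
  | Sum.inl 1 => ![y₀, 1, y₂ - A.a 0 * y₀ * y₁ / (y₀ * y₁ - 1), y₃ + A.a 0 / (y₀ * y₁ - 1)]
  | Sum.inl 2 => ![y₀, y₁, (y₀ - y₁) / (y₀ - y₁ - A.a 0 * y₀ * y₂),
      y₃ + A.a 0 * y₁ / (y₀ - y₁)]
  | Sum.inl 3 => ![y₀, y₁, y₂ - A.a 0 * y₀ / (y₀ - y₁),
      (y₀ - y₁) / (y₀ - y₁ + A.a 0 * y₁ * y₃)]
  | Sum.inr k =>
    match k with
    | 1 => ![1, y₁, y₂ - A.a 0 / (y₀ - y₁), y₃ + A.a 0 * y₁ / (y₀ - y₁)]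
    | 2 => ![1, y₁, y₂ - A.a 0 * y₁ / (1 - y₀ * y₁), y₃ + A.a 0 * y₀ * y₁ / (1 - y₀ * y₁)]
    | 3 => ![y₀, 1, y₂ - A.a 0 * y₀ / (y₀ - y₁), y₃ + A.a 0 / (y₀ - y₁)]
    | 4 => ![y₀, 1, y₂ - A.a 0 * y₀ * y₁ / (y₀ * y₁ - 1), y₃ + A.a 0 * y₀ / (y₀ * y₁ - 1)]
    | 5 => ![1, y₁, y₂, y₃ + A.a 0 * y₁ / (1 - y₁)]
    | 6 => ![1, y₁, y₂, y₃ + A.a 0 / (y₁ - 1)]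
    | 7 =>
      let q : Ex := A.t + y₀ * y₂
      ![y₀ * (q - y₁ - A.a 0 * q * y₂) / (q - y₁), y₁, (q - y₁) / (q - y₁ - A.a 0 * q * y₂),
        y₃ + A.a 0 * y₁ / (q - y₁)]
    | 8 =>
      let v : Ex := A.a 2 * A.t + y₀ * y₂
      let q : Ex := A.t + y₂ * v
      ![(y₀ - A.a 0 * q * v / (q - y₁)) * (q - y₁ - A.a 0 * q * y₂) / (q - y₁), y₁,
        (q - y₁) / (q - y₁ - A.a 0 * q * y₂), y₃ + A.a 0 * y₁ / (q - y₁)]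
    | 9 =>
      let p : Ex := 1 + y₁ * y₃
      ![y₀, y₁ * (y₀ - p + A.a 0 * p * y₃) / (y₀ - p), y₂ - A.a 0 * y₀ / (y₀ - p),
        (y₀ - p) / (y₀ - p + A.a 0 * p * y₃)]
    | 10 =>
      let v : Ex := A.a 4 + y₁ * y₃
      let p : Ex := 1 + y₃ * v
      ![y₀, (y₁ + A.a 0 * p * v / (y₀ - p)) * (y₀ - p + A.a 0 * p * y₃) / (y₀ - p),
        y₂ - A.a 0 * y₀ / (y₀ - p), (y₀ - p) / (y₀ - p + A.a 0 * p * y₃)]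
    | 11 =>
      let n : Ex := y₀ - A.a 0 * y₁ - A.a 0 * y₀ * y₂
      ![n, y₁, y₀ / n, y₃ * n / (y₀ + A.a 0 * y₁ * y₃)]
    | _ => Ex.var

def bwd₀ (A : Params) : Comp → Fin 4 → Ex
  | Sum.inl 0 => ![y₀, y₁, y₂ + A.a 0, y₃]
  | Sum.inl 1 => ![y₀, y₁, y₂, y₃ + A.a 0]
  | Sum.inl 2 => ![y₀, y₁, y₂, y₃ - A.a 0 * y₁ / (y₀ - y₁)]
  | Sum.inl 3 => ![y₀, y₁, y₂ + A.a 0 * y₀ / (y₀ - y₁), y₃]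
  | Sum.inr k =>
    match k with
    | 1 => ![y₀, y₁, y₂ - A.a 0 / y₁, y₃ + A.a 0]
    | 2 => ![y₀, y₁, y₂ + A.a 0 * y₁, y₃]
    | 3 => ![y₀, y₁, y₂ + A.a 0, y₃ - A.a 0 / y₀]
    | 4 => ![y₀, y₁, y₂, y₃ + A.a 0 * y₀]
    | 5 => ![y₀, y₁, y₂, y₃ - A.a 0 * y₁ / (1 - y₁)]
    | 6 => ![y₀, y₁, y₂, y₃ - A.a 0 / (y₁ - 1)]
    | 7 => ![y₀, y₁, y₂, y₃ - A.a 0 * y₁ / (A.t - y₁)]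
    | 8 => ![y₀ + A.a 0 * A.a 2 * A.t * A.t / (A.t - y₁), y₁, y₂,
        y₃ - A.a 0 * y₁ / (A.t - y₁)]
    | 9 => ![y₀, y₁, y₂ + A.a 0 * y₀ / (y₀ - 1), y₃]
    | 10 => ![y₀, y₁ - A.a 0 * A.a 4 / (y₀ - 1), y₂ + A.a 0 * y₀ / (y₀ - 1), y₃]
    | 11 => ![y₀ + A.a 0 * y₁, y₁, y₂, y₃ * (y₀ + A.a 0 * y₁) / (y₀ - A.a 0 * y₁ * y₃)]
    | _ => Ex.var

/-- For `i = 0` the neighbour `i - 1` is normalised to `-1`; these decide the resulting index tests.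
-/
theorem five_eq_neg_one : ((5 : Fin 6) = -1) = True := by decide

theorem two_eq_neg_one : ((2 : Fin 6) = -1) = False := by decide

theorem four_eq_neg_one : ((4 : Fin 6) = -1) = False := by decide

theorem three_eq_neg_one : ((3 : Fin 6) = -1) = False := by decide

set_option maxHeartbeats 4000000 in
theorem boundaryOrd_sPull_zero_inl {A : Params} (k : Fin 4) :
    boundaryOrd A (Sum.inl k) ∘ sPull 0 A = boundaryOrd (sParam 0 A) (Sum.inl k) := by
  have h0 := x_ne_zero 0
  have h1 := x_ne_zero 1
  have h2 := x_ne_zero 2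
  have h3 := x_ne_zero 3
  have h4 : x 0 - x 1 ≠ 0 := x_sub_x_ne_zero (by decide)
  have h5 : 1 - x 0 * x 1 ≠ 0 := by simpa using (1 - y₀ * y₁).ne_zero 0 (by simp) (by simp)
  have h6 : x 0 * x 1 - 1 ≠ 0 := by simpa using (y₀ * y₁ - 1).ne_zero 0 (by simp) (by simp)
  have h7 : x 0 - x 1 - κ (A.a 0) * x 0 * x 2 ≠ 0 :=
    (y₀ - y₁ - A.a 0 * y₀ * y₂).ne_zero ![1, 0, 0, 0] (by simp) (by simp)
  have h8 : x 0 - x 1 + κ (A.a 0) * x 1 * x 3 ≠ 0 :=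
    (y₀ - y₁ + A.a 0 * y₁ * y₃).ne_zero ![1, 0, 0, 0] (by simp) (by simp)
  refine boundaryOrd_sPull _ (fwd₀ A (Sum.inl k)) (bwd₀ A (Sum.inl k)) ?_ ?_ ?_ ?_
  · intro j
    fin_cases k <;> fin_cases j
    all_goals simp [-mul_eq_mul_left_iff, -mul_eq_mul_right_iff, sEx, Ex.evals, chartEx, chartEq,
      
      fwd₀]
    all_goals field_simp (disch := first
      | assumption | exact ne_of_eq_of_ne (by ring1) h4 | exact ne_of_eq_of_ne (by ring1) h5
      | exact ne_of_eq_of_ne (by ring1) h6 | exact ne_of_eq_of_ne (by ring1) h7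
      | exact ne_of_eq_of_ne (by ring1) h8)
  · intro j
    fin_cases k <;> fin_cases j <;> simp [chartEq, fwd₀, *]
  · fin_cases k <;> simp [chartEq, fwd₀, *]
  · intro j
    fin_cases k <;> fin_cases j
    all_goals simp [chartEq, Ex.evals, fwd₀, bwd₀, *]
    all_goals field_simp
    all_goals ring

set_option maxHeartbeats 4000000 in
theorem boundaryOrd_sPull_zero_inr {A : Params} (k : Fin 12) (hk : k ≤ 6) (hk0 : k ≠ 0) :
    boundaryOrd A (Sum.inr k) ∘ sPull 0 A = boundaryOrd (sParam 0 A) (Sum.inr k) := by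
  have h0 := x_ne_zero 0
  have h1 := x_ne_zero 1
  have h2 := x_ne_zero 2
  have h3 := x_ne_zero 3
  have h4 : x 0 - x 1 ≠ 0 := x_sub_x_ne_zero (by decide)
  have h5 : 1 - x 0 * x 1 ≠ 0 := by simpa using (1 - y₀ * y₁).ne_zero 0 (by simp) (by simp)
  have h6 : x 0 * x 1 - 1 ≠ 0 := by simpa using (y₀ * y₁ - 1).ne_zero 0 (by simp) (by simp)
  have h7 : 1 - x 1 ≠ 0 := by simpa using (1 - y₁).ne_zero 0 (by simp) (by simp)
  have h8 : x 1 - 1 ≠ 0 := x_sub_one_ne_zero 1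
  refine boundaryOrd_sPull _ (fwd₀ A (Sum.inr k)) (bwd₀ A (Sum.inr k)) ?_ ?_ ?_ ?_
  · intro j
    fin_cases k <;> first | exact absurd rfl hk0 | exact absurd hk (by decide) | fin_cases j
    all_goals simp [-mul_eq_mul_left_iff, -mul_eq_mul_right_iff, sEx, Ex.evals, chartEx, chartEq,
      sParam_a, sParam_zero_η, five_eq_neg_one,
      three_eq_neg_one, fwd₀]
    all_goals field_simp (disch := first
      | assumption | exact ne_of_eq_of_ne (by ring1) h4 | exact ne_of_eq_of_ne (by ring1) h5
      | exact ne_of_eq_of_ne (by ring1) h6 | exact ne_of_eq_of_ne (by ring1) h7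
      | exact ne_of_eq_of_ne (by ring1) h8 | exact ne_of_eq_of_ne (by ring1) (mul_ne_zero h0 h8)
      | exact ne_of_eq_of_ne (by ring1) (mul_ne_zero h0 h7))
    all_goals ring
  · intro j
    fin_cases k <;> first | exact absurd rfl hk0 | exact absurd hk (by decide) | fin_cases j
    all_goals simp [chartEq, fwd₀, *]
  · fin_cases k <;> first | exact absurd rfl hk0 | exact absurd hk (by decide) | skip
    all_goals simp [chartEq, fwd₀, *]
  · intro j
    fin_cases k <;> first | exact absurd rfl hk0 | exact absurd hk (by decide) | fin_cases j
    all_goals simp [chartEq, Ex.evals, fwd₀, bwd₀, *]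
    all_goals field_simp
    all_goals ring

theorem boundaryOrd_sPull_zero_seven {A : Params} :
    boundaryOrd A (Sum.inr 7) ∘ sPull 0 A = boundaryOrd (sParam 0 A) (Sum.inr 7) := by
  have h2 := x_ne_zero 2
  have h4 : κ A.t - x 1 ≠ 0 := (A.t - y₁).ne_zero ![0, A.t - 1, 0, 0] (by simp) (by simp)
  have h5 : κ A.t + x 0 * x 2 - x 1 ≠ 0 :=
    (A.t + y₀ * y₂ - y₁).ne_zero ![0, A.t - 1, 0, 0] (by simp) (by simp)
  have h6 : κ A.t + x 0 * x 2 - x 1 - κ (A.a 0) * (κ A.t + x 0 * x 2) * x 2 ≠ 0 :=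
    (A.t + y₀ * y₂ - y₁ - A.a 0 * (A.t + y₀ * y₂) * y₂).ne_zero ![0, A.t - 1, 0, 0]
      (by simp) (by simp)
  refine boundaryOrd_sPull _ (fwd₀ A (Sum.inr 7)) (bwd₀ A (Sum.inr 7)) ?_ ?_ ?_ ?_
  · intro j
    fin_cases j <;> simp [-mul_eq_mul_left_iff, -mul_eq_mul_right_iff, sEx, Ex.evals, chartEx,
      chartEq, sParam_t, fwd₀]
    all_goals field_simp (disch := first
      | assumption | exact ne_of_eq_of_ne (by ring1) h5 | exact ne_of_eq_of_ne (by ring1) h6)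
  · intro j
    fin_cases j <;> simp [chartEq, fwd₀, *]
  · simp [chartEq, fwd₀, *]
  · intro j
    fin_cases j <;> simp [chartEq, Ex.evals, fwd₀, bwd₀, *]

theorem boundaryOrd_sPull_zero_eight {A : Params} :
    boundaryOrd A (Sum.inr 8) ∘ sPull 0 A = boundaryOrd (sParam 0 A) (Sum.inr 8) := by
  have h2 := x_ne_zero 2
  have h4 : κ A.t - x 1 ≠ 0 := (A.t - y₁).ne_zero ![0, A.t - 1, 0, 0] (by simp) (by simp)
  have h5 : κ A.t + x 2 * (κ (A.a 2) * κ A.t + x 0 * x 2) - x 1 ≠ 0 := by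
    simpa using (A.t + y₂ * (A.a 2 * A.t + y₀ * y₂) - y₁).ne_zero ![0, A.t - 1, 0, 0]
      (by simp) (by simp)
  have h6 : κ A.t + x 2 * (κ (A.a 2) * κ A.t + x 0 * x 2) - x 1 - κ (A.a 0) *
      (κ A.t + x 2 * (κ (A.a 2) * κ A.t + x 0 * x 2)) * x 2 ≠ 0 := by
    simpa using (A.t + y₂ * (A.a 2 * A.t + y₀ * y₂) - y₁ - A.a 0 *
      (A.t + y₂ * (A.a 2 * A.t + y₀ * y₂)) * y₂).ne_zero ![0, A.t - 1, 0, 0] (by simp) (by simp)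
  refine boundaryOrd_sPull _ (fwd₀ A (Sum.inr 8)) (bwd₀ A (Sum.inr 8)) ?_ ?_ ?_ ?_
  · intro j
    fin_cases j <;> simp [-mul_eq_mul_left_iff, -mul_eq_mul_right_iff, sEx, Ex.evals, chartEx,
      chartEq, sParam_a, sParam_t, two_eq_neg_one, fwd₀]
    all_goals field_simp (disch := first
      | assumption | exact ne_of_eq_of_ne (by ring1) h5 | exact ne_of_eq_of_ne (by ring1) h6)
    all_goals ring
  · intro j
    fin_cases j <;> simp [chartEq, fwd₀, *]
  · simp [chartEq, fwd₀, *]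
  · intro j
    fin_cases j <;> simp [chartEq, Ex.evals, fwd₀, bwd₀, *]
    all_goals field_simp
    all_goals ring

theorem boundaryOrd_sPull_zero_nine {A : Params} :
    boundaryOrd A (Sum.inr 9) ∘ sPull 0 A = boundaryOrd (sParam 0 A) (Sum.inr 9) := by
  have h3 := x_ne_zero 3
  have h4 := x_sub_one_ne_zero 0
  have h5 : x 0 - (1 + x 1 * x 3) ≠ 0 := by
    simpa using (y₀ - (1 + y₁ * y₃)).ne_zero 0 (by simp) (by simp)
  have h6 : x 0 - (1 + x 1 * x 3) + κ (A.a 0) * (1 + x 1 * x 3) * x 3 ≠ 0 := by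
    simpa using (y₀ - (1 + y₁ * y₃) + A.a 0 * (1 + y₁ * y₃) * y₃).ne_zero 0 (by simp) (by simp)
  refine boundaryOrd_sPull _ (fwd₀ A (Sum.inr 9)) (bwd₀ A (Sum.inr 9)) ?_ ?_ ?_ ?_
  · intro j
    fin_cases j <;> simp [-mul_eq_mul_left_iff, -mul_eq_mul_right_iff, sEx, Ex.evals, chartEx,
      chartEq, fwd₀]
    all_goals field_simp (disch := first
      | assumption | exact ne_of_eq_of_ne (by ring1) h5 | exact ne_of_eq_of_ne (by ring1) h6)
  · intro j
    fin_cases j <;> simp [chartEq, fwd₀, *]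
  · simp [chartEq, fwd₀, *]
  · intro j
    fin_cases j <;> simp [chartEq, Ex.evals, fwd₀, bwd₀, *]

theorem boundaryOrd_sPull_zero_ten {A : Params} :
    boundaryOrd A (Sum.inr 10) ∘ sPull 0 A = boundaryOrd (sParam 0 A) (Sum.inr 10) := by
  have h3 := x_ne_zero 3
  have h4 := x_sub_one_ne_zero 0
  have h5 : x 0 - (1 + x 3 * (κ (A.a 4) + x 1 * x 3)) ≠ 0 := by
    simpa using (y₀ - (1 + y₃ * (A.a 4 + y₁ * y₃))).ne_zero 0 (by simp) (by simp)
  have h6 : x 0 - (1 + x 3 * (κ (A.a 4) + x 1 * x 3)) + κ (A.a 0) *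
      (1 + x 3 * (κ (A.a 4) + x 1 * x 3)) * x 3 ≠ 0 := by
    simpa using (y₀ - (1 + y₃ * (A.a 4 + y₁ * y₃)) + A.a 0 *
      (1 + y₃ * (A.a 4 + y₁ * y₃)) * y₃).ne_zero 0 (by simp) (by simp)
  refine boundaryOrd_sPull _ (fwd₀ A (Sum.inr 10)) (bwd₀ A (Sum.inr 10)) ?_ ?_ ?_ ?_
  · intro j
    fin_cases j <;> simp [-mul_eq_mul_left_iff, -mul_eq_mul_right_iff, sEx, Ex.evals, chartEx,
      chartEq, sParam_a, four_eq_neg_one, fwd₀]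
    all_goals field_simp (disch := first
      | assumption | exact ne_of_eq_of_ne (by ring1) h5 | exact ne_of_eq_of_ne (by ring1) h6)
    all_goals ring
  · intro j
    fin_cases j <;> simp [chartEq, fwd₀, *]
  · simp [chartEq, fwd₀, *]
  · intro j
    fin_cases j <;> simp [chartEq, Ex.evals, fwd₀, bwd₀, *]

theorem boundaryOrd_sPull_zero_eleven {A : Params} :
    boundaryOrd A (Sum.inr 11) ∘ sPull 0 A = boundaryOrd (sParam 0 A) (Sum.inr 11) := by
  have h0 := x_ne_zero 0
  have h1 := x_ne_zero 1
  have h2 := x_ne_zero 2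
  have h3 := x_ne_zero 3
  have h4 : x 0 - κ (A.a 0) * x 1 - κ (A.a 0) * x 0 * x 2 ≠ 0 :=
    (y₀ - A.a 0 * y₁ - A.a 0 * y₀ * y₂).ne_zero ![1, 0, 0, 0] (by simp) (by simp)
  have h5 : x 0 + κ (A.a 0) * x 1 * x 3 ≠ 0 :=
    (y₀ + A.a 0 * y₁ * y₃).ne_zero ![1, 0, 0, 0] (by simp) (by simp)
  have h6 : x 0 - κ (A.a 0) * x 1 ≠ 0 :=
    (y₀ - A.a 0 * y₁).ne_zero ![1, 0, 0, 0] (by simp) (by simp)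
  refine boundaryOrd_sPull _ (fwd₀ A (Sum.inr 11)) (bwd₀ A (Sum.inr 11)) ?_ ?_ ?_ ?_
  · intro j
    fin_cases j <;> simp [-mul_eq_mul_left_iff, -mul_eq_mul_right_iff, sEx, Ex.evals, chartEx,
      chartEq, fwd₀]
    all_goals field_simp (disch := first
      | assumption | exact ne_of_eq_of_ne (by ring1) h4 | exact ne_of_eq_of_ne (by ring1) h5)
    all_goals ring
  · intro j
    fin_cases j <;> simp [chartEq, fwd₀, *]
  · simp [chartEq, fwd₀, *]
  · intro j
    fin_cases j <;> simp [chartEq, Ex.evals, fwd₀, bwd₀, *]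
    -- The denominator in the composite with the inverse is a product of factors already known to be
    -- nonzero.
    rw [show x 0 - κ (A.a 0) * x 1 - κ (A.a 0) * x 1 * (x 3 * (x 0 - κ (A.a 0) * x 1) /
      (x 0 + κ (A.a 0) * x 1 * x 3)) =
        (x 0 - κ (A.a 0) * x 1) * x 0 / (x 0 + κ (A.a 0) * x 1 * x 3) by field_simp; ring]
    field_simp (disch := first | assumption | exact ne_of_eq_of_ne (by ring1) h5)

theorem boundaryOrd_sPull_zero {A : Params} (b : Comp) (hb : b ≠ Sum.inr 0) :
    boundaryOrd A b ∘ sPull 0 A = boundaryOrd (sParam 0 A) b := by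
  rcases b with k | k
  · exact boundaryOrd_sPull_zero_inl k
  · have hk : k ≠ 0 := fun h => hb (by rw [h])
    by_cases h6 : k ≤ 6
    · exact boundaryOrd_sPull_zero_inr k h6 hk
    · have h7 : k = 7 ∨ k = 8 ∨ k = 9 ∨ k = 10 ∨ k = 11 := by
        clear hb hk
        decide +revert
      obtain rfl | rfl | rfl | rfl | rfl := h7
      exacts [boundaryOrd_sPull_zero_seven, boundaryOrd_sPull_zero_eight,
        boundaryOrd_sPull_zero_nine, boundaryOrd_sPull_zero_ten, boundaryOrd_sPull_zero_eleven]

/-- With `q₁ - q₂ = y₂ g`, the poles of `r₁` and `r₂` are both cancelled by the corrections. This is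
the combined effect of the two conditions `v = -1` and `w = a₀ q₂` that define `C₁₂`. -/
theorem boundaryOrd_sPull_zero_twelve {A : Params} (ha : A.a 0 ≠ 0) :
    boundaryOrd A (Sum.inr 0) ∘ sPull 0 A = ordAlong (X 0 - X 1) := by
  have ha' := κ_ne_zero ha
  have h1 := x_ne_zero 1
  have h2 := x_ne_zero 2
  have h4 : κ (A.a 0) * x 1 + x 0 * x 2 ≠ 0 :=
    (A.a 0 * y₁ + y₀ * y₂).ne_zero ![0, 1, 0, 0] (by simp) (by simp [ha])
  have h5 : x 2 * x 3 - 1 ≠ 0 := by simpa using (y₂ * y₃ - 1).ne_zero 0 (by simp) (by simp)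
  let g : Ex := A.a 0 * y₁ + y₀ * y₂
  refine boundaryOrd_sPull_graph y₁ ![g, y₁, (y₀ - A.a 0 * g) / g,
      (y₀ + A.a 0 * y₁ * y₃) / (g * (y₂ * y₃ - 1))]
    ![(y₂ + A.a 0) * A.a 0 * y₁, y₁, y₀, (0 : ℂ) - y₃ - y₂ - A.a 0] (by simp) (by simp [x]) ?_ ?_ ?_ ?_
  · intro j
    fin_cases j <;> simp [-mul_inv_rev, -mul_eq_mul_left_iff, -mul_eq_mul_right_iff, sEx, Ex.evals,
      chartEx, chartEq, graphChart, g]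
    all_goals field_simp (disch := first
      | assumption | exact ne_of_eq_of_ne (by ring1) h4 | exact ne_of_eq_of_ne (by ring1) h5)
    all_goals ring
  · intro j
    fin_cases j <;> simp [chartEq, g, *]
  · simp [chartEq, g, *]
  · intro j
    fin_cases j <;> simp [chartEq, Ex.evals, g, *]
    all_goals field_simp
    all_goals ring

/-- On `q₁ = q₂` both `r̄₁` and `r̄₂` acquire simple poles with opposite polar parts, and `(q₁ - q₂)
r̄₁ = -a₀ q₂`: the conditions for `C₁₂` in the target. -/
theorem ordAlong_sPull_zero {A : Params} (ha : A.a 0 ≠ 0) :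
    ordAlong (X 0 - X 1) ∘ sPull 0 A = boundaryOrd (sParam 0 A) (Sum.inr 0) := by
  have ha' := κ_ne_zero ha
  have h0 := x_ne_zero 0
  have h1 := x_ne_zero 1
  have h4 : x 0 * x 2 - κ (A.a 0) * x 1 - κ (A.a 0) * x 0 ≠ 0 :=
    (y₀ * y₂ - A.a 0 * y₁ - A.a 0 * y₀).ne_zero ![0, 1, 0, 0] (by simp) (by simp [ha])
  have h5 : x 0 * x 3 + κ (A.a 0) * x 1 ≠ 0 :=
    (y₀ * y₃ + A.a 0 * y₁).ne_zero ![0, 1, 0, 0] (by simp) (by simp [ha])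
  let n : Ex := y₀ * y₂ - A.a 0 * y₁ - A.a 0 * y₀
  refine ordAlong_graph_sPull y₁ ![(y₂ - A.a 0) * n, y₁, 1 / n,
      (y₂ + y₃ - A.a 0) * n / (y₀ * y₃ + A.a 0 * y₁)]
    ![y₂, y₁, A.a 0 - y₀ / (A.a 0 * y₁), y₀ / (A.a 0 * y₁) - y₃] (by simp) (by simp [x]) ?_ ?_ ?_ ?_
  · intro j
    fin_cases j <;> simp [-mul_inv_rev, -mul_eq_mul_left_iff, -mul_eq_mul_right_iff, sEx, Ex.evals,
      chartEx, chartEq, graphChart, sParam_a, n]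
    all_goals field_simp (disch := first
      | assumption | exact ne_of_eq_of_ne (by ring1) h4 | exact ne_of_eq_of_ne (by ring1) h5)
    all_goals ring
  · intro j
    fin_cases j <;> simp [n, *]
  · simp [chartEq, n, *]
  · intro j
    fin_cases j <;> simp [chartEq, Ex.evals, n, *]
    all_goals field_simp
    all_goals ring

end

/-! ### The generator `s₃`, which exchanges `ℰ₅` and `ℰ₆` with hypersurfaces `r₁ + r₂ = const` -/

section

/-- Both `q₁` and `q₂` are multiplied by `(r₁ + r₂ + η) / (r₁ + r₂ + η - a₃)`. The local names `s`
and `N` stand for the numerator, in the second case after clearing the pole of `r₁` or `r₂`. The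
default is a placeholder for `5` and `6`. -/
def fwd₃ (A : Params) : Comp → Fin 4 → Ex
  | Sum.inl 0 =>
    let s : Ex := y₂ + y₃ + A.η
    ![(s - A.a 3) / s, y₁ * s / (s - A.a 3), y₂, y₃]
  | Sum.inl 1 =>
    let s : Ex := y₂ + y₃ + A.η
    ![y₀ * s / (s - A.a 3), (s - A.a 3) / s, y₂, y₃]
  | Sum.inl 2 =>
    let N : Ex := 1 + y₂ * (y₃ + A.η)
    ![y₀ * N / (N - A.a 3 * y₂), y₁ * N / (N - A.a 3 * y₂), 1, y₃]
  | Sum.inl 3 =>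
    let N : Ex := 1 + y₃ * (y₂ + A.η)
    ![y₀ * N / (N - A.a 3 * y₃), y₁ * N / (N - A.a 3 * y₃), y₂, 1]
  | Sum.inr k =>
    match k with
    | 1 =>
      let s : Ex := y₀ * y₂ + y₃ + A.η
      ![s / (s - A.a 3), y₁ * s / (s - A.a 3), y₂ * (s - A.a 3) / s, y₃]
    | 2 =>
      let s : Ex := y₀ * y₂ - A.a 1 + y₃ + A.η
      ![(s - A.a 3) / s, y₁ * s / (s - A.a 3), y₂ * s / (s - A.a 3), y₃]
    | 3 =>
      let s : Ex := y₂ + y₁ * y₃ + A.η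
      ![y₀ * s / (s - A.a 3), s / (s - A.a 3), y₂, y₃ * (s - A.a 3) / s]
    | 4 =>
      let s : Ex := y₂ + y₁ * y₃ - A.a 5 + A.η
      ![y₀ * s / (s - A.a 3), (s - A.a 3) / s, y₂, y₃ * s / (s - A.a 3)]
    | 7 =>
      let N : Ex := 1 + y₂ * (y₃ + A.η)
      ![y₀ + A.a 3 * (A.t + y₀ * y₂) / (N - A.a 3 * y₂), y₁ * N / (N - A.a 3 * y₂), 1, y₃]
    | 8 =>
      let N : Ex := 1 + y₂ * (y₃ + A.η)
      ![y₀ + A.a 3 * (A.a 2 * A.t + y₀ * y₂ - A.t * (y₃ + A.η - A.a 3)) / (N - A.a 3 * y₂),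
        y₁ * N / (N - A.a 3 * y₂), 1, y₃]
    | 9 =>
      let N : Ex := 1 + y₃ * (y₂ + A.η)
      ![y₀ * N / (N - A.a 3 * y₃), y₁ + A.a 3 * (1 + y₁ * y₃) / (N - A.a 3 * y₃), y₂, 1]
    | 10 =>
      let N : Ex := 1 + y₃ * (y₂ + A.η)
      ![y₀ * N / (N - A.a 3 * y₃),
        y₁ + A.a 3 * (A.a 4 + y₁ * y₃ - (y₂ + A.η - A.a 3)) / (N - A.a 3 * y₃), y₂, 1]
    | 11 =>
      let N : Ex := 1 + y₃ + A.η * y₂ * y₃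
      ![y₀ * N / (N - A.a 3 * y₂ * y₃), y₁ * N / (N - A.a 3 * y₂ * y₃), 1, y₃]
    | 0 =>
      let N : Ex := y₃ + A.η * (y₂ * y₃ - 1)
      ![y₀ * N / (N - A.a 3 * (y₂ * y₃ - 1)), y₁ * N / (N - A.a 3 * (y₂ * y₃ - 1)), 1, y₃]
    | _ => Ex.var

def bwd₃ (A : Params) : Comp → Fin 4 → Ex
  | Sum.inl 0 =>
    let s : Ex := y₂ + y₃ + A.η
    ![y₀, y₁ * (s - A.a 3) / s, y₂, y₃]
  | Sum.inl 1 =>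
    let s : Ex := y₂ + y₃ + A.η
    ![y₀ * (s - A.a 3) / s, y₁, y₂, y₃]
  | Sum.inr k =>
    match k with
    | 1 =>
      let s : Ex := y₃ + A.η
      ![y₀, y₁ * (s - A.a 3) / s, y₂ * s / (s - A.a 3), y₃]
    | 2 =>
      let s : Ex := y₃ - A.a 1 + A.η
      ![y₀, y₁ * (s - A.a 3) / s, y₂ * (s - A.a 3) / s, y₃]
    | 3 =>
      let s : Ex := y₂ + A.η
      ![y₀ * (s - A.a 3) / s, y₁, y₂, y₃ * s / (s - A.a 3)]
    | 4 =>
      let s : Ex := y₂ - A.a 5 + A.η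
      ![y₀ * (s - A.a 3) / s, y₁, y₂, y₃ * (s - A.a 3) / s]
    | 7 => ![y₀ - A.a 3 * A.t, y₁, y₂, y₃]
    | 8 => ![y₀ - A.a 3 * (A.a 2 * A.t - A.t * (y₃ + A.η - A.a 3)), y₁, y₂, y₃]
    | 9 => ![y₀, y₁ - A.a 3, y₂, y₃]
    | 10 => ![y₀, y₁ - A.a 3 * (A.a 4 - (y₂ + A.η - A.a 3)), y₂, y₃]
    | 0 => ![y₀ * (y₃ - A.η + A.a 3) / (y₃ - A.η), y₁ * (y₃ - A.η + A.a 3) / (y₃ - A.η), y₂, y₃]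
    | _ => Ex.var
  | _ => Ex.var

set_option maxHeartbeats 4000000 in
theorem boundaryOrd_sPull_three_inl {A : Params} (k : Fin 4) :
    boundaryOrd A (Sum.inl k) ∘ sPull 3 A = boundaryOrd (sParam 3 A) (Sum.inl k) := by
  have h0 := x_ne_zero 0
  have h1 := x_ne_zero 1
  have h2 := x_ne_zero 2
  have h3 := x_ne_zero 3
  have h4 : x 2 + x 3 + κ A.η ≠ 0 :=
    (y₂ + y₃ + A.η).ne_zero ![0, 0, 0, 1 - A.η] (by simp) (by simp)
  have h5 : x 2 + x 3 + κ A.η - κ (A.a 3) ≠ 0 :=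
    (y₂ + y₃ + A.η - A.a 3).ne_zero ![0, 0, 0, 1 - A.η + A.a 3] (by simp) (by simp; ring_nf; simp)
  have h6 : 1 + x 2 * (x 3 + κ A.η) ≠ 0 := by
    simpa using (1 + y₂ * (y₃ + A.η)).ne_zero 0 (by simp) (by simp)
  have h7 : 1 + x 2 * (x 3 + κ A.η) - κ (A.a 3) * x 2 ≠ 0 := by
    simpa using (1 + y₂ * (y₃ + A.η) - A.a 3 * y₂).ne_zero 0 (by simp) (by simp)
  have h8 : 1 + x 3 * (x 2 + κ A.η) ≠ 0 := by
    simpa using (1 + y₃ * (y₂ + A.η)).ne_zero 0 (by simp) (by simp)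
  have h9 : 1 + x 3 * (x 2 + κ A.η) - κ (A.a 3) * x 3 ≠ 0 := by
    simpa using (1 + y₃ * (y₂ + A.η) - A.a 3 * y₃).ne_zero 0 (by simp) (by simp)
  refine boundaryOrd_sPull _ (fwd₃ A (Sum.inl k)) (bwd₃ A (Sum.inl k)) ?_ ?_ ?_ ?_
  · intro j
    fin_cases k <;> fin_cases j
    all_goals simp [-mul_inv_rev, -mul_eq_mul_left_iff, -mul_eq_mul_right_iff, sEx, Ex.evals,
      chartEx, chartEq, fwd₃]
    all_goals field_simp (disch := first
      | assumption | exact ne_of_eq_of_ne (by ring1) h4 | exact ne_of_eq_of_ne (by ring1) h5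
      | exact ne_of_eq_of_ne (by ring1) h6 | exact ne_of_eq_of_ne (by ring1) h7
      | exact ne_of_eq_of_ne (by ring1) h8 | exact ne_of_eq_of_ne (by ring1) h9)
    all_goals ring
  · intro j
    fin_cases k <;> fin_cases j <;> simp [chartEq, fwd₃, *]
  · fin_cases k <;> simp [chartEq, fwd₃, *]
  · intro j
    fin_cases k <;> fin_cases j
    all_goals simp [chartEq, Ex.evals, fwd₃, bwd₃, *]

set_option maxHeartbeats 4000000 in
theorem boundaryOrd_sPull_three_inr_one {A : Params} (k : Fin 12) (hk : k ≤ 4) (hk0 : k ≠ 0) :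
    boundaryOrd A (Sum.inr k) ∘ sPull 3 A = boundaryOrd (sParam 3 A) (Sum.inr k) := by
  have h0 := x_ne_zero 0
  have h1 := x_ne_zero 1
  have h4 : x 0 * x 2 + x 3 + κ A.η ≠ 0 :=
    (y₀ * y₂ + y₃ + A.η).ne_zero ![0, 0, 0, 1 - A.η] (by simp) (by simp)
  have h5 : x 0 * x 2 + x 3 + κ A.η - κ (A.a 3) ≠ 0 :=
    (y₀ * y₂ + y₃ + A.η - A.a 3).ne_zero ![0, 0, 0, 1 - A.η + A.a 3] (by simp)
      (by simp; ring_nf; simp)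
  have h6 : x 0 * x 2 - κ (A.a 1) + x 3 + κ A.η ≠ 0 :=
    (y₀ * y₂ - A.a 1 + y₃ + A.η).ne_zero ![0, 0, 0, 1 - A.η + A.a 1] (by simp)
      (by simp)
  have h7 : x 0 * x 2 - κ (A.a 1) + x 3 + κ A.η - κ (A.a 3) ≠ 0 :=
    (y₀ * y₂ - A.a 1 + y₃ + A.η - A.a 3).ne_zero ![0, 0, 0, 1 - A.η + A.a 1 + A.a 3] (by simp)
      (by simp; ring_nf; simp)
  have h8 : x 2 + x 1 * x 3 + κ A.η ≠ 0 :=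
    (y₂ + y₁ * y₃ + A.η).ne_zero ![0, 0, 1 - A.η, 0] (by simp) (by simp)
  have h9 : x 2 + x 1 * x 3 + κ A.η - κ (A.a 3) ≠ 0 :=
    (y₂ + y₁ * y₃ + A.η - A.a 3).ne_zero ![0, 0, 1 - A.η + A.a 3, 0] (by simp)
      (by simp; ring_nf; simp)
  have h10 : x 2 + x 1 * x 3 - κ (A.a 5) + κ A.η ≠ 0 :=
    (y₂ + y₁ * y₃ - A.a 5 + A.η).ne_zero ![0, 0, 1 - A.η + A.a 5, 0] (by simp)
      (by simp)
  have h11 : x 2 + x 1 * x 3 - κ (A.a 5) + κ A.η - κ (A.a 3) ≠ 0 :=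
    (y₂ + y₁ * y₃ - A.a 5 + A.η - A.a 3).ne_zero ![0, 0, 1 - A.η + A.a 5 + A.a 3, 0] (by simp)
      (by simp; ring_nf; simp)
  have g4 : x 3 + κ A.η ≠ 0 :=
    (y₃ + A.η).ne_zero ![0, 0, 0, 1 - A.η] (by simp) (by simp)
  have g5 : x 3 + κ A.η - κ (A.a 3) ≠ 0 :=
    (y₃ + A.η - A.a 3).ne_zero ![0, 0, 0, 1 - A.η + A.a 3] (by simp) (by simp; ring_nf; simp)
  have g6 : -κ (A.a 1) + x 3 + κ A.η ≠ 0 := by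
    simpa using ((0 : ℂ) - A.a 1 + y₃ + A.η).ne_zero ![0, 0, 0, 1 - A.η + A.a 1] (by simp)
      (by simp)
  have g7 : -κ (A.a 1) + x 3 + κ A.η - κ (A.a 3) ≠ 0 := by
    simpa using ((0 : ℂ) - A.a 1 + y₃ + A.η - A.a 3).ne_zero ![0, 0, 0, 1 - A.η + A.a 1 + A.a 3]
      (by simp) (by simp; ring_nf; simp)
  have g8 : x 2 + κ A.η ≠ 0 :=
    (y₂ + A.η).ne_zero ![0, 0, 1 - A.η, 0] (by simp) (by simp)
  have g9 : x 2 + κ A.η - κ (A.a 3) ≠ 0 :=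
    (y₂ + A.η - A.a 3).ne_zero ![0, 0, 1 - A.η + A.a 3, 0] (by simp) (by simp; ring_nf; simp)
  have g10 : x 2 - κ (A.a 5) + κ A.η ≠ 0 :=
    (y₂ - A.a 5 + A.η).ne_zero ![0, 0, 1 - A.η + A.a 5, 0] (by simp) (by simp)
  have g11 : x 2 - κ (A.a 5) + κ A.η - κ (A.a 3) ≠ 0 :=
    (y₂ - A.a 5 + A.η - A.a 3).ne_zero ![0, 0, 1 - A.η + A.a 5 + A.a 3, 0] (by simp)
      (by simp; ring_nf; simp)
  refine boundaryOrd_sPull _ (fwd₃ A (Sum.inr k)) (bwd₃ A (Sum.inr k)) ?_ ?_ ?_ ?_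
  · intro j
    fin_cases k <;> first | exact absurd rfl hk0 | exact absurd hk (by decide) | fin_cases j
    all_goals simp [-mul_eq_mul_left_iff, -mul_eq_mul_right_iff, sEx, Ex.evals, chartEx, chartEq,
      sParam_a, fwd₃]
    all_goals field_simp (disch := first
      | assumption | exact ne_of_eq_of_ne (by ring1) h4 | exact ne_of_eq_of_ne (by ring1) h5
      | exact ne_of_eq_of_ne (by ring1) h6 | exact ne_of_eq_of_ne (by ring1) h7
      | exact ne_of_eq_of_ne (by ring1) h8 | exact ne_of_eq_of_ne (by ring1) h9
      | exact ne_of_eq_of_ne (by ring1) h10 | exact ne_of_eq_of_ne (by ring1) h11)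
    all_goals ring
  · intro j
    fin_cases k <;> first | exact absurd rfl hk0 | exact absurd hk (by decide) | fin_cases j
    all_goals simp [chartEq, fwd₃, *]
  · fin_cases k <;> first | exact absurd rfl hk0 | exact absurd hk (by decide) | skip
    all_goals simp [chartEq, fwd₃, *]
  · intro j
    fin_cases k <;> first | exact absurd rfl hk0 | exact absurd hk (by decide) | fin_cases j
    all_goals simp [chartEq, Ex.evals, fwd₃, bwd₃, *]
    all_goals field_simp (disch := first
      | assumption | exact ne_of_eq_of_ne (by ring1) g6 | exact ne_of_eq_of_ne (by ring1) g7)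
    all_goals ring

set_option maxHeartbeats 4000000 in
theorem boundaryOrd_sPull_three_inr_seven {A : Params} (k : Fin 12) (hk : 7 ≤ k) (hk0 : k ≤ 10) :
    boundaryOrd A (Sum.inr k) ∘ sPull 3 A = boundaryOrd (sParam 3 A) (Sum.inr k) := by
  have h2 := x_ne_zero 2
  have h3 := x_ne_zero 3
  have h6 : 1 + x 2 * (x 3 + κ A.η) ≠ 0 := by
    simpa using (1 + y₂ * (y₃ + A.η)).ne_zero 0 (by simp) (by simp)
  have h7 : 1 + x 2 * (x 3 + κ A.η) - κ (A.a 3) * x 2 ≠ 0 := by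
    simpa using (1 + y₂ * (y₃ + A.η) - A.a 3 * y₂).ne_zero 0 (by simp) (by simp)
  have h8 : 1 + x 3 * (x 2 + κ A.η) ≠ 0 := by
    simpa using (1 + y₃ * (y₂ + A.η)).ne_zero 0 (by simp) (by simp)
  have h9 : 1 + x 3 * (x 2 + κ A.η) - κ (A.a 3) * x 3 ≠ 0 := by
    simpa using (1 + y₃ * (y₂ + A.η) - A.a 3 * y₃).ne_zero 0 (by simp) (by simp)
  refine boundaryOrd_sPull _ (fwd₃ A (Sum.inr k)) (bwd₃ A (Sum.inr k)) ?_ ?_ ?_ ?_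
  · intro j
    fin_cases k <;> first
      | exact absurd hk0 (by decide) | exact absurd hk (by decide) | fin_cases j
    all_goals simp [-mul_inv_rev, -mul_eq_mul_left_iff, -mul_eq_mul_right_iff, sEx, Ex.evals,
      chartEx, chartEq, sParam_a, sParam_t, fwd₃]
    all_goals field_simp (disch := first
      | assumption | exact ne_of_eq_of_ne (by ring1) h6 | exact ne_of_eq_of_ne (by ring1) h7
      | exact ne_of_eq_of_ne (by ring1) h8 | exact ne_of_eq_of_ne (by ring1) h9)
    all_goals ring
  · intro j
    fin_cases k <;> first
      | exact absurd hk0 (by decide) | exact absurd hk (by decide) | fin_cases j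
    all_goals simp [chartEq, fwd₃, *]
  · fin_cases k <;> first | exact absurd hk0 (by decide) | exact absurd hk (by decide) | skip
    all_goals simp [chartEq, fwd₃, *]
  · intro j
    fin_cases k <;> first
      | exact absurd hk0 (by decide) | exact absurd hk (by decide) | fin_cases j
    all_goals simp [chartEq, Ex.evals, fwd₃, bwd₃, *]

theorem boundaryOrd_sPull_three_eleven {A : Params} :
    boundaryOrd A (Sum.inr 11) ∘ sPull 3 A = boundaryOrd (sParam 3 A) (Sum.inr 11) := by
  have h2 := x_ne_zero 2
  have h3 := x_ne_zero 3
  have h4 : 1 + x 3 + κ A.η * x 2 * x 3 - κ (A.a 3) * x 2 * x 3 ≠ 0 := by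
    simpa using (1 + y₃ + A.η * y₂ * y₃ - A.a 3 * y₂ * y₃).ne_zero 0 (by simp) (by simp)
  have h5 : 1 + x 3 ≠ 0 := by simpa using (1 + y₃).ne_zero 0 (by simp) (by simp)
  refine boundaryOrd_sPull _ (fwd₃ A (Sum.inr 11)) (bwd₃ A (Sum.inr 11)) ?_ ?_ ?_ ?_
  · intro j
    fin_cases j <;> simp [-mul_eq_mul_left_iff, -mul_eq_mul_right_iff, sEx, Ex.evals, chartEx,
      chartEq, fwd₃]
    all_goals field_simp (disch := first
      | assumption | exact ne_of_eq_of_ne (by ring1) h4)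
    all_goals ring
  · intro j
    fin_cases j <;> simp [chartEq, fwd₃, *]
  · simp [chartEq, fwd₃, *]
  · intro j
    fin_cases j <;> simp [chartEq, Ex.evals, fwd₃, bwd₃, *]

theorem boundaryOrd_sPull_three_twelve {A : Params} :
    boundaryOrd A (Sum.inr 0) ∘ sPull 3 A = boundaryOrd (sParam 3 A) (Sum.inr 0) := by
  have h2 := x_ne_zero 2
  have h3 : x 2 * x 3 - 1 ≠ 0 := by simpa using (y₂ * y₃ - 1).ne_zero 0 (by simp) (by simp)
  have h4 : x 3 + κ A.η * (x 2 * x 3 - 1) - κ (A.a 3) * (x 2 * x 3 - 1) ≠ 0 := by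
    simpa using (y₃ + A.η * (y₂ * y₃ - 1) - A.a 3 * (y₂ * y₃ - 1)).ne_zero
      ![0, 0, 0, 1 + A.η - A.a 3] (by simp) (by simp; ring_nf; simp)
  have h5 : x 3 - κ A.η ≠ 0 := x_sub_const_ne_zero 3 A.η
  have h6 : x 3 - κ A.η + κ (A.a 3) ≠ 0 :=
    (y₃ - A.η + A.a 3).ne_zero ![0, 0, 0, 1 + A.η - A.a 3] (by simp) (by simp; ring_nf; simp)
  refine boundaryOrd_sPull _ (fwd₃ A (Sum.inr 0)) (bwd₃ A (Sum.inr 0)) ?_ ?_ ?_ ?_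
  · intro j
    fin_cases j <;> simp [-mul_inv_rev, -mul_eq_mul_left_iff, -mul_eq_mul_right_iff, sEx, Ex.evals,
      chartEx, chartEq, sParam_a, fwd₃]
    all_goals
      -- The polar parts of `r₁` and `r₂` cancel on this divisor, where `r₁ + r₂ = y₃ / (y₂ y₃ - 1)`
      -- is finite.
      rw [show (x 2)⁻¹ + (x 2 * (x 2 * x 3 - 1))⁻¹ - κ (A.a 3) + κ A.η =
        (x 3 + κ A.η * (x 2 * x 3 - 1) - κ (A.a 3) * (x 2 * x 3 - 1)) / (x 2 * x 3 - 1) by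
          field_simp
          ring]
      generalize hd : x 3 + κ A.η * (x 2 * x 3 - 1) - κ (A.a 3) * (x 2 * x 3 - 1) = d at h4 ⊢
      field_simp
      rw [← hd]
      ring
  · intro j
    fin_cases j <;> simp [chartEq, fwd₃, ← sub_eq_add_neg, *]
  · simp [chartEq, fwd₃, *]
  · intro j
    fin_cases j <;> simp [chartEq, Ex.evals, fwd₃, bwd₃, ← sub_eq_add_neg, *]

theorem boundaryOrd_sPull_three {A : Params} (b : Comp) (hb : b ≠ Sum.inr 5) (hb' : b ≠ Sum.inr 6) :
    boundaryOrd A b ∘ sPull 3 A = boundaryOrd (sParam 3 A) b := by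
  rcases b with k | k
  · exact boundaryOrd_sPull_three_inl k
  · by_cases h0 : k = 0
    · rw [h0, boundaryOrd_sPull_three_twelve]
    · by_cases h4 : k ≤ 4
      · exact boundaryOrd_sPull_three_inr_one k h4 h0
      · by_cases h10 : k ≤ 10
        · refine boundaryOrd_sPull_three_inr_seven k ?_ h10
          rw [Ne, Sum.inr.injEq] at hb hb'
          clear h10
          decide +revert
        · have h11 : k = 11 := by
            clear hb hb' h0 h4
            decide +revert
          rw [h11, boundaryOrd_sPull_three_eleven]

/-- The denominator of `s₃` equals `y₀ y₂` in this chart, so it vanishes together with `q₁` and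
`q₂`, and the quotients stay finite. -/
theorem boundaryOrd_sPull_three_five {A : Params} (ha : A.a 3 ≠ 0) :
    boundaryOrd A (Sum.inr 5) ∘ sPull 3 A = ordAlong (X 2 - (C (A.a 3 - A.η) - X 3)) := by
  have ha' := κ_ne_zero ha
  have h0 := x_ne_zero 0
  have h2 := x_ne_zero 2
  refine boundaryOrd_sPull_graph (Ex.con (A.a 3 - A.η) - y₃)
    ![(y₀ * y₂ + A.a 3) / y₂, y₁ * (y₀ * y₂ + A.a 3) / y₂, y₂, y₃]
    ![y₂, y₁ / y₀, A.a 3 / y₀, y₃] (by simp) (by simp [x, algebraMap_C]) ?_ ?_ ?_ ?_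
  · intro j
    fin_cases j <;> simp [sEx, Ex.evals, chartEx, chartEq, graphChart]
    on_goal 3 => ring
    all_goals
      -- The denominator of `s₃` is exhibited as a multiple of the equation of the divisor.
      rw [show x 0 * x 2 - x 3 + κ (A.a 3) - κ A.η + x 3 - κ (A.a 3) + κ A.η = x 0 * x 2 by ring]
      field_simp
  · intro j
    fin_cases j <;> simp [chartEq, h2]
  · simp [chartEq, h2]
  · intro j
    fin_cases j <;> simp [chartEq, Ex.evals, ha']
    all_goals field_simp

/-- The zero of `r₁ + r₂ + η` cancels the poles of `q₁` and `q₂`, the denominator being `-a₃ ≠ 0`.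
-/
theorem boundaryOrd_sPull_three_six {A : Params} (ha : A.a 3 ≠ 0) :
    boundaryOrd A (Sum.inr 6) ∘ sPull 3 A = ordAlong (X 2 - (C (-A.η) - X 3)) := by
  have ha' := κ_ne_zero ha
  have h0 := x_ne_zero 0
  have h1 := x_ne_zero 1
  have h2 := x_ne_zero 2
  have h5 : x 0 * x 2 - κ (A.a 3) ≠ 0 :=
    (y₀ * y₂ - A.a 3).ne_zero 0 (by simp) (by simp [ha])
  refine boundaryOrd_sPull_graph (Ex.con (-A.η) - y₃)
    ![y₂ / (y₀ * y₂ - A.a 3), y₂ / (y₁ * (y₀ * y₂ - A.a 3)), y₂, y₃]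
    ![y₂, y₀ / y₁, (0 : ℂ) - A.a 3 * y₀, y₃] (by simp) (by simp [x, algebraMap_C]) ?_ ?_ ?_ ?_
  · intro j
    fin_cases j <;> simp [-mul_inv_rev, sEx, Ex.evals, chartEx, chartEq, graphChart]
    all_goals field_simp (disch := first | assumption | exact ne_of_eq_of_ne (by ring1) h5)
    all_goals ring
  · intro j
    fin_cases j <;> simp [chartEq, h1, ha]
  · simp [chartEq, h2]
  · intro j
    fin_cases j <;> simp [chartEq, Ex.evals]
    all_goals field_simp

/-- Where the denominator vanishes both `q̄ⱼ` become infinite and `r₁ + r₂ = -(η - a₃)`, the centre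
`C₆` for the new `η`. In the next lemma the numerator vanishes instead, and the image lies over
`C₅`. -/
theorem ordAlong_sPull_three {A : Params} (ha : A.a 3 ≠ 0) :
    ordAlong (X 2 - (C (A.a 3 - A.η) - X 3)) ∘ sPull 3 A =
      boundaryOrd (sParam 3 A) (Sum.inr 6) := by
  have ha' := κ_ne_zero ha
  have h0 := x_ne_zero 0
  have h1 := x_ne_zero 1
  have h2 := x_ne_zero 2
  have h5 : x 2 + κ (A.a 3) ≠ 0 := x_add_const_ne_zero 2 (A.a 3)
  refine ordAlong_graph_sPull (Ex.con (A.a 3 - A.η) - y₃)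
    ![1 / (y₀ * (y₂ + A.a 3)), y₀ / y₁, y₀ * (y₂ + A.a 3), y₃]
    ![y₂ / A.a 3, y₂ / (A.a 3 * y₁), y₀, y₃] (by simp) (by simp [x, algebraMap_C]) ?_ ?_ ?_ ?_
  · intro j
    fin_cases j <;> simp [-mul_inv_rev, sEx, Ex.evals, chartEx, chartEq, graphChart, sParam_three_η]
    all_goals field_simp (disch := first
      | assumption | exact ne_of_eq_of_ne (by ring1) h0 | exact ne_of_eq_of_ne (by ring1) h2
      | exact ne_of_eq_of_ne (by ring1) (mul_ne_zero h0 h2))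
    all_goals ring
  · intro j
    fin_cases j <;> simp [h0, h1, ha']
  · simp [chartEq, ha, h0]
  · intro j
    fin_cases j <;> simp [chartEq, Ex.evals, ha']
    all_goals field_simp

theorem ordAlong_sPull_three_zero {A : Params} (ha : A.a 3 ≠ 0) :
    ordAlong (X 2 - (C (-A.η) - X 3)) ∘ sPull 3 A = boundaryOrd (sParam 3 A) (Sum.inr 5) := by
  have ha' := κ_ne_zero ha
  have h0 := x_ne_zero 0
  have h1 := x_ne_zero 1
  have h2 := x_ne_zero 2
  have h5 : x 2 - κ (A.a 3) ≠ 0 := x_sub_const_ne_zero 2 (A.a 3)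
  refine ordAlong_graph_sPull (Ex.con (-A.η) - y₃)
    ![y₀ / (y₂ - A.a 3), y₁ / y₀, (y₂ - A.a 3) / y₀, y₃]
    ![(0 : ℂ) - A.a 3 / y₂, y₁ * ((0 : ℂ) - A.a 3 / y₂), y₀, y₃] (by simp)
    (by simp [x, algebraMap_C]) ?_ ?_ ?_ ?_
  · intro j
    fin_cases j <;> simp [-mul_inv_rev, sEx, Ex.evals, chartEx, chartEq, graphChart, sParam_a, sParam_three_η]
    all_goals field_simp (disch := first | assumption | exact ne_of_eq_of_ne (by ring1) h5)
    all_goals ring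
  · intro j
    fin_cases j <;> simp [h0, ha']
  · simp [chartEq, ha, h0]
  · intro j
    fin_cases j <;> simp [chartEq, Ex.evals]
    all_goals field_simp

end

/-! ### Images of hypersurfaces of `ℂ⁴` under maps regular along them -/

section

variable {w : RatFun → ℤ}

/-- The fractions whose denominator has order zero. -/
def integral (hw : IsOrd w) : Subalgebra ℂ RatFun where
  carrier := {f | ∃ n d : Poly, d ≠ 0 ∧ w (algebraMap Poly RatFun d) = 0 ∧
    f * algebraMap Poly RatFun d = algebraMap Poly RatFun n}
  mul_mem' := by
    rintro f g ⟨n, d, hd, hwd, h⟩ ⟨n', d', hd', hwd', h'⟩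
    refine ⟨n * n', d * d', mul_ne_zero hd hd', ?_, ?_⟩
    · rw [map_mul, hw.mul (algebraMap_poly_ne_zero hd) (algebraMap_poly_ne_zero hd'), hwd, hwd',
        add_zero]
    · rw [map_mul, map_mul, ← h, ← h']
      ring
  add_mem' := by
    rintro f g ⟨n, d, hd, hwd, h⟩ ⟨n', d', hd', hwd', h'⟩
    refine ⟨n * d' + n' * d, d * d', mul_ne_zero hd hd', ?_, ?_⟩
    · rw [map_mul, hw.mul (algebraMap_poly_ne_zero hd) (algebraMap_poly_ne_zero hd'), hwd, hwd',
        add_zero]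
    · rw [map_mul, map_add, map_mul, map_mul, ← h, ← h']
      ring
  algebraMap_mem' c := ⟨C c, 1, one_ne_zero, by rw [map_one, hw.one], by
    rw [algebraMap_C, map_one, mul_one]⟩

theorem poly_mem_integral (hw : IsOrd w) (p : Poly) : algebraMap Poly RatFun p ∈ integral hw :=
  ⟨p, 1, one_ne_zero, by rw [map_one, hw.one], by rw [map_one, mul_one]⟩

theorem x_mem_integral (hw : IsOrd w) (j : Fin 4) : x j ∈ integral hw := poly_mem_integral hw (X j)

theorem inv_mem_integral (hw : IsOrd w) {d : Poly} (hd : d ≠ 0)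
    (h : w (algebraMap Poly RatFun d) = 0) : (algebraMap Poly RatFun d)⁻¹ ∈ integral hw :=
  ⟨1, d, hd, h, by rw [map_one, inv_mul_cancel₀ (algebraMap_poly_ne_zero hd)]⟩

theorem aeval_mem_integral (hw : IsOrd w) {y : Fin 4 → RatFun} (h : ∀ j, y j ∈ integral hw)
    (p : Poly) : aeval y p ∈ integral hw := by
  have h1 : aeval y p ∈ Algebra.adjoin ℂ (Set.range y) := by
    rw [Algebra.adjoin_range_eq_range_aeval]
    exact ⟨p, rfl⟩
  exact Algebra.adjoin_le (by rintro _ ⟨j, rfl⟩; exact h j) h1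

theorem map_poly_mem_integral (hw : IsOrd w) {φ : RatFun →ₐ[ℂ] RatFun}
    (h : ∀ j, φ (x j) ∈ integral hw) (p : Poly) : φ (algebraMap Poly RatFun p) ∈ integral hw := by
  rw [algebraMap_eq_aeval, ← AlgHom.comp_apply, comp_aeval]
  exact aeval_mem_integral hw h p

/-- A birational map that is regular, with regular inverse, along a hypersurface of `ℂ⁴` maps it to
a hypersurface of `ℂ⁴`. -/
theorem exists_ordAlong_comp {φ ψ : RatFun →ₐ[ℂ] RatFun} (hφψ : ∀ f, φ (ψ f) = f)
    (hψφ : ∀ f, ψ (φ f) = f) {p : Poly} (hp : Irreducible p)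
    (h1 : ∀ j, φ (x j) ∈ integral (isOrd_ordAlong hp))
    (h2 : ∀ j, ψ (x j) ∈ integral ((isOrd_ordAlong hp).comp φ)) :
    ∃ p', Irreducible p' ∧ ordAlong p ∘ φ = ordAlong p' := by
  have hv := isOrd_ordAlong hp
  have hw := hv.comp φ
  set w := ordAlong p ∘ φ with hwdef
  -- Regularity of `φ` along `p` makes the transported order nonnegative on polynomials, and so
  -- monotone under divisibility.
  have hnn : ∀ g : Poly, 0 ≤ w (algebraMap Poly RatFun g) := by
    intro g
    by_cases hg : g = 0
    · rw [hg, map_zero, hw.zero]; exact zero_le_one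
    obtain ⟨n, d, hd, hd0, h⟩ := map_poly_mem_integral hv h1 g
    have hg' : φ (algebraMap Poly RatFun g) ≠ 0 := (map_ne_zero φ).2 (algebraMap_poly_ne_zero hg)
    have h3 := hv.mul hg' (algebraMap_poly_ne_zero hd)
    rw [h, hd0, add_zero] at h3
    rw [hwdef, Function.comp_apply, ← h3]
    exact ordAlong_nonneg hp
  have hdvd : ∀ {f g : Poly}, g ≠ 0 → f ∣ g →
      w (algebraMap Poly RatFun f) ≤ w (algebraMap Poly RatFun g) := by
    rintro f _ hg ⟨g, rfl⟩
    rw [map_mul, hw.mul (algebraMap_poly_ne_zero (left_ne_zero_of_mul hg))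
      (algebraMap_poly_ne_zero (right_ne_zero_of_mul hg))]
    have := hnn g
    omega
  -- The function `ψ p` has transported order `1` and a denominator of order `0`; its numerator `n`
  -- has order `1`, and one irreducible factor of `n` has to carry it.
  obtain ⟨n, d, hd, hd0, h⟩ := map_poly_mem_integral hw h2 p
  have hn : n ≠ 0 := by
    rintro rfl
    rw [map_zero, mul_eq_zero] at h
    exact h.elim ((map_ne_zero ψ).2 (algebraMap_poly_ne_zero hp.ne_zero))
      (algebraMap_poly_ne_zero hd)
  have hwp : w (ψ (algebraMap Poly RatFun p)) = 1 := by
    rw [hwdef, Function.comp_apply, hφψ, ordAlong_self hp]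
  have hwn : w (algebraMap Poly RatFun n) = 1 := by
    rw [← h, hw.mul ((map_ne_zero ψ).2 (algebraMap_poly_ne_zero hp.ne_zero))
      (algebraMap_poly_ne_zero hd), hwp, hd0, add_zero]
  -- an irreducible factor of `n` of positive order
  have hfac : ∃ p', Irreducible p' ∧ p' ∣ n ∧ 0 < w (algebraMap Poly RatFun p') := by
    by_contra! hcon
    have key : ∀ m : Poly, m ≠ 0 → m ∣ n → w (algebraMap Poly RatFun m) ≤ 0 := by
      intro m
      induction m using WfDvdMonoid.induction_on_irreducible with
      | zero => exact fun h0 => absurd rfl h0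
      | unit u hu =>
        intro hu0 _
        have h3 := hdvd one_ne_zero hu.dvd (f := u)
        rwa [map_one, hw.one] at h3
      | mul a q ha hq ih =>
        intro h0 hdv
        rw [map_mul, hw.mul (algebraMap_poly_ne_zero hq.ne_zero) (algebraMap_poly_ne_zero ha)]
        have h3 := hcon q hq (dvd_of_mul_right_dvd hdv)
        have h4 := ih ha (dvd_of_mul_left_dvd hdv)
        omega
    have := key n hn dvd_rfl
    omega
  obtain ⟨p', hp', hp'n, hp'w⟩ := hfac
  refine ⟨p', hp', hw.eq_ordAlong hp' ?_ ?_⟩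
  · have := hdvd hn hp'n
    omega
  · intro g hg
    have hg0 : g ≠ 0 := by rintro rfl; exact hg (dvd_zero p')
    by_contra hwg
    apply hg
    have hwg' : 0 < w (algebraMap Poly RatFun g) := lt_of_le_of_ne (hnn g) (Ne.symm hwg)
    obtain ⟨m, k, hk, hk0, h3⟩ := map_poly_mem_integral hv h1 g
    have hm0 : m ≠ 0 := by
      rintro rfl
      rw [map_zero, mul_eq_zero] at h3
      exact h3.elim ((map_ne_zero φ).2 (algebraMap_poly_ne_zero hg0)) (algebraMap_poly_ne_zero hk)
    -- Positive order of `g` says that `φ g` vanishes on `p = 0`, so `p` divides its numerator.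
    have hpm : p ∣ m := by
      rw [← ordAlong_pos_iff hp, ← h3, hv.mul ((map_ne_zero φ).2 (algebraMap_poly_ne_zero hg0))
        (algebraMap_poly_ne_zero hk), hk0, add_zero]
      exact hwg'
    obtain ⟨u, rfl⟩ := hpm
    obtain ⟨a, b, hb, hb0, h4⟩ := map_poly_mem_integral hw h2 u
    obtain ⟨c, e, he, he0, h5⟩ := map_poly_mem_integral hw h2 k
    have hc0 : c ≠ 0 := by
      rintro rfl
      rw [map_zero, mul_eq_zero] at h5
      exact h5.elim ((map_ne_zero ψ).2 (algebraMap_poly_ne_zero hk)) (algebraMap_poly_ne_zero he)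
    have hwc : w (algebraMap Poly RatFun c) = 0 := by
      rw [← h5, hw.mul ((map_ne_zero ψ).2 (algebraMap_poly_ne_zero hk))
        (algebraMap_poly_ne_zero he), he0, add_zero, hwdef, Function.comp_apply, hφψ, hk0]
    have h6 := congrArg ψ h3
    rw [map_mul, hψφ, map_mul, map_mul] at h6
    -- Applying `ψ` and clearing denominators turns `φ g = p u / k` into a divisibility among
    -- polynomials. Now `p'` divides `n`, while `b`, `c` and `d` have order zero and are prime to
    -- `p'`. Hence `p'` divides `g`.
    have h7 : g * c * (d * b) = n * a * e := by
      apply FaithfulSMul.algebraMap_injective Poly RatFun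
      simp only [map_mul]
      rw [← h, ← h4, ← h5]
      linear_combination (algebraMap Poly RatFun e * algebraMap Poly RatFun d *
        algebraMap Poly RatFun b) * h6
    have h8 : p' ∣ g * c * (d * b) := h7 ▸ ((hp'n.mul_right a).mul_right e)
    have h9 : ∀ f : Poly, f ≠ 0 → w (algebraMap Poly RatFun f) = 0 → ¬ p' ∣ f := by
      intro f hf hf0 hdv
      have := hdvd hf hdv
      omega
    rcases hp'.prime.dvd_or_dvd h8 with h10 | h10
    · exact (hp'.prime.dvd_or_dvd h10).resolve_right (h9 c hc0 hwc)
    · exact absurd h10 fun h11 => (hp'.prime.dvd_or_dvd h11).elim (h9 d hd hd0) (h9 b hb hb0)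

end

/-! ### The generators are pseudo-isomorphisms -/

section

theorem sParam_sParam (i : Fin 6) (A : Params) : sParam i (sParam i A) = A := by
  obtain ⟨a, η, t⟩ := A
  simp only [sParam, Params.mk.injEq, and_true]
  refine ⟨funext fun j => ?_, by simp⟩
  fin_cases i <;> fin_cases j <;>
    simp [two_eq_neg_one, three_eq_neg_one, four_eq_neg_one, five_eq_neg_one]

theorem sPull_x (i : Fin 6) (A : Params) (j : Fin 4) :
    sPull i A (x j) = (sEx i A j).eval x := by
  rw [sPull_eq, subst_x (dominant_sVar i A)]
  rfl

theorem sPull_sPull (i : Fin 6) (A : Params) (f : RatFun) :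
    sPull i A (sPull i (sParam i A) f) = f := by
  have h : (sPull i A).comp (sPull i (sParam i A)) = AlgHom.id ℂ RatFun := by
    refine algHom_ext fun j => ?_
    rw [AlgHom.comp_apply, sPull_x, sPull_eq, subst_eval (dominant_sVar i A), sEx_sEx]
    rfl
  exact DFunLike.congr_fun h f

theorem sPull_sPull' (i : Fin 6) (A : Params) (f : RatFun) :
    sPull i (sParam i A) (sPull i A f) = f := by
  have h := sPull_sPull i (sParam i A) f
  rwa [sParam_sParam] at h

theorem sPull_bijective (i : Fin 6) (A : Params) : Function.Bijective (sPull i A) :=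
  ⟨Function.LeftInverse.injective (sPull_sPull' i A),
    Function.RightInverse.surjective (sPull_sPull i A)⟩

variable {w : RatFun → ℤ}

theorem κ_mem_integral (hw : IsOrd w) (c : ℂ) : κ c ∈ integral hw := Subalgebra.algebraMap_mem _ c

section transversal

variable {A : Params} {p : Poly}

/-- Regularity of the inverse is tested along the image, that is, for the transported order. -/
theorem exists_ordAlong_comp_sPull_of_mem (hp : Irreducible p) (i : Fin 6)
    (h1 : ∀ j, (sEx i A j).eval x ∈ integral (isOrd_ordAlong hp))
    (h2 : ∀ j, (sEx i (sParam i A) j).eval x ∈ integral ((isOrd_ordAlong hp).comp (sPull i A))) :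
    ∃ p', Irreducible p' ∧ ordAlong p ∘ sPull i A = ordAlong p' :=
  exists_ordAlong_comp (sPull_sPull i A) (sPull_sPull' i A) hp
    (fun j => by rw [sPull_x]; exact h1 j) (fun j => by rw [sPull_x]; exact h2 j)

/-- The map fixes its own denominator `q₁ - q₂`, so a single hypersurface has to be excluded for the
map and its inverse. The same holds for `s₂` and `s₄`. -/
theorem exists_ordAlong_comp_sPull_zero (hp : Irreducible p) (h : ¬ p ∣ X 0 - X 1) :
    ∃ p', Irreducible p' ∧ ordAlong p ∘ sPull 0 A = ordAlong p' := by
  have key : ∀ {w : RatFun → ℤ} (hw : IsOrd w) (c : ℂ), w (x 0 - x 1) = 0 → ∀ j,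
      (![x 0, x 1, x 2 - κ c * x 0 / (x 0 - x 1), x 3 + κ c * x 1 / (x 0 - x 1)] :
        Fin 4 → RatFun) j ∈ integral hw := by
    intro w hw c hc j
    have hi : (x 0 - x 1)⁻¹ ∈ integral hw := by
      have := inv_mem_integral hw (d := X 0 - X 1) (by rintro h0; exact h (h0 ▸ dvd_zero p))
      rw [map_sub] at this
      exact this hc
    have hx := x_mem_integral hw
    have hκ := κ_mem_integral hw c
    simp only [div_eq_mul_inv]
    fin_cases j
    · exact hx 0
    · exact hx 1
    · exact sub_mem (hx 2) (mul_mem (mul_mem hκ (hx 0)) hi)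
    · exact add_mem (hx 3) (mul_mem (mul_mem hκ (hx 1)) hi)
  have h0 := ordAlong_eq_zero hp h
  rw [map_sub] at h0
  change ordAlong p (x 0 - x 1) = 0 at h0
  refine exists_ordAlong_comp_sPull_of_mem hp 0 (fun j => ?_) (fun j => ?_)
  · convert key (isOrd_ordAlong hp) (A.a 0) h0 j using 1
    fin_cases j <;> simp [sEx]
  · convert key ((isOrd_ordAlong hp).comp (sPull 0 A)) (-A.a 0) ?_ j using 1
    · fin_cases j <;> simp [sEx, sParam_a]
    · simpa [sPull_x, sEx] using h0

/-- The inverse has denominator `r₁`, which the map pulls back to `r₁ + a₁`; hence two excluded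
hypersurfaces. The same occurs for `s₅`. -/
theorem exists_ordAlong_comp_sPull_one (hp : Irreducible p) (h : ¬ p ∣ X 2)
    (h' : ¬ p ∣ X 2 + C (A.a 1)) :
    ∃ p', Irreducible p' ∧ ordAlong p ∘ sPull 1 A = ordAlong p' := by
  have key : ∀ {w : RatFun → ℤ} (hw : IsOrd w) (c : ℂ), w (x 2) = 0 → ∀ j,
      (![x 0 * (1 + κ c / x 2), x 1, x 2 + κ c, x 3] : Fin 4 → RatFun) j ∈ integral hw := by
    intro w hw c hc j
    have hi : (x 2)⁻¹ ∈ integral hw := inv_mem_integral hw (X_ne_zero 2) hc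
    have hx := x_mem_integral hw
    have hκ := κ_mem_integral hw c
    simp only [div_eq_mul_inv]
    fin_cases j
    · exact mul_mem (hx 0) (add_mem (one_mem _) (mul_mem hκ hi))
    · exact hx 1
    · exact add_mem (hx 2) hκ
    · exact hx 3
  have h0 := ordAlong_eq_zero hp h
  have h1 := ordAlong_eq_zero hp h'
  rw [map_add, algebraMap_C] at h1
  change ordAlong p (x 2 + κ (A.a 1)) = 0 at h1
  refine exists_ordAlong_comp_sPull_of_mem hp 1 (fun j => ?_) (fun j => ?_)
  · convert key (isOrd_ordAlong hp) (A.a 1) h0 j using 1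
    fin_cases j <;> simp [sEx]
  · convert key ((isOrd_ordAlong hp).comp (sPull 1 A)) (-A.a 1) ?_ j using 1
    · fin_cases j <;> simp [sEx, sParam_a]
    · simpa [sPull_x, sEx] using h1

theorem exists_ordAlong_comp_sPull_five (hp : Irreducible p) (h : ¬ p ∣ X 3)
    (h' : ¬ p ∣ X 3 + C (A.a 5)) :
    ∃ p', Irreducible p' ∧ ordAlong p ∘ sPull 5 A = ordAlong p' := by
  have key : ∀ {w : RatFun → ℤ} (hw : IsOrd w) (c : ℂ), w (x 3) = 0 → ∀ j,
      (![x 0, x 1 * (1 + κ c / x 3), x 2, x 3 + κ c] : Fin 4 → RatFun) j ∈ integral hw := by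
    intro w hw c hc j
    have hi : (x 3)⁻¹ ∈ integral hw := inv_mem_integral hw (X_ne_zero 3) hc
    have hx := x_mem_integral hw
    have hκ := κ_mem_integral hw c
    simp only [div_eq_mul_inv]
    fin_cases j
    · exact hx 0
    · exact mul_mem (hx 1) (add_mem (one_mem _) (mul_mem hκ hi))
    · exact hx 2
    · exact add_mem (hx 3) hκ
  have h0 := ordAlong_eq_zero hp h
  have h1 := ordAlong_eq_zero hp h'
  rw [map_add, algebraMap_C] at h1
  change ordAlong p (x 3 + κ (A.a 5)) = 0 at h1
  refine exists_ordAlong_comp_sPull_of_mem hp 5 (fun j => ?_) (fun j => ?_)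
  · convert key (isOrd_ordAlong hp) (A.a 5) h0 j using 1
    fin_cases j <;> simp [sEx]
  · convert key ((isOrd_ordAlong hp).comp (sPull 5 A)) (-A.a 5) ?_ j using 1
    · fin_cases j <;> simp [sEx, sParam_a]
    · simpa [sPull_x, sEx] using h1

theorem exists_ordAlong_comp_sPull_two (hp : Irreducible p) (h : ¬ p ∣ X 0 - C A.t) :
    ∃ p', Irreducible p' ∧ ordAlong p ∘ sPull 2 A = ordAlong p' := by
  have key : ∀ {w : RatFun → ℤ} (hw : IsOrd w) (c : ℂ), w (x 0 - κ A.t) = 0 → ∀ j,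
      (![x 0, x 1, x 2 - κ c * x 0 / (x 0 - κ A.t), x 3] : Fin 4 → RatFun) j ∈ integral hw := by
    intro w hw c hc j
    have hi : (x 0 - κ A.t)⁻¹ ∈ integral hw := by
      have := inv_mem_integral hw (d := X 0 - C A.t) (by rintro h0; exact h (h0 ▸ dvd_zero p))
      rw [map_sub, algebraMap_C] at this
      exact this hc
    have hx := x_mem_integral hw
    have hκ := κ_mem_integral hw c
    simp only [div_eq_mul_inv]
    fin_cases j
    · exact hx 0
    · exact hx 1
    · exact sub_mem (hx 2) (mul_mem (mul_mem hκ (hx 0)) hi)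
    · exact hx 3
  have h0 := ordAlong_eq_zero hp h
  rw [map_sub, algebraMap_C] at h0
  change ordAlong p (x 0 - κ A.t) = 0 at h0
  refine exists_ordAlong_comp_sPull_of_mem hp 2 (fun j => ?_) (fun j => ?_)
  · convert key (isOrd_ordAlong hp) (A.a 2) h0 j using 1
    fin_cases j <;> simp [sEx]
  · convert key ((isOrd_ordAlong hp).comp (sPull 2 A)) (-A.a 2) ?_ j using 1
    · fin_cases j <;> simp [sEx, sParam_a, sParam_t]
    · simpa [sPull_x, sEx] using h0

theorem exists_ordAlong_comp_sPull_four (hp : Irreducible p) (h : ¬ p ∣ X 1 - C 1) :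
    ∃ p', Irreducible p' ∧ ordAlong p ∘ sPull 4 A = ordAlong p' := by
  have key : ∀ {w : RatFun → ℤ} (hw : IsOrd w) (c : ℂ), w (x 1 - 1) = 0 → ∀ j,
      (![x 0, x 1, x 2, x 3 - κ c * x 1 / (x 1 - 1)] : Fin 4 → RatFun) j ∈ integral hw := by
    intro w hw c hc j
    have hi : (x 1 - 1)⁻¹ ∈ integral hw := by
      have := inv_mem_integral hw (d := X 1 - C 1) (by rintro h0; exact h (h0 ▸ dvd_zero p))
      rw [map_sub, algebraMap_C, map_one] at this
      exact this hc
    have hx := x_mem_integral hw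
    have hκ := κ_mem_integral hw c
    simp only [div_eq_mul_inv]
    fin_cases j
    · exact hx 0
    · exact hx 1
    · exact hx 2
    · exact sub_mem (hx 3) (mul_mem (mul_mem hκ (hx 1)) hi)
  have h0 := ordAlong_eq_zero hp h
  rw [map_sub, algebraMap_C, map_one] at h0
  change ordAlong p (x 1 - 1) = 0 at h0
  refine exists_ordAlong_comp_sPull_of_mem hp 4 (fun j => ?_) (fun j => ?_)
  · convert key (isOrd_ordAlong hp) (A.a 4) h0 j using 1
    fin_cases j <;> simp [sEx]
  · convert key ((isOrd_ordAlong hp).comp (sPull 4 A)) (-A.a 4) ?_ j using 1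
    · fin_cases j <;> simp [sEx, sParam_a]
    · simpa [sPull_x, sEx] using h0

/-- The map fixes `r₁` and `r₂`, but the shift of parameters changes the denominator of its inverse
to `r₁ + r₂ + η`. -/
theorem exists_ordAlong_comp_sPull_three (hp : Irreducible p)
    (h : ¬ p ∣ X 2 - (C (A.a 3 - A.η) - X 3)) (h' : ¬ p ∣ X 2 - (C (-A.η) - X 3)) :
    ∃ p', Irreducible p' ∧ ordAlong p ∘ sPull 3 A = ordAlong p' := by
  have key : ∀ {w : RatFun → ℤ} (hw : IsOrd w) (c d : ℂ), w (x 2 - (κ d - x 3)) = 0 →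
      ∀ j, (![x 0 + κ c * x 0 / (x 2 - (κ d - x 3)), x 1 + κ c * x 1 / (x 2 - (κ d - x 3)), x 2,
        x 3] : Fin 4 → RatFun) j ∈ integral hw := by
    intro w hw c d hc j
    have hi : (x 2 - (κ d - x 3))⁻¹ ∈ integral hw := by
      have := inv_mem_integral hw (d := X 2 - (C d - X 3))
        (irreducible_graph (by simp)).ne_zero
      rw [map_sub, map_sub, algebraMap_C] at this
      exact this hc
    have hx := x_mem_integral hw
    have hκ := κ_mem_integral hw c
    simp only [div_eq_mul_inv]
    fin_cases j
    · exact add_mem (hx 0) (mul_mem (mul_mem hκ (hx 0)) hi)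
    · exact add_mem (hx 1) (mul_mem (mul_mem hκ (hx 1)) hi)
    · exact hx 2
    · exact hx 3
  have h0 := ordAlong_eq_zero hp h
  have h1 := ordAlong_eq_zero hp h'
  rw [map_sub, map_sub, algebraMap_C] at h0 h1
  change ordAlong p (x 2 - (κ (-A.η) - x 3)) = 0 at h1
  refine exists_ordAlong_comp_sPull_of_mem hp 3 (fun j => ?_) (fun j => ?_)
  · convert key (isOrd_ordAlong hp) (A.a 3) (A.a 3 - A.η) h0 j using 1
    have e : x 2 + x 3 - κ (A.a 3) + κ A.η = x 2 - (κ (A.a 3) - κ A.η - x 3) := by ring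
    fin_cases j <;> simp [sEx, e]
  · convert key ((isOrd_ordAlong hp).comp (sPull 3 A)) (-A.a 3) (-A.η) ?_ j using 1
    · have e : x 2 + x 3 + κ (A.a 3) + (κ A.η - κ (A.a 3)) = x 2 - (-κ A.η - x 3) := by ring
      fin_cases j <;> simp [sEx, sParam_a, sParam_three_η, e]
    · simpa [sPull_x, sEx] using h1

end transversal

theorem ordAlong_eq_of_dvd {p p' : Poly} (hp : Irreducible p) (hp' : Irreducible p') (h : p ∣ p') :
    ordAlong p = ordAlong p' := ordAlong_congr ((hp.dvd_irreducible_iff_associated hp').1 h)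

theorem irreducible_add_const (c : Fin 4) (a : ℂ) : Irreducible (X c + C a : Poly) := by
  have h : Irreducible (X c - C (-a) : Poly) := irreducible_graph (by simp)
  rwa [C_neg, sub_neg_eq_add] at h

theorem irreducible_sub_const (c : Fin 4) (a : ℂ) : Irreducible (X c - C a : Poly) :=
  irreducible_graph (by simp)

theorem boundaryOrd_mem (A : Params) (b : Comp) : boundaryOrd A b ∈ primeDivisors A :=
  Or.inr ⟨b, rfl⟩

theorem ordAlong_mem (A : Params) {p : Poly} (hp : Irreducible p) : ordAlong p ∈ primeDivisors A :=
  Or.inl ⟨p, hp, rfl⟩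

theorem fin_six_cases (i : Fin 6) : i = 0 ∨ i = 1 ∨ i = 2 ∨ i = 3 ∨ i = 4 ∨ i = 5 := by
  decide +revert

/-- Either `p` is one of the exchanged hypersurfaces, and its image is an exceptional divisor, or
`sᵢ` is regular in both directions along it. -/
theorem ordAlong_comp_sPull_mem {A : Params} {i : Fin 6} (ha : A.a i ≠ 0) (ht : A.t ≠ 0) {p : Poly}
    (hp : Irreducible p) : ordAlong p ∘ sPull i A ∈ primeDivisors (sParam i A) := by
  have key : (∃ p', Irreducible p' ∧ ordAlong p ∘ sPull i A = ordAlong p') ∨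
      ∃ b, ordAlong p ∘ sPull i A = boundaryOrd (sParam i A) b := by
    rcases fin_six_cases i with rfl | rfl | rfl | rfl | rfl | rfl
    · by_cases h : p ∣ X 0 - X 1
      · rw [ordAlong_eq_of_dvd hp (irreducible_graph (by simp)) h]
        exact Or.inr ⟨_, ordAlong_sPull_zero ha⟩
      · exact Or.inl (exists_ordAlong_comp_sPull_zero hp h)
    · by_cases h : p ∣ X 2
      · rw [ordAlong_eq_of_dvd hp (irreducible_X 2) h]
        exact Or.inr ⟨_, ordAlong_sPull_one_zero ha⟩
      · by_cases h' : p ∣ X 2 + C (A.a 1)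
        · rw [ordAlong_eq_of_dvd hp (irreducible_add_const 2 _) h']
          exact Or.inr ⟨_, ordAlong_sPull_one_neg ha⟩
        · exact Or.inl (exists_ordAlong_comp_sPull_one hp h h')
    · by_cases h : p ∣ X 0 - C A.t
      · rw [ordAlong_eq_of_dvd hp (irreducible_sub_const 0 _) h]
        exact Or.inr ⟨_, ordAlong_sPull_two ha ht⟩
      · exact Or.inl (exists_ordAlong_comp_sPull_two hp h)
    · by_cases h : p ∣ X 2 - (C (A.a 3 - A.η) - X 3)
      · rw [ordAlong_eq_of_dvd hp (irreducible_graph (by simp)) h]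
        exact Or.inr ⟨_, ordAlong_sPull_three ha⟩
      · by_cases h' : p ∣ X 2 - (C (-A.η) - X 3)
        · rw [ordAlong_eq_of_dvd hp (irreducible_graph (by simp)) h']
          exact Or.inr ⟨_, ordAlong_sPull_three_zero ha⟩
        · exact Or.inl (exists_ordAlong_comp_sPull_three hp h h')
    · by_cases h : p ∣ X 1 - C 1
      · rw [ordAlong_eq_of_dvd hp (irreducible_sub_const 1 _) h]
        exact Or.inr ⟨_, ordAlong_sPull_four ha⟩
      · exact Or.inl (exists_ordAlong_comp_sPull_four hp h)
    · by_cases h : p ∣ X 3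
      · rw [ordAlong_eq_of_dvd hp (irreducible_X 3) h]
        exact Or.inr ⟨_, ordAlong_sPull_five_zero ha⟩
      · by_cases h' : p ∣ X 3 + C (A.a 5)
        · rw [ordAlong_eq_of_dvd hp (irreducible_add_const 3 _) h']
          exact Or.inr ⟨_, ordAlong_sPull_five_neg ha⟩
        · exact Or.inl (exists_ordAlong_comp_sPull_five hp h h')
  rcases key with ⟨p', hp', h⟩ | ⟨b, h⟩
  · exact h ▸ ordAlong_mem _ hp'
  · exact h ▸ boundaryOrd_mem _ b

/-- The divisors of the boundary that `sᵢ` interchanges with hypersurfaces of `ℂ⁴`. -/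
def moved : Fin 6 → Finset Comp
  | 0 => {Sum.inr 0}
  | 1 => {Sum.inr 1, Sum.inr 2}
  | 2 => {Sum.inr 8}
  | 3 => {Sum.inr 5, Sum.inr 6}
  | 4 => {Sum.inr 10}
  | 5 => {Sum.inr 3, Sum.inr 4}

theorem boundaryOrd_comp_sPull {A : Params} (ht : A.t ≠ 0) (i : Fin 6) {b : Comp}
    (hb : b ∉ moved i) : boundaryOrd A b ∘ sPull i A = boundaryOrd (sParam i A) b := by
  rcases fin_six_cases i with rfl | rfl | rfl | rfl | rfl | rfl <;>
    simp only [moved, Finset.mem_singleton, Finset.mem_insert, not_or] at hb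
  · exact boundaryOrd_sPull_zero b hb
  · exact boundaryOrd_sPull_one b hb.1 hb.2
  · exact boundaryOrd_sPull_two ht b hb
  · exact boundaryOrd_sPull_three b hb.1 hb.2
  · exact boundaryOrd_sPull_four b hb
  · exact boundaryOrd_sPull_five b hb.1 hb.2

theorem boundaryOrd_comp_sPull_moved {A : Params} {i : Fin 6} (ha : A.a i ≠ 0) (ht : A.t ≠ 0)
    {b : Comp} (hb : b ∈ moved i) :
    ∃ p, Irreducible p ∧ boundaryOrd A b ∘ sPull i A = ordAlong p := by
  rcases fin_six_cases i with rfl | rfl | rfl | rfl | rfl | rfl <;>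
    simp only [moved, Finset.mem_singleton, Finset.mem_insert] at hb
  · subst hb
    exact ⟨_, irreducible_graph (by simp), boundaryOrd_sPull_zero_twelve ha⟩
  · obtain rfl | rfl := hb
    · exact ⟨_, irreducible_sub_const _ _, boundaryOrd_sPull_one_one ha⟩
    · exact ⟨_, irreducible_X 2, boundaryOrd_sPull_one_two ha⟩
  · subst hb
    exact ⟨_, irreducible_sub_const _ _, boundaryOrd_sPull_two_eight ha ht⟩
  · obtain rfl | rfl := hb
    · exact ⟨_, irreducible_graph (by simp), boundaryOrd_sPull_three_five ha⟩
    · exact ⟨_, irreducible_graph (by simp), boundaryOrd_sPull_three_six ha⟩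
  · subst hb
    exact ⟨_, irreducible_sub_const _ _, boundaryOrd_sPull_four_ten ha⟩
  · obtain rfl | rfl := hb
    · exact ⟨_, irreducible_sub_const _ _, boundaryOrd_sPull_five_three ha⟩
    · exact ⟨_, irreducible_X 3, boundaryOrd_sPull_five_four ha⟩

theorem comp_sPull_mem {A : Params} {i : Fin 6} (ha : A.a i ≠ 0) (ht : A.t ≠ 0) {v : RatFun → ℤ}
    (hv : v ∈ primeDivisors A) : v ∘ sPull i A ∈ primeDivisors (sParam i A) := by
  obtain ⟨p, hp, rfl⟩ | ⟨b, rfl⟩ := hv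
  · exact ordAlong_comp_sPull_mem ha ht hp
  · by_cases hb : b ∈ moved i
    · obtain ⟨p, hp, h⟩ := boundaryOrd_comp_sPull_moved ha ht hb
      exact h ▸ ordAlong_mem _ hp
    · exact boundaryOrd_comp_sPull ht i hb ▸ boundaryOrd_mem _ b

theorem sParam_self (i : Fin 6) (A : Params) : (sParam i A).a i = -A.a i := by simp [sParam]

/-- The transformation `sᵢ` is a pseudo-isomorphism. -/
theorem isPseudoIso_sPull {A : Params} {i : Fin 6} (ha : A.a i ≠ 0) (ht : A.t ≠ 0) :
    IsPseudoIso A (sParam i A) (sPull i A) where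
  birational := sPull_bijective i A
  bijOn := by
    have ha' : (sParam i A).a i ≠ 0 := by rw [sParam_self]; exact neg_ne_zero.2 ha
    -- The inverse bijection comes from `sᵢ` at the reflected parameters, to which the same
    -- inclusion applies because `-aᵢ ≠ 0`.
    refine Set.InvOn.bijOn (f' := fun v => v ∘ sPull i (sParam i A)) ⟨?_, ?_⟩ ?_ ?_
    · intro v _
      funext f
      exact congrArg v (sPull_sPull i A f)
    · intro v _
      funext f
      exact congrArg v (sPull_sPull' i A f)
    · exact fun v hv => comp_sPull_mem ha ht hv
    · intro v hv
      have h := comp_sPull_mem ha' (by rwa [sParam_t]) hv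
      rwa [sParam_sParam] at h

end

section

/-! ## Generic parameters -/

theorem Params.Generic.ne_zero {A : Params} (hA : A.Generic) (i : Fin 6) : A.a i ≠ 0 := by
  intro h
  refine hA.sum_ne_int i 1 le_rfl (by norm_num) 0 ?_
  rw [Finset.sum_range_one]
  simpa using h

/-- The simple root parameters are the differences, modulo the integers, of six complex numbers
that are distinct modulo the integers. -/
theorem Params.Generic.exists_diff {A : Params} (hA : A.Generic) :
    ∃ b : Fin 6 → ℂ, (∀ k, ∃ m : ℤ, A.a k = b (k + 1) - b k + m) ∧
      ∀ j k, j ≠ k → ∀ m : ℤ, b j - b k ≠ m := by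
  -- The six numbers are the partial sums `a₀ + ⋯ + aₖ₋₁`.
  refine ⟨fun k => ∑ r ∈ Finset.range k, A.a (Fin.ofNat 6 r), ?_, ?_⟩
  · intro k
    have h := hA.sum_eq_one
    rw [Fin.sum_univ_six] at h
    fin_cases k
    · exact ⟨0, by simp⟩
    · exact ⟨0, by simp [Finset.sum_range_succ]; rfl⟩
    · exact ⟨0, by simp [Finset.sum_range_succ]⟩
    · exact ⟨0, by simp [Finset.sum_range_succ]⟩
    · exact ⟨0, by simp [Finset.sum_range_succ]⟩
    -- At `k = 5` the index wraps around, and `a₅ = b₀ - b₅ + 1` because the parameters sum to `1`.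
    · refine ⟨1, ?_⟩
      simp [Finset.sum_range_succ]
      linear_combination h
  · have key : ∀ j k : Fin 6, j < k → ∀ m : ℤ, ∑ r ∈ Finset.range k, A.a (Fin.ofNat 6 r) -
        ∑ r ∈ Finset.range j, A.a (Fin.ofNat 6 r) ≠ m := by
      intro j k hjk m h
      obtain ⟨l, hl⟩ := Nat.exists_eq_add_of_lt (Fin.lt_def.1 hjk)
      refine hA.sum_ne_int j (l + 1) (by omega) (by omega) m ?_
      rw [← h, hl, add_assoc, Finset.sum_range_add (fun r => A.a (Fin.ofNat 6 r)) j (l + 1),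
        add_sub_cancel_left]
      refine Finset.sum_congr rfl fun r _ => congrArg A.a (Fin.ext ?_)
      simp [Fin.val_add]
    intro j k hjk m h
    rcases lt_or_gt_of_ne hjk with h1 | h1
    · exact key j k h1 (-m) (by push_cast; linear_combination -h)
    · exact key k j h1 m h

theorem swap_succ_succ (i : Fin 6) : Equiv.swap i (i + 1) (i + 1 + 1) = i + 1 + 1 := by
  decide +revert

theorem swap_pred (i : Fin 6) : Equiv.swap i (i + 1) (i - 1) = i - 1 := by
  decide +revert

/-- Modulo integers `sᵢ` transposes the numbers `bᵢ` and `bᵢ₊₁` of `Params.Generic.exists_diff`.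
Being pairwise distinct modulo the integers is invariant under permutations. -/
theorem Params.Generic.sParam {A : Params} (hA : A.Generic) (i : Fin 6) :
    (FST.sParam i A).Generic where
  sum_eq_one := by
    have h := hA.sum_eq_one
    rw [Fin.sum_univ_six] at h ⊢
    rcases fin_six_cases i with rfl | rfl | rfl | rfl | rfl | rfl <;>
      simp [sParam_a, two_eq_neg_one, three_eq_neg_one, four_eq_neg_one, five_eq_neg_one] <;>
      linear_combination h
  t_ne_zero := hA.t_ne_zero
  t_ne_one := hA.t_ne_one
  sum_ne_int := by
    obtain ⟨b, hb, hb'⟩ := hA.exists_diff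
    set b' : Fin 6 → ℂ := fun k => b (Equiv.swap i (i + 1) k) with hbdef
    have h1 : ∀ k, ∃ m : ℤ, (FST.sParam i A).a k = b' (k + 1) - b' k + m := by
      intro k
      rw [sParam_a]
      obtain ⟨m, hm⟩ := hb i
      split_ifs with h h'
      · subst h
        refine ⟨-m, ?_⟩
        rw [hbdef]
        simp only [Equiv.swap_apply_left, Equiv.swap_apply_right, hm]
        push_cast
        ring
      · rcases h' with rfl | rfl
        · obtain ⟨m', hm'⟩ := hb (i + 1)
          refine ⟨m + m', ?_⟩
          have h2 : Equiv.swap i (i + 1) (i + 1 + 1) = i + 1 + 1 :=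
            swap_succ_succ i
          simp only [hbdef, Equiv.swap_apply_right, h2, hm, hm']
          push_cast
          ring
        · obtain ⟨m', hm'⟩ := hb (i - 1)
          refine ⟨m + m', ?_⟩
          have h2 : Equiv.swap i (i + 1) (i - 1) = i - 1 := swap_pred i
          rw [sub_add_cancel] at hm' ⊢
          simp only [hbdef, Equiv.swap_apply_left, h2, hm, hm']
          push_cast
          ring
      · obtain ⟨m', hm'⟩ := hb k
        refine ⟨m', ?_⟩
        rw [not_or] at h'
        have h2 : Equiv.swap i (i + 1) k = k := Equiv.swap_apply_of_ne_of_ne h h'.1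
        have h3 : Equiv.swap i (i + 1) (k + 1) = k + 1 :=
          Equiv.swap_apply_of_ne_of_ne (fun h4 => h'.2 (eq_sub_of_add_eq h4))
            (fun h4 => h (add_right_cancel h4))
        simp only [hbdef, h2, h3, hm']
    -- Cyclically consecutive sums telescope, up to an integer, to one difference.
    have h2 : ∀ (j : Fin 6) (l : ℕ), ∃ m : ℤ, ∑ k ∈ Finset.range l,
        (FST.sParam i A).a (j + Fin.ofNat 6 k) = b' (j + Fin.ofNat 6 l) - b' j + m := by
      intro j l
      induction l with
      | zero => exact ⟨0, by simp⟩
      | succ l ih =>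
        obtain ⟨m, hm⟩ := ih
        obtain ⟨m', hm'⟩ := h1 (j + Fin.ofNat 6 l)
        refine ⟨m + m', ?_⟩
        have e : j + Fin.ofNat 6 l + 1 = j + Fin.ofNat 6 (l + 1) := by
          rw [add_assoc]
          congr 1
          exact Fin.ext (by simp [Fin.val_add])
        rw [Finset.sum_range_succ, hm, hm', e]
        push_cast
        ring
    intro j l hl hl' m h
    obtain ⟨m', hm'⟩ := h2 j l
    -- Lengths from `1` to `5` are exactly those that do not return to the start modulo `6`.
    have hne : Equiv.swap i (i + 1) (j + Fin.ofNat 6 l) ≠ Equiv.swap i (i + 1) j := by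
      intro h4
      have h5 := congrArg Fin.val (add_eq_left.1 ((Equiv.swap i (i + 1)).injective h4))
      rw [Fin.val_ofNat] at h5
      simp at h5
      omega
    refine hb' _ _ hne (m - m') ?_
    push_cast
    rw [← h, hm']
    simp only [hbdef]
    ring

theorem Params.Generic.wordParam {A : Params} (hA : A.Generic) (l : List (Fin 6)) :
    (FST.wordParam l A).Generic := by
  induction l generalizing A with
  | nil => exact hA
  | cons i l ih => exact ih (hA.sParam i)

theorem Params.Generic.TParam_iterate {A : Params} (hA : A.Generic) (i : Fin 6) (n : ℕ) :
    ((TParam i)^[n] A).Generic := by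
  induction n generalizing A with
  | zero => exact hA
  | succ n ih => exact ih (hA.wordParam (translationWord i))

/-! ## Composition of pseudo-isomorphisms -/

namespace IsPseudoIso

variable {A B C : Params} {φ ψ : RatFun →ₐ[ℂ] RatFun}

theorem refl (A : Params) : IsPseudoIso A A (AlgHom.id ℂ RatFun) where
  birational := Function.bijective_id
  bijOn := Set.bijOn_id _

theorem trans (h : IsPseudoIso A B φ) (h' : IsPseudoIso B C ψ) : IsPseudoIso A C (φ.comp ψ) where
  birational := h.birational.comp h'.birational
  bijOn := h'.bijOn.comp h.bijOn

theorem pull_mk (h : IsPseudoIso A B φ) (D : Div B) :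
    h.pull (QuotientAddGroup.mk D) = QuotientAddGroup.mk (h.pullDiv D) := rfl

theorem pullDiv_refl (D : Div A) : (refl A).pullDiv D = D :=
  Finsupp.ext fun v => (pullDiv_apply _ D v).trans
    (congrArg D (Subtype.ext (funext fun f => (refl A).equiv_val v f)))

theorem pullDiv_trans (h : IsPseudoIso A B φ) (h' : IsPseudoIso B C ψ) (D : Div C) :
    (h.trans h').pullDiv D = h.pullDiv (h'.pullDiv D) := by
  refine Finsupp.ext fun v => ?_
  rw [pullDiv_apply, pullDiv_apply, pullDiv_apply]
  refine congrArg D (Subtype.ext (funext fun f => ?_))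
  exact ((h.trans h').equiv_val v f).trans ((h'.equiv_val _ f).trans (h.equiv_val v _)).symm

theorem pull_refl (D : Pic A) : (refl A).pull D = D := by
  induction D using QuotientAddGroup.induction_on with
  | H D => rw [pull_mk, pullDiv_refl]

theorem pull_trans (h : IsPseudoIso A B φ) (h' : IsPseudoIso B C ψ) (D : Pic C) :
    (h.trans h').pull D = h.pull (h'.pull D) := by
  induction D using QuotientAddGroup.induction_on with
  | H D => rw [pull_mk, pull_mk, pull_mk, pullDiv_trans]

theorem pullDiv_single (h : IsPseudoIso A B φ) {v : primeDivisors A} {v' : primeDivisors B}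
    (hv : v.1 ∘ φ = v'.1) : h.pullDiv (Finsupp.single v' 1) = Finsupp.single v 1 := by
  have hv' : h.bijOn.equiv _ v = v' := Subtype.ext hv
  classical
  ext u
  rw [pullDiv_apply, ← hv', Finsupp.single_apply, Finsupp.single_apply]
  exact if_congr (Equiv.apply_eq_iff_eq _) rfl rfl

end IsPseudoIso

/-! ## The reflections -/

theorem pairing_add (D D' : NSLattice) (d : NSDual) :
    pairing (D + D') d = pairing D d + pairing D' d := by
  simp only [pairing, Pi.add_apply, add_mul, Finset.sum_add_distrib]
  ring

theorem pairing_smul (n : ℤ) (D : NSLattice) (d : NSDual) : pairing (n • D) d = n * pairing D d := by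
  simp only [pairing, Pi.smul_apply, smul_eq_mul, mul_assoc, ← Finset.mul_sum]
  ring

theorem pairing_sum (D : NSLattice) (d : Fin 6 → NSDual) :
    pairing D (∑ i, d i) = ∑ i, pairing D (d i) := by
  simp only [pairing, Finset.sum_apply, Finset.mul_sum, Finset.sum_sub_distrib]
  rw [Finset.sum_comm, Finset.sum_comm (s := Finset.univ (α := Fin 12))]

/-- The reflection `D ↦ D + ⟨D, α̌ᵢ⟩ αᵢ`. -/
def reflect (i : Fin 6) (D : NSLattice) : NSLattice := D + pairing D (coroot i) • root i

/-- The action of a word of reflections. -/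
def wordReflect : List (Fin 6) → NSLattice → NSLattice
  | [], D => D
  | i :: l, D => reflect i (wordReflect l D)

theorem pairing_root_coroot (j i : Fin 6) : pairing (root j) (coroot i) =
    if j = i then -2 else if j = i + 1 ∨ j = i - 1 then 1 else 0 := by
  decide +revert

/-- The root part changes only in its `i`-th coefficient, by an amount fixed by the affine Cartan
matrix. Words of reflections can therefore be computed on six integers, without the sixteen lattice
coordinates. -/
theorem reflect_add_sum (i : Fin 6) (D : NSLattice) (c : Fin 6 → ℤ) :
    reflect i (D + ∑ k, c k • root k) = D + ∑ k, Function.update c i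
      (pairing D (coroot i) - c i + c (i + 1) + c (i - 1)) k • root k := by
  have h : ∑ k, c k * pairing (root k) (coroot i) = c (i + 1) + c (i - 1) - 2 * c i := by
    simp only [pairing_root_coroot, Fin.sum_univ_six]
    rcases fin_six_cases i with rfl | rfl | rfl | rfl | rfl | rfl <;>
      simp [two_eq_neg_one, three_eq_neg_one, four_eq_neg_one, five_eq_neg_one] <;>
      try ring
    rw [show (-1 : Fin 6) = 5 from rfl]
  have h' : pairing (D + ∑ k, c k • root k) (coroot i) =
      pairing D (coroot i) + (c (i + 1) + c (i - 1) - 2 * c i) := by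
    rw [pairing_add, ← h, Fin.sum_univ_six, Fin.sum_univ_six]
    simp only [pairing_add, pairing_smul]
  have h'' : ∀ e : ℤ, ∑ k, Function.update c i (c i + e) k • root k =
      ∑ k, c k • root k + e • root i := by
    intro e
    have : ∀ k, Function.update c i (c i + e) k • root k =
        c k • root k + (if k = i then e • root i else 0) := by
      intro k
      by_cases hk : k = i
      · subst hk; simp [add_smul]
      · simp [hk]
    simp only [this, Finset.sum_add_distrib, Finset.sum_ite_eq', Finset.mem_univ, if_true]
  rw [reflect, h', show pairing D (coroot i) - c i + c (i + 1) + c (i - 1) =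
    c i + (pairing D (coroot i) + (c (i + 1) + c (i - 1) - 2 * c i)) by ring, h'', add_assoc]

/-- The translate of `D` by an element of the root lattice. -/
def addRoots (D : NSLattice) (c₀ c₁ c₂ c₃ c₄ c₅ : ℤ) : NSLattice :=
  D + (c₀ • root 0 + c₁ • root 1 + c₂ • root 2 + c₃ • root 3 + c₄ • root 4 + c₅ • root 5)

theorem addRoots_eq (D : NSLattice) (c : Fin 6 → ℤ) :
    addRoots D (c 0) (c 1) (c 2) (c 3) (c 4) (c 5) = D + ∑ k, c k • root k := by
  rw [addRoots, Fin.sum_univ_six]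

/-- Passing the six coefficients as separate arguments allows a whole word to be evaluated by
rewriting. -/
theorem reflect_addRoots (i : Fin 6) (D : NSLattice) (c : Fin 6 → ℤ) {c' : Fin 6 → ℤ}
    (h : Function.update c i (pairing D (coroot i) - c i + c (i + 1) + c (i - 1)) = c') :
    reflect i (addRoots D (c 0) (c 1) (c 2) (c 3) (c 4) (c 5)) =
      addRoots D (c' 0) (c' 1) (c' 2) (c' 3) (c' 4) (c' 5) := by
  rw [addRoots_eq, addRoots_eq, reflect_add_sum, h]

section

variable (D : NSLattice) (c₀ c₁ c₂ c₃ c₄ c₅ : ℤ)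

theorem reflect_zero_addRoots : reflect 0 (addRoots D c₀ c₁ c₂ c₃ c₄ c₅) =
    addRoots D (pairing D (coroot 0) - c₀ + c₁ + c₅) c₁ c₂ c₃ c₄ c₅ :=
  reflect_addRoots 0 D ![c₀, c₁, c₂, c₃, c₄, c₅]
    (c' := ![pairing D (coroot 0) - c₀ + c₁ + c₅, c₁, c₂, c₃, c₄, c₅])
    (by funext k; fin_cases k <;> rfl)

theorem reflect_one_addRoots : reflect 1 (addRoots D c₀ c₁ c₂ c₃ c₄ c₅) =
    addRoots D c₀ (pairing D (coroot 1) - c₁ + c₂ + c₀) c₂ c₃ c₄ c₅ :=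
  reflect_addRoots 1 D ![c₀, c₁, c₂, c₃, c₄, c₅]
    (c' := ![c₀, pairing D (coroot 1) - c₁ + c₂ + c₀, c₂, c₃, c₄, c₅])
    (by funext k; fin_cases k <;> rfl)

theorem reflect_two_addRoots : reflect 2 (addRoots D c₀ c₁ c₂ c₃ c₄ c₅) =
    addRoots D c₀ c₁ (pairing D (coroot 2) - c₂ + c₃ + c₁) c₃ c₄ c₅ :=
  reflect_addRoots 2 D ![c₀, c₁, c₂, c₃, c₄, c₅]
    (c' := ![c₀, c₁, pairing D (coroot 2) - c₂ + c₃ + c₁, c₃, c₄, c₅])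
    (by funext k; fin_cases k <;> rfl)

theorem reflect_three_addRoots : reflect 3 (addRoots D c₀ c₁ c₂ c₃ c₄ c₅) =
    addRoots D c₀ c₁ c₂ (pairing D (coroot 3) - c₃ + c₄ + c₂) c₄ c₅ :=
  reflect_addRoots 3 D ![c₀, c₁, c₂, c₃, c₄, c₅]
    (c' := ![c₀, c₁, c₂, pairing D (coroot 3) - c₃ + c₄ + c₂, c₄, c₅])
    (by funext k; fin_cases k <;> rfl)

theorem reflect_four_addRoots : reflect 4 (addRoots D c₀ c₁ c₂ c₃ c₄ c₅) =
    addRoots D c₀ c₁ c₂ c₃ (pairing D (coroot 4) - c₄ + c₅ + c₃) c₅ :=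
  reflect_addRoots 4 D ![c₀, c₁, c₂, c₃, c₄, c₅]
    (c' := ![c₀, c₁, c₂, c₃, pairing D (coroot 4) - c₄ + c₅ + c₃, c₅])
    (by funext k; fin_cases k <;> rfl)

theorem reflect_five_addRoots : reflect 5 (addRoots D c₀ c₁ c₂ c₃ c₄ c₅) =
    addRoots D c₀ c₁ c₂ c₃ c₄ (pairing D (coroot 5) - c₅ + c₀ + c₄) :=
  reflect_addRoots 5 D ![c₀, c₁, c₂, c₃, c₄, c₅]
    (c' := ![c₀, c₁, c₂, c₃, c₄, pairing D (coroot 5) - c₅ + c₀ + c₄])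
    (by funext k; fin_cases k <;> rfl)

end

theorem addRoots_zero (D : NSLattice) : addRoots D 0 0 0 0 0 0 = D := by simp [addRoots]

/-- Ten coefficient updates, symbolic in the six numbers `⟨D, α̌ₖ⟩`, produce the translation; for
each `i` the final comparison is an identity in a `ℤ`-module. -/
theorem wordReflect_translationWord (i : Fin 6) (D : NSLattice) :
    wordReflect (translationWord i) D = kac i 1 D := by
  have hδ : pairing D coδ = ∑ k, pairing D (coroot k) := pairing_sum D coroot
  rw [Fin.sum_univ_six] at hδ
  -- Half of `⟨αᵢ, α̌ᵢ⟩ = -2` gives the sign of the second term.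
  have hr : kac i 1 D = D + (pairing D coδ • root i +
      (pairing D coδ - pairing D (coroot i)) • (root 0 + root 1 + root 2 + root 3 + root 4 + root 5))
      := by
    rw [kac, pairing_root_coroot_self, δ, Fin.sum_univ_six, add_assoc]
    congr 3 <;> push_cast <;> ring
  rw [hr, hδ]
  have key : ∀ l, wordReflect l D = wordReflect l (addRoots D 0 0 0 0 0 0) := fun l => by
    rw [addRoots_zero]
  rw [key]
  rcases fin_six_cases i with rfl | rfl | rfl | rfl | rfl | rfl
  -- Pullback reverses composition: the generator applied first to points gives the outermost
  -- reflection.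
  · change reflect 0 (reflect 1 (reflect 2 (reflect 3 (reflect 4 (reflect 5 (reflect 4 (reflect 3
      (reflect 2 (reflect 1 (addRoots D 0 0 0 0 0 0)))))))))) = _
    simp only [reflect_zero_addRoots, reflect_one_addRoots, reflect_two_addRoots,
      reflect_three_addRoots, reflect_four_addRoots, reflect_five_addRoots]
    rw [addRoots]
    module
  · change reflect 1 (reflect 2 (reflect 3 (reflect 4 (reflect 5 (reflect 0 (reflect 5 (reflect 4
      (reflect 3 (reflect 2 (addRoots D 0 0 0 0 0 0)))))))))) = _
    simp only [reflect_zero_addRoots, reflect_one_addRoots, reflect_two_addRoots,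
      reflect_three_addRoots, reflect_four_addRoots, reflect_five_addRoots]
    rw [addRoots]
    module
  · change reflect 2 (reflect 3 (reflect 4 (reflect 5 (reflect 0 (reflect 1 (reflect 0 (reflect 5
      (reflect 4 (reflect 3 (addRoots D 0 0 0 0 0 0)))))))))) = _
    simp only [reflect_zero_addRoots, reflect_one_addRoots, reflect_two_addRoots,
      reflect_three_addRoots, reflect_four_addRoots, reflect_five_addRoots]
    rw [addRoots]
    module
  · change reflect 3 (reflect 4 (reflect 5 (reflect 0 (reflect 1 (reflect 2 (reflect 1 (reflect 0
      (reflect 5 (reflect 4 (addRoots D 0 0 0 0 0 0)))))))))) = _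
    simp only [reflect_zero_addRoots, reflect_one_addRoots, reflect_two_addRoots,
      reflect_three_addRoots, reflect_four_addRoots, reflect_five_addRoots]
    rw [addRoots]
    module
  · change reflect 4 (reflect 5 (reflect 0 (reflect 1 (reflect 2 (reflect 3 (reflect 2 (reflect 1
      (reflect 0 (reflect 5 (addRoots D 0 0 0 0 0 0)))))))))) = _
    simp only [reflect_zero_addRoots, reflect_one_addRoots, reflect_two_addRoots,
      reflect_three_addRoots, reflect_four_addRoots, reflect_five_addRoots]
    rw [addRoots]
    module
  · change reflect 5 (reflect 0 (reflect 1 (reflect 2 (reflect 3 (reflect 4 (reflect 3 (reflect 2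
      (reflect 1 (reflect 0 (addRoots D 0 0 0 0 0 0)))))))))) = _
    simp only [reflect_zero_addRoots, reflect_one_addRoots, reflect_two_addRoots,
      reflect_three_addRoots, reflect_four_addRoots, reflect_five_addRoots]
    rw [addRoots]
    module

/-- The translations of the parameter `n` form a semigroup. -/
theorem kac_one_kac (i : Fin 6) (n : ℕ) (D : NSLattice) : kac i 1 (kac i n D) = kac i (n + 1) D := by
  have h1 : pairing (root i) coδ = 0 := by decide +revert
  have h2 : pairing δ coδ = 0 := by decide
  have h3 : pairing δ (coroot i) = 0 := by decide +revert
  have h4 := pairing_root_coroot_self i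
  -- The pairing with `δ̌` is invariant because `δ̌` annihilates `αᵢ` and `δ`. The pairing with
  -- `α̌ᵢ` drops linearly in `n`; its accumulation is the quadratic term.
  have h5 : pairing (kac i n D) coδ = pairing D coδ := by
    rw [kac, pairing_add, pairing_add, pairing_smul, pairing_smul, h1, h2]
    ring
  have h6 : pairing (kac i n D) (coroot i) = pairing D (coroot i) - 2 * n * pairing D coδ := by
    rw [kac, pairing_add, pairing_add, pairing_smul, pairing_smul, h3, h4]
    ring
  rw [kac, h5, h6, kac, kac, h4, show (-2 : ℤ) / 2 = -1 from rfl]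
  push_cast
  module

end

section

/-! ## Orders along the boundary -/

/-- In the chart the function is split into a power of the equation of the divisor and a cofactor
that is regular and nonzero at the generic point. -/
theorem boundaryOrd_eval {A : Params} {b : Comp} (e u : Ex) (k : ℤ)
    (h : e.eval (Ex.evals (chartEx A b) x) = x (chartEq b) ^ k * u.eval x)
    (hu : u.Def (Function.update x (chartEq b) 0))
    (hu' : u.eval (Function.update x (chartEq b) 0) ≠ 0) : boundaryOrd A b (e.eval x) = k := by
  have hd : Dominant (Ex.evals (chartEx A b) x) := dominant_chart A b
  have hw := isOrd_ordAlong (irreducible_X (chartEq b))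
  have hx := x_ne_zero (chartEq b)
  rw [boundaryOrd_apply, subst_eval hd, h, hw.mul (zpow_ne_zero k hx) ((Red.eval hu).ne_zero hu'),
    hw.zpow hx, (Red.eval hu).ordAlong_eq_zero hu', add_zero]
  rw [show ordAlong (X (chartEq b)) (x (chartEq b)) = 1 from
    ordAlong_self (irreducible_X (chartEq b)), mul_one]

variable {A : Params}

/-- In this and the following tables `ord…` lists orders along the boundary and `unit…` the
cofactors; in the default case, where the order is zero, the cofactor is the function itself in the
chart. Besides the coordinates, the functions tabulated are the equations of the exchanged
hypersurfaces. -/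
def ordX₀ : Comp → ℤ
  | Sum.inl 0 | Sum.inr 2 | Sum.inr 6 => -1
  | Sum.inr 1 | Sum.inr 5 => 1
  | _ => 0

def unitX₀ (A : Params) : Comp → Ex
  | Sum.inl 0 | Sum.inr 2 | Sum.inr 6 | Sum.inr 1 | Sum.inr 5 => 1
  | b => chartEx A b 0

theorem boundaryOrd_X₀ (hA : A.Generic) (b : Comp) :
    boundaryOrd A b ((y₀ : Ex).eval x) = ordX₀ b := by
  have h0 := x_ne_zero 0
  have h1 := x_ne_zero 1
  have h2 := x_ne_zero 2
  have h3 := x_ne_zero 3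
  have ht := hA.t_ne_zero
  refine boundaryOrd_eval (y₀) (unitX₀ A b) (ordX₀ b) ?_ ?_ ?_
  · rcases b with k | k <;> fin_cases k <;> simp [chartEx, chartEq, Ex.evals, unitX₀, ordX₀]
  · rcases b with k | k <;> fin_cases k <;> simp [chartEx, chartEq, unitX₀, *]
  · rcases b with k | k <;> fin_cases k <;> simp [chartEx, chartEq, unitX₀, *]

def ordX₁ : Comp → ℤ
  | Sum.inl 1 | Sum.inr 4 | Sum.inr 6 => -1
  | Sum.inr 3 | Sum.inr 5 => 1
  | _ => 0

def unitX₁ (A : Params) : Comp → Ex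
  | Sum.inl 1 | Sum.inr 4 | Sum.inr 3 => 1
  | Sum.inr 6 => 1 / y₁
  | Sum.inr 5 => y₁
  | b => chartEx A b 1

theorem boundaryOrd_X₁ (hA : A.Generic) (b : Comp) :
    boundaryOrd A b ((y₁ : Ex).eval x) = ordX₁ b := by
  have h0 := x_ne_zero 0
  have h1 := x_ne_zero 1
  have h2 := x_ne_zero 2
  have h3 := x_ne_zero 3
  have ht := hA.t_ne_zero
  refine boundaryOrd_eval (y₁) (unitX₁ A b) (ordX₁ b) ?_ ?_ ?_
  · rcases b with k | k <;> fin_cases k <;> simp [chartEx, chartEq, Ex.evals, unitX₁, ordX₁]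
    all_goals field_simp
  · rcases b with k | k <;> fin_cases k <;> simp [chartEx, chartEq, unitX₁, *]
  · rcases b with k | k <;> fin_cases k <;> simp [chartEx, chartEq, unitX₁, *]

def ordX₂ : Comp → ℤ
  | Sum.inl 2 | Sum.inr 7 | Sum.inr 8 | Sum.inr 11 | Sum.inr 0 => -1
  | Sum.inr 1 => 1
  | _ => 0

def unitX₂ (A : Params) : Comp → Ex
  | Sum.inl 2 | Sum.inr 7 | Sum.inr 8 | Sum.inr 11 | Sum.inr 0 => 1
  | Sum.inr 1 => y₂
  | b => chartEx A b 2

theorem boundaryOrd_X₂ (hA : A.Generic) (b : Comp) :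
    boundaryOrd A b ((y₂ : Ex).eval x) = ordX₂ b := by
  have h0 := x_ne_zero 0
  have h1 := x_ne_zero 1
  have h2 := x_ne_zero 2
  have h3 := x_ne_zero 3
  have ht := hA.t_ne_zero
  have ha := hA.ne_zero 1
  have h4 : -x 3 + κ (A.a 3) - κ A.η ≠ 0 := by
    simpa using ((0 : ℂ) - y₃ + A.a 3 - A.η).ne_zero ![0, 0, 0, A.a 3 - A.η - 1] (by simp)
      (by simp; ring_nf; simp)
  have h5 : -x 3 - κ A.η ≠ 0 := by
    simpa using ((0 : ℂ) - y₃ - A.η).ne_zero ![0, 0, 0, -A.η - 1] (by simp) (by simp)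
  refine boundaryOrd_eval (y₂) (unitX₂ A b) (ordX₂ b) ?_ ?_ ?_
  · rcases b with k | k <;> fin_cases k <;> simp [chartEx, chartEq, Ex.evals, unitX₂, ordX₂]
  · rcases b with k | k <;> fin_cases k <;> simp [chartEx, chartEq, unitX₂, *]
  · rcases b with k | k <;> fin_cases k <;> simp [chartEx, chartEq, unitX₂, *]

def ordX₃ : Comp → ℤ
  | Sum.inl 3 | Sum.inr 9 | Sum.inr 10 | Sum.inr 11 | Sum.inr 0 => -1
  | Sum.inr 3 => 1
  | _ => 0

def unitX₃ (A : Params) : Comp → Ex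
  | Sum.inl 3 | Sum.inr 9 | Sum.inr 10 => 1
  | Sum.inr 11 => 1 / y₃
  | Sum.inr 0 => 1 / (y₂ * y₃ - 1)
  | Sum.inr 3 => y₃
  | b => chartEx A b 3

theorem boundaryOrd_X₃ (hA : A.Generic) (b : Comp) :
    boundaryOrd A b ((y₃ : Ex).eval x) = ordX₃ b := by
  have h0 := x_ne_zero 0
  have h1 := x_ne_zero 1
  have h2 := x_ne_zero 2
  have h3 := x_ne_zero 3
  have ht := hA.t_ne_zero
  have ha := hA.ne_zero 5
  refine boundaryOrd_eval (y₃) (unitX₃ A b) (ordX₃ b) ?_ ?_ ?_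
  · rcases b with k | k <;> fin_cases k <;> simp [chartEx, chartEq, Ex.evals, unitX₃, ordX₃]
    all_goals field_simp
  · rcases b with k | k <;> fin_cases k <;> simp [chartEx, chartEq, unitX₃, *]
  · rcases b with k | k <;> fin_cases k <;> simp [chartEx, chartEq, unitX₃, *]

def ordTwo : Comp → ℤ
  | Sum.inl 0 | Sum.inr 2 | Sum.inr 6 => -1
  | Sum.inr 7 | Sum.inr 8 => 1
  | _ => 0

def unitTwo (A : Params) : Comp → Ex
  | Sum.inl 0 | Sum.inr 2 | Sum.inr 6 => 1 - A.t * y₀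
  | Sum.inr 7 => y₀
  | Sum.inr 8 => A.a 2 * A.t + y₂ * y₀
  | b => chartEx A b 0 - A.t

theorem boundaryOrd_Two (hA : A.Generic) (b : Comp) :
    boundaryOrd A b ((y₀ - A.t : Ex).eval x) = ordTwo b := by
  have h0 := x_ne_zero 0
  have h1 := x_ne_zero 1
  have h2 := x_ne_zero 2
  have h3 := x_ne_zero 3
  have ht := hA.t_ne_zero
  have ha := hA.ne_zero 2
  have h4 := x_sub_const_ne_zero 0 A.t
  have h5 := x_sub_const_ne_zero 1 A.t
  refine boundaryOrd_eval (y₀ - A.t) (unitTwo A b) (ordTwo b) ?_ ?_ ?_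
  · rcases b with k | k <;> fin_cases k <;> simp [chartEx, chartEq, Ex.evals, unitTwo, ordTwo]
    all_goals field_simp
  · rcases b with k | k <;> fin_cases k <;> simp [chartEx, chartEq, unitTwo, *]
  · rcases b with k | k <;> fin_cases k <;> simp [chartEx, chartEq, unitTwo, *]

def ordFour : Comp → ℤ
  | Sum.inl 1 | Sum.inr 4 | Sum.inr 6 => -1
  | Sum.inr 9 | Sum.inr 10 => 1
  | _ => 0

def unitFour (A : Params) : Comp → Ex
  | Sum.inl 1 | Sum.inr 4 => 1 - y₁
  | Sum.inr 6 => 1 / y₁ - y₀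
  | Sum.inr 9 => y₁
  | Sum.inr 10 => A.a 4 + y₃ * y₁
  | b => chartEx A b 1 - 1

theorem boundaryOrd_Four (hA : A.Generic) (b : Comp) :
    boundaryOrd A b ((y₁ - 1 : Ex).eval x) = ordFour b := by
  have h0 := x_ne_zero 0
  have h1 := x_ne_zero 1
  have h2 := x_ne_zero 2
  have h3 := x_ne_zero 3
  have ht := hA.t_ne_zero
  have ha := hA.ne_zero 4
  have h4 := x_sub_one_ne_zero 1
  refine boundaryOrd_eval (y₁ - 1) (unitFour A b) (ordFour b) ?_ ?_ ?_
  · rcases b with k | k <;> fin_cases k <;> simp [chartEx, chartEq, Ex.evals, unitFour, ordFour]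
    all_goals field_simp
  · rcases b with k | k <;> fin_cases k <;> simp [chartEx, chartEq, unitFour, *]
  · rcases b with k | k <;> fin_cases k <;> simp [chartEx, chartEq, unitFour, *]

def ordZero : Comp → ℤ
  | Sum.inl 0 | Sum.inl 1 | Sum.inr 2 | Sum.inr 4 | Sum.inr 6 => -1
  | Sum.inr 5 | Sum.inr 11 | Sum.inr 0 => 1
  | _ => 0

def unitZero (A : Params) : Comp → Ex
  | Sum.inl 0 | Sum.inr 2 => 1 - y₀ * y₁
  | Sum.inl 1 | Sum.inr 4 => y₀ * y₁ - 1
  | Sum.inr 5 => 1 - y₁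
  | Sum.inr 6 => 1 - 1 / y₁
  | Sum.inr 11 => y₀
  | Sum.inr 0 => A.a 0 * y₁ + y₂ * y₀
  | b => chartEx A b 0 - chartEx A b 1

theorem boundaryOrd_Zero (hA : A.Generic) (b : Comp) :
    boundaryOrd A b ((y₀ - y₁ : Ex).eval x) = ordZero b := by
  have h0 := x_ne_zero 0
  have h1 := x_ne_zero 1
  have h2 := x_ne_zero 2
  have h3 := x_ne_zero 3
  have ht := hA.t_ne_zero
  have ha := hA.ne_zero 0
  have h4 : x 0 - x 1 ≠ 0 := x_sub_x_ne_zero (by decide)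
  have h5 : 1 - x 1 ≠ 0 := by simpa using (1 - y₁).ne_zero 0 (by simp) (by simp)
  have h6 : 1 - (x 1)⁻¹ ≠ 0 := by
    simpa using (1 - 1 / y₁).ne_zero ![0, 2, 0, 0] (by simp) (by simp; norm_num)
  have h7 : κ A.t - x 1 ≠ 0 := (A.t - y₁).ne_zero ![0, A.t - 1, 0, 0] (by simp) (by simp)
  have h8 := x_sub_one_ne_zero 0
  refine boundaryOrd_eval (y₀ - y₁) (unitZero A b) (ordZero b) ?_ ?_ ?_
  · rcases b with k | k <;> fin_cases k <;> simp [chartEx, chartEq, Ex.evals, unitZero, ordZero]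
    all_goals field_simp
  · rcases b with k | k <;> fin_cases k <;> simp [chartEx, chartEq, unitZero, *]
  · rcases b with k | k <;> fin_cases k <;> simp [chartEx, chartEq, unitZero, *]

def ordOne : Comp → ℤ
  | Sum.inl 2 | Sum.inr 7 | Sum.inr 8 | Sum.inr 11 | Sum.inr 0 => -1
  | Sum.inr 2 => 1
  | _ => 0

def unitOne (A : Params) : Comp → Ex
  | Sum.inl 2 | Sum.inr 7 | Sum.inr 8 | Sum.inr 11 | Sum.inr 0 => 1 + A.a 1 * y₂
  | Sum.inr 2 => y₂
  | b => chartEx A b 2 + A.a 1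

theorem boundaryOrd_One (hA : A.Generic) (b : Comp) :
    boundaryOrd A b ((y₂ + A.a 1 : Ex).eval x) = ordOne b := by
  have h0 := x_ne_zero 0
  have h1 := x_ne_zero 1
  have h2 := x_ne_zero 2
  have h3 := x_ne_zero 3
  have ht := hA.t_ne_zero
  have ha := hA.ne_zero 1
  have h4 := x_add_const_ne_zero 2 (A.a 1)
  have h5 : -x 3 + κ (A.a 3) - κ A.η + κ (A.a 1) ≠ 0 := by
    simpa using ((0 : ℂ) - y₃ + A.a 3 - A.η + A.a 1).ne_zero ![0, 0, 0, A.a 3 - A.η + A.a 1 - 1]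
      (by simp) (by simp; ring_nf; simp)
  have h6 : -x 3 - κ A.η + κ (A.a 1) ≠ 0 := by
    simpa using ((0 : ℂ) - y₃ - A.η + A.a 1).ne_zero ![0, 0, 0, -A.η + A.a 1 - 1] (by simp)
      (by simp; ring_nf; simp)
  refine boundaryOrd_eval (y₂ + A.a 1) (unitOne A b) (ordOne b) ?_ ?_ ?_
  · rcases b with k | k <;> fin_cases k <;> simp [chartEx, chartEq, Ex.evals, unitOne, ordOne]
    all_goals field_simp
  · rcases b with k | k <;> fin_cases k <;> simp [chartEx, chartEq, unitOne, *]
  · rcases b with k | k <;> fin_cases k <;> simp [chartEx, chartEq, unitOne, *]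

def ordFive : Comp → ℤ
  | Sum.inl 3 | Sum.inr 9 | Sum.inr 10 | Sum.inr 11 | Sum.inr 0 => -1
  | Sum.inr 4 => 1
  | _ => 0

def unitFive (A : Params) : Comp → Ex
  | Sum.inl 3 | Sum.inr 9 | Sum.inr 10 => 1 + A.a 5 * y₃
  | Sum.inr 4 => y₃
  | Sum.inr 11 => 1 / y₃ + A.a 5 * y₂
  | Sum.inr 0 => 1 / (y₂ * y₃ - 1) + A.a 5 * y₂
  | b => chartEx A b 3 + A.a 5

theorem boundaryOrd_Five (hA : A.Generic) (b : Comp) :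
    boundaryOrd A b ((y₃ + A.a 5 : Ex).eval x) = ordFive b := by
  have h0 := x_ne_zero 0
  have h1 := x_ne_zero 1
  have h2 := x_ne_zero 2
  have h3 := x_ne_zero 3
  have ht := hA.t_ne_zero
  have ha := hA.ne_zero 5
  have h4 := x_add_const_ne_zero 3 (A.a 5)
  refine boundaryOrd_eval (y₃ + A.a 5) (unitFive A b) (ordFive b) ?_ ?_ ?_
  · rcases b with k | k <;> fin_cases k <;> simp [chartEx, chartEq, Ex.evals, unitFive, ordFive]
    all_goals field_simp
  · rcases b with k | k <;> fin_cases k <;> simp [chartEx, chartEq, unitFive, *]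
  · rcases b with k | k <;> fin_cases k <;> simp [chartEx, chartEq, unitFive, *]

/-- The entry at `0` is zero although `r₁` and `r₂` have poles there: their polar parts cancel on
`ℰ₁₂`, but not on `ℰ₁₁`. -/
def ordThree : Comp → ℤ
  | Sum.inl 2 | Sum.inl 3 | Sum.inr 7 | Sum.inr 8 | Sum.inr 9 | Sum.inr 10 | Sum.inr 11 => -1
  | Sum.inr 5 => 1
  | _ => 0

def unitThree (A : Params) : Comp → Ex
  | Sum.inl 2 | Sum.inr 7 | Sum.inr 8 => 1 + y₂ * (y₃ - (A.a 3 - A.η))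
  | Sum.inl 3 | Sum.inr 9 | Sum.inr 10 => 1 + y₃ * (y₂ - (A.a 3 - A.η))
  | Sum.inr 11 => 1 + 1 / y₃ - (A.a 3 - A.η) * y₂
  | Sum.inr 0 => y₃ / (y₂ * y₃ - 1) - (A.a 3 - A.η)
  | Sum.inr 5 => y₂
  | Sum.inr 6 => y₀ * y₂ - A.a 3
  | b => chartEx A b 2 + chartEx A b 3 - (A.a 3 - A.η)

theorem boundaryOrd_Three (hA : A.Generic) (b : Comp) :
    boundaryOrd A b ((y₂ + y₃ - (A.a 3 - A.η) : Ex).eval x) = ordThree b := by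
  have h0 := x_ne_zero 0
  have h1 := x_ne_zero 1
  have h2 := x_ne_zero 2
  have h3 := x_ne_zero 3
  have ha := hA.ne_zero 3
  have h4 : x 2 * x 3 - 1 ≠ 0 := by simpa using (y₂ * y₃ - 1).ne_zero 0 (by simp) (by simp)
  have h5 : 1 + (x 3)⁻¹ ≠ 0 := by
    simpa using (1 + 1 / y₃).ne_zero 1 (by simp) (by simp)
  have h6 : x 2 + x 3 - (κ (A.a 3) - κ A.η) ≠ 0 := by
    simpa using (y₂ + y₃ - (A.a 3 - A.η)).ne_zero
      ![0, 0, A.a 3 - A.η + 1, 0] (by simp) (by simp)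
  have h7 : x 3 / -1 - (κ (A.a 3) - κ A.η) ≠ 0 := by
    simpa using (y₃ / ((0 : ℂ) - 1) - (A.a 3 - A.η)).ne_zero
      ![0, 0, 0, -(A.a 3 - A.η) - 1] (by simp) (by simp; ring_nf; simp)
  have h8 : x 3 - (κ (A.a 3) - κ A.η) ≠ 0 := by
    simpa using (y₃ - (A.a 3 - A.η)).ne_zero
      ![0, 0, 0, A.a 3 - A.η + 1] (by simp) (by simp)
  have h9 : -κ (A.a 1) + x 3 - (κ (A.a 3) - κ A.η) ≠ 0 := by
    simpa using ((0 : ℂ) - A.a 1 + y₃ - (A.a 3 - A.η)).ne_zero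
      ![0, 0, 0, A.a 1 + (A.a 3 - A.η) + 1] (by simp) (by simp; ring_nf; simp)
  have h10 : x 2 - (κ (A.a 3) - κ A.η) ≠ 0 := by
    simpa using (y₂ - (A.a 3 - A.η)).ne_zero
      ![0, 0, A.a 3 - A.η + 1, 0] (by simp) (by simp)
  have h11 : x 2 + -κ (A.a 5) - (κ (A.a 3) - κ A.η) ≠ 0 := by
    simpa using (y₂ + ((0 : ℂ) - A.a 5) - (A.a 3 - A.η)).ne_zero
      ![0, 0, A.a 5 + (A.a 3 - A.η) + 1, 0] (by simp) (by simp; ring_nf; simp)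
  refine boundaryOrd_eval (y₂ + y₃ - (A.a 3 - A.η)) (unitThree A b) (ordThree b) ?_ ?_ ?_
  · rcases b with k | k <;> fin_cases k <;> simp [chartEx, chartEq, Ex.evals, unitThree, ordThree]
    all_goals field_simp (disch := first
      | assumption | exact ne_of_eq_of_ne (by ring1) h4)
    all_goals ring
  · rcases b with k | k <;> fin_cases k <;> simp [chartEx, chartEq, unitThree, *]
  · rcases b with k | k <;> fin_cases k <;> simp [chartEx, chartEq, unitThree, *]

def ordThree' : Comp → ℤ
  | Sum.inl 2 | Sum.inl 3 | Sum.inr 7 | Sum.inr 8 | Sum.inr 9 | Sum.inr 10 | Sum.inr 11 => -1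
  | Sum.inr 6 => 1
  | _ => 0

def unitThree' (A : Params) : Comp → Ex
  | Sum.inl 2 | Sum.inr 7 | Sum.inr 8 => 1 + y₂ * (y₃ - ((0 : ℂ) - A.η))
  | Sum.inl 3 | Sum.inr 9 | Sum.inr 10 => 1 + y₃ * (y₂ - ((0 : ℂ) - A.η))
  | Sum.inr 11 => 1 + 1 / y₃ - ((0 : ℂ) - A.η) * y₂
  | Sum.inr 0 => y₃ / (y₂ * y₃ - 1) - ((0 : ℂ) - A.η)
  | Sum.inr 6 => y₂
  | Sum.inr 5 => y₀ * y₂ + A.a 3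
  | b => chartEx A b 2 + chartEx A b 3 - ((0 : ℂ) - A.η)

theorem boundaryOrd_Three' (hA : A.Generic) (b : Comp) :
    boundaryOrd A b ((y₂ + y₃ - ((0 : ℂ) - A.η) : Ex).eval x) = ordThree' b := by
  have h0 := x_ne_zero 0
  have h1 := x_ne_zero 1
  have h2 := x_ne_zero 2
  have h3 := x_ne_zero 3
  have ha := hA.ne_zero 3
  have h4 : x 2 * x 3 - 1 ≠ 0 := by simpa using (y₂ * y₃ - 1).ne_zero 0 (by simp) (by simp)
  have h5 : 1 + (x 3)⁻¹ ≠ 0 := by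
    simpa using (1 + 1 / y₃).ne_zero 1 (by simp) (by simp)
  have h6 : x 2 + x 3 + κ A.η ≠ 0 := by
    simpa using (y₂ + y₃ - ((0 : ℂ) - A.η)).ne_zero
      ![0, 0, -A.η + 1, 0] (by simp) (by simp)
  have h7 : x 3 / -1 + κ A.η ≠ 0 := by
    simpa using (y₃ / ((0 : ℂ) - 1) - ((0 : ℂ) - A.η)).ne_zero
      ![0, 0, 0, -(-A.η) - 1] (by simp) (by simp; ring_nf; simp)
  have h8 : x 3 + κ A.η ≠ 0 := by
    simpa using (y₃ - ((0 : ℂ) - A.η)).ne_zero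
      ![0, 0, 0, -A.η + 1] (by simp) (by simp)
  have h9 : -κ (A.a 1) + x 3 + κ A.η ≠ 0 := by
    simpa using ((0 : ℂ) - A.a 1 + y₃ - ((0 : ℂ) - A.η)).ne_zero
      ![0, 0, 0, A.a 1 + (-A.η) + 1] (by simp) (by simp; ring_nf; simp)
  have h10 : x 2 + κ A.η ≠ 0 := by
    simpa using (y₂ - ((0 : ℂ) - A.η)).ne_zero
      ![0, 0, -A.η + 1, 0] (by simp) (by simp)
  have h11 : x 2 + -κ (A.a 5) + κ A.η ≠ 0 := by
    simpa using (y₂ + ((0 : ℂ) - A.a 5) - ((0 : ℂ) - A.η)).ne_zero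
      ![0, 0, A.a 5 + (-A.η) + 1, 0] (by simp) (by simp; ring_nf; simp)
  refine boundaryOrd_eval (y₂ + y₃ - ((0 : ℂ) - A.η)) (unitThree' A b) (ordThree' b) ?_ ?_ ?_
  · rcases b with k | k <;> fin_cases k <;> simp [chartEx, chartEq, Ex.evals, unitThree', ordThree']
    all_goals field_simp (disch := first
      | assumption | exact ne_of_eq_of_ne (by ring1) h4)
    all_goals ring
  · rcases b with k | k <;> fin_cases k <;> simp [chartEx, chartEq, unitThree', *]
  · rcases b with k | k <;> fin_cases k <;> simp [chartEx, chartEq, unitThree', *]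

end

section

/-! ## Partial derivatives and the canonical divisor -/

/-- The quotient rule does not depend on the fraction chosen. This gives the rules of a derivation
without any reference to lowest terms. -/
theorem partialDeriv_div_algebraMap (j : Fin 4) (n : Poly) {d : Poly} (hd : d ≠ 0) :
    partialDeriv j (algebraMap Poly RatFun n / algebraMap Poly RatFun d) =
      algebraMap Poly RatFun (pderiv j n * d - n * pderiv j d) / algebraMap Poly RatFun d ^ 2 := by
  set f := algebraMap Poly RatFun n / algebraMap Poly RatFun d with hf
  have hd' := algebraMap_poly_ne_zero hd
  have hD := den_ne_zero f
  have hD' := algebraMap_poly_ne_zero hD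
  have h1 := num_div_den f
  unfold partialDeriv
  set N := IsFractionRing.num Poly f
  set D : Poly := (IsFractionRing.den Poly f : Poly)
  have h2 : N * d = n * D := by
    apply FaithfulSMul.algebraMap_injective Poly RatFun
    rw [map_mul, map_mul]
    rw [hf] at h1
    exact (div_eq_div_iff hD' hd').1 h1
  have h3 := congrArg (pderiv j) h2
  rw [Derivation.leibniz, Derivation.leibniz] at h3
  simp only [smul_eq_mul] at h3
  -- A combination of the cross-multiplied equation and its derivative.
  have h4 : (pderiv j N * D - N * pderiv j D) * d ^ 2 = (pderiv j n * d - n * pderiv j d) * D ^ 2 := by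
    linear_combination (D * d) * h3 - (D * pderiv j d + d * pderiv j D) * h2
  rw [div_eq_div_iff (pow_ne_zero 2 hD') (pow_ne_zero 2 hd'), ← map_pow, ← map_pow, ← map_mul,
    ← map_mul, h4]

theorem partialDeriv_algebraMap (j : Fin 4) (n : Poly) :
    partialDeriv j (algebraMap Poly RatFun n) = algebraMap Poly RatFun (pderiv j n) := by
  have h := partialDeriv_div_algebraMap j n one_ne_zero
  simpa using h

theorem partialDeriv_x (j k : Fin 4) : partialDeriv j (x k) = if k = j then 1 else 0 := by
  rw [x, partialDeriv_algebraMap, pderiv_X, Pi.single_apply]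
  split_ifs <;> simp

theorem partialDeriv_κ (j : Fin 4) (c : ℂ) : partialDeriv j (κ c) = 0 := by
  rw [← algebraMap_C, partialDeriv_algebraMap, pderiv_C, map_zero]

theorem partialDeriv_zero (j : Fin 4) : partialDeriv j 0 = 0 := by
  simpa using partialDeriv_κ j 0

theorem partialDeriv_one (j : Fin 4) : partialDeriv j 1 = 0 := by
  simpa using partialDeriv_κ j 1

theorem partialDeriv_add (j : Fin 4) (f g : RatFun) :
    partialDeriv j (f + g) = partialDeriv j f + partialDeriv j g := by
  obtain ⟨n, d, hd, rfl⟩ := exists_fraction f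
  obtain ⟨n', d', hd', rfl⟩ := exists_fraction g
  have e := algebraMap_poly_ne_zero hd
  have e' := algebraMap_poly_ne_zero hd'
  rw [div_add_div _ _ e e', ← map_mul, ← map_mul, ← map_add, ← map_mul,
    partialDeriv_div_algebraMap j _ (mul_ne_zero hd hd'), partialDeriv_div_algebraMap j _ hd,
    partialDeriv_div_algebraMap j _ hd']
  simp only [map_add, map_sub, map_mul, Derivation.leibniz, smul_eq_mul]
  field_simp
  ring

theorem partialDeriv_mul (j : Fin 4) (f g : RatFun) :
    partialDeriv j (f * g) = partialDeriv j f * g + f * partialDeriv j g := by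
  obtain ⟨n, d, hd, rfl⟩ := exists_fraction f
  obtain ⟨n', d', hd', rfl⟩ := exists_fraction g
  have e := algebraMap_poly_ne_zero hd
  have e' := algebraMap_poly_ne_zero hd'
  rw [div_mul_div_comm, ← map_mul, ← map_mul,
    partialDeriv_div_algebraMap j _ (mul_ne_zero hd hd'), partialDeriv_div_algebraMap j _ hd,
    partialDeriv_div_algebraMap j _ hd']
  simp only [map_add, map_sub, map_mul, Derivation.leibniz, smul_eq_mul]
  field_simp
  ring

theorem partialDeriv_neg (j : Fin 4) (f : RatFun) : partialDeriv j (-f) = -partialDeriv j f := by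
  have h := partialDeriv_add j f (-f)
  rw [add_neg_cancel, partialDeriv_zero] at h
  linear_combination -h

theorem partialDeriv_sub (j : Fin 4) (f g : RatFun) :
    partialDeriv j (f - g) = partialDeriv j f - partialDeriv j g := by
  rw [sub_eq_add_neg, partialDeriv_add, partialDeriv_neg, ← sub_eq_add_neg]

theorem partialDeriv_inv (j : Fin 4) (f : RatFun) :
    partialDeriv j f⁻¹ = -partialDeriv j f / f ^ 2 := by
  by_cases hf : f = 0
  · rw [hf, inv_zero, partialDeriv_zero, neg_zero, zero_div]
  · have h := partialDeriv_mul j f f⁻¹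
    rw [mul_inv_cancel₀ hf, partialDeriv_one] at h
    field_simp at h ⊢
    linear_combination -h

/-- The orders of the form `dq₁ ∧ dq₂ ∧ dr₁ ∧ dr₂` along the boundary. -/
def ordJac : Comp → ℤ
  | Sum.inl _ | Sum.inr 6 | Sum.inr 11 => -2
  | Sum.inr 1 | Sum.inr 3 => 1
  | Sum.inr 2 | Sum.inr 4 | Sum.inr 7 | Sum.inr 9 => -1
  | Sum.inr 5 => 2
  | _ => 0

def unitJac : Comp → Ex
  | Sum.inl _ | Sum.inr 2 | Sum.inr 4 | Sum.inr 7 | Sum.inr 8 | Sum.inr 9 | Sum.inr 10 => (-1 : ℂ)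
  | Sum.inr 6 => 1 / (y₁ * y₁)
  | Sum.inr 11 => 1 / (y₃ * y₃)
  | Sum.inr 0 => 1 / ((y₂ * y₃ - 1) * (y₂ * y₃ - 1))
  | _ => 1

set_option maxHeartbeats 1000000 in
-- The exponents agree with the rule for blow-ups: `-2` for each coordinate at infinity, and the
-- codimension of the centre minus one for each blow-up, accumulated over infinitely near centres.
theorem det_jacobian (A : Params) (b : Comp) :
    (Matrix.of fun i j => partialDeriv j (chart A b i)).det =
      x (chartEq b) ^ ordJac b * (unitJac b).eval x := by
  have h0 := x_ne_zero 0
  have h1 := x_ne_zero 1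
  have h2 := x_ne_zero 2
  have h3 := x_ne_zero 3
  have h4 : x 2 * x 3 - 1 ≠ 0 := by simpa using (y₂ * y₃ - 1).ne_zero 0 (by simp) (by simp)
  have h5 : (Matrix.of fun i j => partialDeriv j (chart A b i)) =
      Matrix.of fun i j => partialDeriv j ((chartEx A b i).eval x) := by
    rw [← evals_chartEx]
    rfl
  rw [h5]
  rcases b with k | k <;> fin_cases k <;>
    simp [Matrix.det_succ_row_zero, Fin.sum_univ_succ, Fin.succAbove, chartEx, chartEq,
      partialDeriv_x, partialDeriv_κ, partialDeriv_add, partialDeriv_sub, partialDeriv_mul,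
      partialDeriv_inv, partialDeriv_one, ordJac, unitJac]
  all_goals field_simp

theorem ordAlong_det_jacobian (A : Params) (b : Comp) :
    ordAlong (X (chartEq b)) (Matrix.of fun i j => partialDeriv j (chart A b i)).det =
      ordJac b := by
  have hw := isOrd_ordAlong (irreducible_X (chartEq b))
  have hx := x_ne_zero (chartEq b)
  have h1 := x_ne_zero 1
  have h3 := x_ne_zero 3
  have hu : (unitJac b).Def (Function.update x (chartEq b) 0) := by
    rcases b with k | k <;> fin_cases k <;> simp [chartEq, unitJac, *]
  have hu' : (unitJac b).eval (Function.update x (chartEq b) 0) ≠ 0 := by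
    rcases b with k | k <;> fin_cases k <;> simp [chartEq, unitJac, *]
  rw [det_jacobian, hw.mul (zpow_ne_zero _ hx) ((Red.eval hu).ne_zero hu'), hw.zpow hx,
    (Red.eval hu).ordAlong_eq_zero hu', add_zero, show ordAlong (X (chartEq b)) (x (chartEq b)) = 1
    from ordAlong_self (irreducible_X (chartEq b)), mul_one]

end

section

/-! ## The Picard group -/

theorem sum_univ_twelve {M : Type*} [AddCommMonoid M] (f : Fin 12 → M) :
    ∑ k, f k = f 0 + f 1 + f 2 + f 3 + f 4 + f 5 + f 6 + f 7 + f 8 + f 9 + f 10 + f 11 := by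
  rw [Fin.sum_univ_castSucc, Fin.sum_univ_castSucc, Fin.sum_univ_castSucc, Fin.sum_univ_castSucc,
    Fin.sum_univ_eight]
  rfl

/-- The orders of the coordinate functions along the boundary. -/
def ordX : Fin 4 → Comp → ℤ := ![ordX₀, ordX₁, ordX₂, ordX₃]

theorem boundaryOrd_x {A : Params} (hA : A.Generic) (j : Fin 4) (b : Comp) :
    boundaryOrd A b (x j) = ordX j b := by
  fin_cases j
  · exact boundaryOrd_X₀ hA b
  · exact boundaryOrd_X₁ hA b
  · exact boundaryOrd_X₂ hA b
  · exact boundaryOrd_X₃ hA b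

theorem isOrd_of_mem {A : Params} {v : RatFun → ℤ} (hv : v ∈ primeDivisors A) : IsOrd v := by
  obtain ⟨p, hp, rfl⟩ | ⟨b, rfl⟩ := hv
  · exact isOrd_ordAlong hp
  · exact isOrd_boundaryOrd A b

theorem eq_of_ordAlong_x_pos {p : Poly} (hp : Irreducible p) {i j : Fin 4}
    (hi : 0 < ordAlong p (x i)) (hj : 0 < ordAlong p (x j)) : i = j := by
  have hi' : p ∣ X i := (ordAlong_pos_iff hp).1 hi
  have hj' : p ∣ X j := (ordAlong_pos_iff hp).1 hj
  have h := ((hp.dvd_irreducible_iff_associated (irreducible_X i)).1 hi').symm.dvd.trans hj'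
  exact X_dvd_X.1 h

/-- Along a hypersurface of `ℂ⁴` no coordinate has a pole and at most one vanishes. Each boundary
divisor violates one of these conditions. -/
theorem boundaryOrd_ne_ordAlong {A : Params} (hA : A.Generic) (b : Comp) {p : Poly}
    (hp : Irreducible p) : boundaryOrd A b ≠ ordAlong p := by
  intro h
  have h1 : (∃ j, ordX j b < 0) ∨ ∃ i j, i ≠ j ∧ 0 < ordX i b ∧ 0 < ordX j b := by
    clear h
    decide +revert
  simp only [← boundaryOrd_x hA, h] at h1
  rcases h1 with ⟨j, hj⟩ | ⟨i, j, hij, hi, hj⟩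
  · exact absurd (ordAlong_nonneg hp (g := X j)) (not_le.2 hj)
  · exact hij (eq_of_ordAlong_x_pos hp hi hj)

/-- Orders of coordinates cannot tell an infinitely near divisor such as `ℰ₁₂` from its parent. The
generators can: `sᵢ` sends moved divisors into `ℂ⁴` and keeps the others on the boundary. -/
theorem boundaryOrd_injective {A : Params} (hA : A.Generic) :
    Function.Injective (boundaryOrd A) := by
  have key : ∀ i {b c : Comp}, b ∈ moved i → c ∉ moved i → boundaryOrd A b ≠ boundaryOrd A c := by
    intro i b c hb hc h
    obtain ⟨p, hp, h1⟩ := boundaryOrd_comp_sPull_moved (hA.ne_zero i) hA.t_ne_zero hb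
    rw [h, boundaryOrd_comp_sPull hA.t_ne_zero i hc] at h1
    exact boundaryOrd_ne_ordAlong (hA.sParam i) c hp h1
  intro b c h
  have h1 : ∀ i, b ∈ moved i ↔ c ∈ moved i := fun i =>
    ⟨fun hb => by_contra fun hc => key i hb hc h, fun hc => by_contra fun hb => key i hc hb h.symm⟩
  have h2 : ∀ j, ordX j b = ordX j c := fun j => by
    rw [← boundaryOrd_x hA, ← boundaryOrd_x hA, h]
  -- The functions `q₁ - t` and `q₂ - 1` separate `ℰ₇` and `ℰ₉` from the hyperplanes `r₁ = ∞` and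
  -- `r₂ = ∞`.
  have h3 : ordTwo b = ordTwo c := by rw [← boundaryOrd_Two hA, ← boundaryOrd_Two hA, h]
  have h4 : ordFour b = ordFour c := by rw [← boundaryOrd_Four hA, ← boundaryOrd_Four hA, h]
  clear h key hA
  decide +revert

theorem boundaryDiv_boundary {A : Params} (hA : A.Generic) (b c : Comp) :
    boundaryDiv A b ⟨boundaryOrd A c, boundaryOrd_mem A c⟩ = if b = c then 1 else 0 := by
  classical
  rw [boundaryDiv, Finsupp.single_apply]
  exact if_congr (Subtype.ext_iff.trans (boundaryOrd_injective hA).eq_iff) rfl rfl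

theorem boundaryDiv_ordAlong {A : Params} (hA : A.Generic) (b : Comp) {p : Poly}
    (hp : Irreducible p) : boundaryDiv A b ⟨ordAlong p, ordAlong_mem A hp⟩ = 0 := by
  classical
  rw [boundaryDiv, Finsupp.single_apply, if_neg]
  exact fun h => boundaryOrd_ne_ordAlong hA b hp (congrArg Subtype.val h)

theorem sum_boundaryDiv_boundary {A : Params} (hA : A.Generic) (m : Comp → ℤ) (c : Comp) :
    (∑ b, m b • boundaryDiv A b) ⟨boundaryOrd A c, boundaryOrd_mem A c⟩ = m c := by
  rw [Finsupp.finsetSum_apply]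
  simp only [Finsupp.smul_apply, boundaryDiv_boundary hA, smul_eq_mul, mul_ite, mul_one, mul_zero,
    Finset.sum_ite_eq', Finset.mem_univ, if_true]

theorem sum_boundaryDiv_ordAlong {A : Params} (hA : A.Generic) (m : Comp → ℤ) {p : Poly}
    (hp : Irreducible p) : (∑ b, m b • boundaryDiv A b) ⟨ordAlong p, ordAlong_mem A hp⟩ = 0 := by
  rw [Finsupp.finsetSum_apply]
  simp only [Finsupp.smul_apply, boundaryDiv_ordAlong hA _ hp, smul_zero, Finset.sum_const_zero]

/-- The prime divisor of a hypersurface of `ℂ⁴`. -/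
def polyDiv (A : Params) {p : Poly} (hp : Irreducible p) : Div A :=
  Finsupp.single ⟨ordAlong p, ordAlong_mem A hp⟩ 1

/-- The class of the `b`-th prime divisor of the boundary. -/
def bd (A : Params) (b : Comp) : Pic A := QuotientAddGroup.mk (boundaryDiv A b)

theorem mk_sum_boundaryDiv (A : Params) (m : Comp → ℤ) :
    (QuotientAddGroup.mk (∑ b, m b • boundaryDiv A b) : Pic A) = ∑ b, m b • bd A b := by
  have h := map_sum (QuotientAddGroup.mk' (principal A)) (fun b => m b • boundaryDiv A b) Finset.univ
  simp only [map_zsmul] at h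
  exact h

/-- The divisor of `p` as a rational function is the hypersurface plus a part supported on the
boundary. -/
theorem mk_polyDiv {A : Params} (hA : A.Generic) {p : Poly} (hp : Irreducible p) :
    (QuotientAddGroup.mk (polyDiv A hp) : Pic A) =
      -∑ b, boundaryOrd A b (algebraMap Poly RatFun p) • bd A b := by
  rw [← mk_sum_boundaryDiv, eq_neg_iff_add_eq_zero, ← QuotientAddGroup.mk_add,
    QuotientAddGroup.eq_zero_iff]
  refine AddSubgroup.subset_closure ⟨algebraMap Poly RatFun p,
    algebraMap_poly_ne_zero hp.ne_zero, ?_⟩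
  classical
  rintro ⟨v, ⟨p', hp', rfl⟩ | ⟨b, rfl⟩⟩
  · rw [Finsupp.add_apply, sum_boundaryDiv_ordAlong hA _ hp', add_zero, polyDiv,
      Finsupp.single_apply]
    split_ifs with h
    · change _ = ordAlong p' _
      rw [← show ordAlong p = ordAlong p' from congrArg Subtype.val h, ordAlong_self hp]
    · change _ = ordAlong p' _
      rw [ordAlong_eq_zero hp']
      intro hdvd
      exact h (Subtype.ext (ordAlong_eq_of_dvd hp' hp hdvd).symm)
  · rw [Finsupp.add_apply, sum_boundaryDiv_boundary hA, polyDiv, Finsupp.single_apply, if_neg,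
      zero_add]
    exact fun h => (boundaryOrd_ne_ordAlong hA b hp).symm (congrArg Subtype.val h)

/-- Every hypersurface of `ℂ⁴` has a global equation, so the boundary generates. -/
theorem exists_sum_bd {A : Params} (hA : A.Generic) (D : Pic A) :
    ∃ m : Comp → ℤ, ∑ b, m b • bd A b = D := by
  have key : ∀ v : primeDivisors A, ∃ m : Comp → ℤ,
      ∑ b, m b • bd A b = (QuotientAddGroup.mk (Finsupp.single v 1) : Pic A) := by
    rintro ⟨v, ⟨p, hp, rfl⟩ | ⟨b, rfl⟩⟩
    · refine ⟨fun b => -boundaryOrd A b (algebraMap Poly RatFun p), ?_⟩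
      simp only [neg_smul, Finset.sum_neg_distrib]
      exact (mk_polyDiv hA hp).symm
    · refine ⟨fun c => if c = b then 1 else 0, ?_⟩
      simp only [ite_smul, one_zsmul, zero_zsmul, Finset.sum_ite_eq', Finset.mem_univ, if_true]
      rfl
  induction D using QuotientAddGroup.induction_on with
  | H D =>
    induction D using Finsupp.induction_linear with
    | zero => exact ⟨0, by simp⟩
    | add D D' h h' =>
      obtain ⟨m, hm⟩ := h
      obtain ⟨m', hm'⟩ := h'
      refine ⟨m + m', ?_⟩
      simp only [Pi.add_apply, add_zsmul, Finset.sum_add_distrib, hm, hm', QuotientAddGroup.mk_add]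
    | single v n =>
      obtain ⟨m, hm⟩ := key v
      refine ⟨n • m, ?_⟩
      rw [show Finsupp.single v n = n • Finsupp.single v (1 : ℤ) by simp,
        QuotientAddGroup.mk_zsmul, ← hm, Finset.smul_sum]
      simp only [Pi.smul_apply, smul_assoc]

theorem exists_of_mem_principal {A : Params} {D : Div A} (hD : D ∈ principal A) :
    ∃ f : RatFun, f ≠ 0 ∧ ∀ v : primeDivisors A, D v = v.1 f := by
  induction hD using AddSubgroup.closure_induction with
  | mem D h => exact h
  | zero => exact ⟨1, one_ne_zero, fun v => (isOrd_of_mem v.2).one.symm⟩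
  | add D D' _ _ h h' =>
    obtain ⟨f, hf, h⟩ := h
    obtain ⟨g, hg, h'⟩ := h'
    exact ⟨f * g, mul_ne_zero hf hg, fun v => by
      rw [Finsupp.add_apply, h, h', (isOrd_of_mem v.2).mul hf hg]⟩
  | neg D _ h =>
    obtain ⟨f, hf, h⟩ := h
    exact ⟨f⁻¹, inv_ne_zero hf, fun v => by
      rw [Finsupp.neg_apply, h, (isOrd_of_mem v.2).inv hf]⟩

/-- A rational function without zeros and poles on `ℂ⁴` is constant. -/
theorem exists_const {f : RatFun} (hf : f ≠ 0) (h : ∀ p : Poly, Irreducible p → ordAlong p f = 0) :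
    ∃ c : ℂ, c ≠ 0 ∧ f = κ c := by
  have hred := IsFractionRing.num_den_reduced Poly f
  have hn : IsUnit (IsFractionRing.num Poly f) := by
    by_contra hu
    obtain ⟨p, hp, hpn⟩ := WfDvdMonoid.exists_irreducible_factor hu (num_ne_zero hf)
    have hpd : ¬ p ∣ (IsFractionRing.den Poly f : Poly) := fun hpd => hp.not_isUnit (hred hpn hpd)
    have h1 := h p hp
    rw [ordAlong, multiplicity_eq_zero.2 hpd, Nat.cast_zero, sub_zero, Nat.cast_eq_zero,
      multiplicity_eq_zero] at h1
    exact h1 hpn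
  have hd : IsUnit (IsFractionRing.den Poly f : Poly) := by
    by_contra hu
    obtain ⟨p, hp, hpd⟩ := WfDvdMonoid.exists_irreducible_factor hu (den_ne_zero f)
    have hpn : ¬ p ∣ IsFractionRing.num Poly f := fun hpn => hp.not_isUnit (hred hpn hpd)
    have h1 := h p hp
    rw [ordAlong, multiplicity_eq_zero.2 hpn, Nat.cast_zero, zero_sub, neg_eq_zero,
      Nat.cast_eq_zero, multiplicity_eq_zero] at h1
    exact h1 hpd
  obtain ⟨a, ha, ha'⟩ := MvPolynomial.isUnit_iff_eq_C_of_isReduced.1 hn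
  obtain ⟨b, hb, hb'⟩ := MvPolynomial.isUnit_iff_eq_C_of_isReduced.1 hd
  refine ⟨a / b, div_ne_zero ha.ne_zero hb.ne_zero, ?_⟩
  rw [← num_div_den f, ha', hb', algebraMap_C, algebraMap_C, map_div₀]

theorem ordAlong_κ {p : Poly} (hp : Irreducible p) {c : ℂ} (hc : c ≠ 0) : ordAlong p (κ c) = 0 := by
  rw [← algebraMap_C]
  refine ordAlong_eq_zero hp fun h => hp.not_isUnit (isUnit_of_dvd_unit h ?_)
  exact (isUnit_iff_ne_zero.2 hc).map C

/-- A principal divisor supported on the boundary belongs to a function without zeros or poles on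
`ℂ⁴`; such a function is constant and has order zero everywhere. -/
theorem eq_zero_of_sum_bd {A : Params} (hA : A.Generic) {m : Comp → ℤ}
    (h : ∑ b, m b • bd A b = 0) : m = 0 := by
  rw [← mk_sum_boundaryDiv, QuotientAddGroup.eq_zero_iff] at h
  obtain ⟨f, hf, h⟩ := exists_of_mem_principal h
  obtain ⟨c, hc, rfl⟩ := exists_const hf fun p hp => by
    exact (h ⟨ordAlong p, ordAlong_mem A hp⟩).symm.trans (sum_boundaryDiv_ordAlong hA m hp)
  funext b
  rw [← sum_boundaryDiv_boundary hA m b, h]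
  exact (boundaryOrd_apply A b (κ c)).trans
    ((congrArg _ (AlgHom.commutes _ c)).trans (ordAlong_κ (irreducible_X _) hc))

end

/-! ### From prime divisors of the boundary to total transforms, and the anticanonical class -/

section

/-- The multiplicities of the total transforms of the exceptional divisors along the boundary. -/
def excMul (k : Fin 12) (b : Comp) : ℤ :=
  if b = Sum.inr k ∨ (k = 7 ∨ k = 9 ∨ k = 11) ∧ b = Sum.inr (k + 1) then 1 else 0

/-- The change of coordinates from total transforms to prime divisors. -/
def toBd (D : NSLattice) (b : Comp) : ℤ :=
  ∑ j, D (Sum.inl j) * max 0 (-ordX j b) + ∑ k, D (Sum.inr k) * excMul k b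

theorem mk_hyperplaneDiv {A : Params} (hA : A.Generic) (j : Fin 4) :
    (QuotientAddGroup.mk (hyperplaneDiv A j) : Pic A) = ∑ b, max 0 (-ordX j b) • bd A b := by
  rw [hyperplaneDiv, mk_sum_boundaryDiv]
  simp only [boundaryOrd_x hA]

theorem mk_exceptionalDiv (A : Params) (k : Fin 12) :
    (QuotientAddGroup.mk (exceptionalDiv A k) : Pic A) = ∑ b, excMul k b • bd A b := by
  have h1 : (∑ b, (if b = Sum.inr k then 1 else 0 : ℤ) • bd A b) = bd A (Sum.inr k) := by
    simp only [ite_smul, one_zsmul, zero_zsmul, Finset.sum_ite_eq', Finset.mem_univ, if_true]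
  have h2 : (∑ b, (if b = Sum.inr (k + 1) then 1 else 0 : ℤ) • bd A b) = bd A (Sum.inr (k + 1)) := by
    simp only [ite_smul, one_zsmul, zero_zsmul, Finset.sum_ite_eq', Finset.mem_univ, if_true]
  rw [exceptionalDiv]
  split_ifs with hk
  · rw [QuotientAddGroup.mk_add]
    refine (congrArg₂ (· + ·) h1 h2).symm.trans ?_
    rw [← Finset.sum_add_distrib]
    refine Finset.sum_congr rfl fun b _ => ?_
    rw [← add_zsmul]
    congr 1
    clear h1 h2
    revert hk
    decide +revert
  · rw [add_zero]
    refine h1.symm.trans (Finset.sum_congr rfl fun b _ => ?_)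
    simp only [excMul, hk, false_and, or_false]

theorem sum_zsmul' {ι G : Type*} [AddCommGroup G] (s : Finset ι) (f : ι → ℤ) (g : G) :
    (∑ i ∈ s, f i) • g = ∑ i ∈ s, f i • g :=
  map_sum (zmultiplesHom G g) f s

theorem toPic_eq {A : Params} (hA : A.Generic) (D : NSLattice) :
    toPic A D = ∑ b, toBd D b • bd A b := by
  simp only [toPic, mk_hyperplaneDiv hA, mk_exceptionalDiv, Finset.smul_sum, smul_smul]
  rw [Finset.sum_comm, Finset.sum_comm (s := (Finset.univ : Finset (Fin 12))),
    ← Finset.sum_add_distrib]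
  refine Finset.sum_congr rfl fun b _ => ?_
  rw [toBd, add_zsmul, sum_zsmul', sum_zsmul']

theorem toBd_inl (D : NSLattice) (j : Fin 4) : toBd D (Sum.inl j) = D (Sum.inl j) := by
  fin_cases j <;>
    simp [toBd, Fin.sum_univ_four, ordX, ordX₀, ordX₁, ordX₂, ordX₃, excMul]

/-- The matrix is unitriangular: the coefficient at each exceptional divisor is that of its own `ℰₖ`
plus contributions of the hyperplanes and of the centre below it. -/
theorem toBd_bijective : Function.Bijective toBd := by
  have h : ∀ D : NSLattice, toBd D = Sum.elim (fun j => D (Sum.inl j)) fun k =>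
      D (Sum.inr k) + ![D (Sum.inr 11) + D (Sum.inl 2) + D (Sum.inl 3), 0, D (Sum.inl 0), 0,
        D (Sum.inl 1), 0, D (Sum.inl 0) + D (Sum.inl 1), D (Sum.inl 2),
        D (Sum.inr 7) + D (Sum.inl 2), D (Sum.inl 3), D (Sum.inr 9) + D (Sum.inl 3),
        D (Sum.inl 2) + D (Sum.inl 3)] k := by
    intro D
    funext b
    rcases b with j | k
    · exact toBd_inl D j
    · fin_cases k <;>
        simp [toBd, sum_univ_twelve, Fin.sum_univ_four, ordX, ordX₀, ordX₁, ordX₂, ordX₃, excMul]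
          <;> ring
  constructor
  · intro D D' hD
    rw [h, h] at hD
    have e1 : ∀ j, D (Sum.inl j) = D' (Sum.inl j) := fun j => congrFun hD (Sum.inl j)
    have e2 := fun k => congrFun hD (Sum.inr k)
    have e7 := e2 7
    have e9 := e2 9
    have e11 := e2 11
    simp [e1] at e7 e9 e11
    funext b
    rcases b with j | k
    · exact e1 j
    · have e := e2 k
      fin_cases k <;> simpa [e1, e7, e9, e11] using e
  · intro c
    -- At `8`, `10` and `12` the correction is the whole coefficient at the parent divisor, which
    -- already contains the hyperplane contributions.
    refine ⟨Sum.elim (fun j => c (Sum.inl j)) fun k => c (Sum.inr k) -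
      ![c (Sum.inr 11), 0, c (Sum.inl 0), 0, c (Sum.inl 1), 0, c (Sum.inl 0) + c (Sum.inl 1),
        c (Sum.inl 2), c (Sum.inr 7), c (Sum.inl 3), c (Sum.inr 9),
        c (Sum.inl 2) + c (Sum.inl 3)] k, ?_⟩
    rw [h]
    funext b
    rcases b with j | k
    · rfl
    · fin_cases k <;> simp
      ring

theorem sum_bd_injective {A : Params} (hA : A.Generic) :
    Function.Injective fun m : Comp → ℤ => ∑ b, m b • bd A b := by
  intro m m' h
  refine sub_eq_zero.1 (eq_zero_of_sum_bd hA ?_)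
  simp only [Pi.sub_apply, sub_zsmul, ← sub_eq_add_neg, Finset.sum_sub_distrib]
  exact sub_eq_zero.2 h

theorem toPic_bijective {A : Params} (hA : A.Generic) : Function.Bijective (toPic A) := by
  have h : toPic A = (fun m : Comp → ℤ => ∑ b, m b • bd A b) ∘ toBd := funext (toPic_eq hA)
  rw [h]
  exact (show Function.Bijective _ from ⟨sum_bd_injective hA, exists_sum_bd hA⟩).comp toBd_bijective

theorem toBd_δ : ∀ b, toBd δ b = -ordJac b := by
  decide

theorem toPic_δ {A : Params} (hA : A.Generic) : toPic A δ = -canonicalClass A := by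
  rw [toPic_eq hA, canonicalClass, canonicalDiv]
  simp only [ordAlong_det_jacobian, mk_sum_boundaryDiv, toBd_δ, neg_zsmul, Finset.sum_neg_distrib]

theorem toPic_add (A : Params) (D D' : NSLattice) : toPic A (D + D') = toPic A D + toPic A D' := by
  simp only [toPic, Pi.add_apply, add_zsmul, Finset.sum_add_distrib]
  abel

theorem toPic_zsmul (A : Params) (n : ℤ) (D : NSLattice) : toPic A (n • D) = n • toPic A D := by
  simp only [toPic, Pi.smul_apply, smul_eq_mul, mul_zsmul, zsmul_add, Finset.smul_sum]

end

section

/-! ## Pullback by the generators -/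

theorem toPic_root_add {A : Params} (hA : A.Generic) {D : NSLattice} {b : Comp} {m : Comp → ℤ}
    (h : ∀ c, -m c = (if c = b then 1 else 0) + toBd D c) :
    -∑ c, m c • bd A c = bd A b + toPic A D := by
  rw [toPic_eq hA, ← Finset.sum_neg_distrib]
  simp only [← neg_zsmul, h, add_zsmul, Finset.sum_add_distrib, ite_smul, one_zsmul, zero_zsmul,
    Finset.sum_ite_eq', Finset.mem_univ, if_true]

/-- The geometric origin of the roots: `αᵢ` is the class of the hypersurface that `sᵢ` maps onto the
divisor `b`, minus the class of `b`. When two divisors are moved, both give the same `αᵢ`. -/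
theorem exists_ordAlong_comp_sPull_moved {A : Params} (hA : A.Generic) (i : Fin 6) {b : Comp}
    (hb : b ∈ moved i) :
    ∃ p : Poly, ∃ _ : Irreducible p, ordAlong p ∘ sPull i A = boundaryOrd (sParam i A) b ∧
      ∀ c, -boundaryOrd A c (algebraMap Poly RatFun p) =
        (if c = b then 1 else 0) + toBd (root i) c := by
  have ha := hA.ne_zero i
  have ht := hA.t_ne_zero
  rcases fin_six_cases i with rfl | rfl | rfl | rfl | rfl | rfl <;>
    simp only [moved, Finset.mem_singleton, Finset.mem_insert] at hb
  · subst hb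
    refine ⟨_, irreducible_graph (by simp), ordAlong_sPull_zero ha, fun c => ?_⟩
    rw [show algebraMap Poly RatFun (X 0 - X 1) = (y₀ - y₁ : Ex).eval x by simp [x],
      boundaryOrd_Zero hA]
    clear ha ht hA
    decide +revert
  · obtain rfl | rfl := hb
    · refine ⟨_, irreducible_add_const _ _, ordAlong_sPull_one_neg ha, fun c => ?_⟩
      rw [show algebraMap Poly RatFun (X 2 + C (A.a 1)) = (y₂ + A.a 1 : Ex).eval x by
        simp [x, algebraMap_C], boundaryOrd_One hA]
      clear ha ht hA
      decide +revert
    · refine ⟨_, irreducible_X 2, ordAlong_sPull_one_zero ha, fun c => ?_⟩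
      rw [show algebraMap Poly RatFun (X 2) = (y₂ : Ex).eval x by simp [x], boundaryOrd_X₂ hA]
      clear ha ht hA
      decide +revert
  · subst hb
    refine ⟨_, irreducible_sub_const _ _, ordAlong_sPull_two ha ht, fun c => ?_⟩
    rw [show algebraMap Poly RatFun (X 0 - C A.t) = (y₀ - A.t : Ex).eval x by
      simp [x, algebraMap_C], boundaryOrd_Two hA]
    clear ha ht hA
    decide +revert
  · obtain rfl | rfl := hb
    · refine ⟨_, irreducible_graph (by simp), ordAlong_sPull_three_zero ha, fun c => ?_⟩
      rw [show algebraMap Poly RatFun (X 2 - (C (-A.η) - X 3)) =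
        (y₂ + y₃ - ((0 : ℂ) - A.η) : Ex).eval x by simp [x, algebraMap_C]; ring,
        boundaryOrd_Three' hA]
      clear ha ht hA
      decide +revert
    · refine ⟨_, irreducible_graph (by simp), ordAlong_sPull_three ha, fun c => ?_⟩
      rw [show algebraMap Poly RatFun (X 2 - (C (A.a 3 - A.η) - X 3)) =
        (y₂ + y₃ - (A.a 3 - A.η) : Ex).eval x by simp [x, algebraMap_C]; ring,
        boundaryOrd_Three hA]
      clear ha ht hA
      decide +revert
  · subst hb
    refine ⟨_, irreducible_sub_const _ _, ordAlong_sPull_four ha, fun c => ?_⟩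
    rw [show algebraMap Poly RatFun (X 1 - C 1) = (y₁ - 1 : Ex).eval x by
      simp [x], boundaryOrd_Four hA]
    clear ha ht hA
    decide +revert
  · obtain rfl | rfl := hb
    · refine ⟨_, irreducible_add_const _ _, ordAlong_sPull_five_neg ha, fun c => ?_⟩
      rw [show algebraMap Poly RatFun (X 3 + C (A.a 5)) = (y₃ + A.a 5 : Ex).eval x by
        simp [x, algebraMap_C], boundaryOrd_Five hA]
      clear ha ht hA
      decide +revert
    · refine ⟨_, irreducible_X 3, ordAlong_sPull_five_zero ha, fun c => ?_⟩
      rw [show algebraMap Poly RatFun (X 3) = (y₃ : Ex).eval x by simp [x], boundaryOrd_X₃ hA]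
      clear ha ht hA
      decide +revert

theorem pull_bd {A : Params} (hA : A.Generic) (i : Fin 6)
    (h : IsPseudoIso A (sParam i A) (sPull i A)) (b : Comp) :
    h.pull (bd (sParam i A) b) = bd A b + if b ∈ moved i then toPic A (root i) else 0 := by
  rw [bd, h.pull_mk, boundaryDiv]
  split_ifs with hb
  · obtain ⟨p, hp, h1, h2⟩ := exists_ordAlong_comp_sPull_moved hA i hb
    rw [h.pullDiv_single (v := ⟨ordAlong p, ordAlong_mem A hp⟩) h1]
    exact (mk_polyDiv hA hp).trans (toPic_root_add hA h2)
  · rw [h.pullDiv_single (v := ⟨boundaryOrd A b, boundaryOrd_mem A b⟩)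
      (boundaryOrd_comp_sPull hA.t_ne_zero i hb), add_zero]
    rfl

/-- By linearity of `toBd` this is a check on the basis. It identifies the co-root with the
functional that sums the coefficients along the moved divisors. -/
theorem sum_moved (i : Fin 6) (D : NSLattice) :
    ∑ b ∈ moved i, toBd D b = pairing D (coroot i) := by
  have h : ∀ (d : Comp → ℤ), (∀ j, d (Sum.inl j) = ∑ b ∈ moved i, max 0 (-ordX j b)) →
      (∀ k, -d (Sum.inr k) = ∑ b ∈ moved i, excMul k b) →
      ∑ b ∈ moved i, toBd D b = pairing D d := by
    intro d h1 h2
    simp only [toBd, Finset.sum_add_distrib, pairing, h1, sub_eq_add_neg, ← Finset.sum_neg_distrib,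
      ← mul_neg, h2]
    rw [Finset.sum_comm, Finset.sum_comm (s := moved i)]
    simp only [Finset.mul_sum]
  refine h _ ?_ ?_
  · clear h
    decide +revert
  · clear h
    decide +revert

/-- Each moved class contributes one extra `αᵢ` and all other boundary classes are fixed, so the
total correction is `sum_moved` times `αᵢ`. -/
theorem pull_sPull {A : Params} (hA : A.Generic) (i : Fin 6)
    (h : IsPseudoIso A (sParam i A) (sPull i A)) (D : NSLattice) :
    h.pull (toPic (sParam i A) D) = toPic A (reflect i D) := by
  rw [toPic_eq (hA.sParam i), map_sum, reflect, toPic_add, toPic_zsmul, toPic_eq hA D,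
    ← sum_moved, sum_zsmul']
  simp only [map_zsmul, pull_bd hA, zsmul_add, Finset.sum_add_distrib, smul_ite, zsmul_zero,
    Finset.sum_ite_mem, Finset.univ_inter]

/-- A composition of generators is a pseudo-isomorphism, and acts by reflections. -/
theorem exists_pull_word {A : Params} (hA : A.Generic) (l : List (Fin 6)) :
    ∃ h : IsPseudoIso A (wordParam l A) (wordPull l A),
      ∀ D, h.pull (toPic (wordParam l A) D) = toPic A (wordReflect l D) := by
  induction l generalizing A with
  | nil => exact ⟨IsPseudoIso.refl A, fun D => IsPseudoIso.pull_refl _⟩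
  | cons i l ih =>
    obtain ⟨h, hD⟩ := ih (hA.sParam i)
    have h' := isPseudoIso_sPull (hA.ne_zero i) hA.t_ne_zero
    refine ⟨h'.trans h, fun D => ?_⟩
    exact (IsPseudoIso.pull_trans h' h _).trans ((congrArg h'.pull (hD D)).trans
      (pull_sPull hA i h' _))

theorem exists_pull_TPull {A : Params} (hA : A.Generic) (i : Fin 6) :
    ∃ h : IsPseudoIso A (TParam i A) (TPull i A),
      ∀ D, h.pull (toPic (TParam i A) D) = toPic A (kac i 1 D) := by
  obtain ⟨h, hD⟩ := exists_pull_word hA (translationWord i)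
  exact ⟨h, fun D => (hD D).trans (congrArg _ (wordReflect_translationWord i D))⟩

theorem exists_pull_TPullIter {A : Params} (hA : A.Generic) (i : Fin 6) (n : ℕ) :
    ∃ h : IsPseudoIso A ((TParam i)^[n] A) (TPullIter i n A),
      ∀ D, h.pull (toPic ((TParam i)^[n] A) D) = toPic A (kac i n D) := by
  induction n generalizing A with
  | zero =>
    refine ⟨IsPseudoIso.refl A, fun D => (IsPseudoIso.pull_refl _).trans (congrArg (toPic A) ?_)⟩
    simp [kac]
  | succ n ih =>
    obtain ⟨h, hD⟩ := ih (A := TParam i A) (hA.TParam_iterate i 1)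
    obtain ⟨h', hD'⟩ := exists_pull_TPull hA i
    refine ⟨h'.trans h, fun D => ?_⟩
    exact (IsPseudoIso.pull_trans h' h _).trans ((congrArg h'.pull (hD D)).trans
      ((hD' _).trans (congrArg _ (kac_one_kac i n D))))

end

section

/-! ## Degrees -/

/-- The polynomial `x k ^ d * p(…, (x k)⁻¹, …)`, where `d` is the degree of `p` in `x k`. -/
def reversal (k : Fin 4) (p : Poly) : Poly :=
  ∑ m ∈ p.support, monomial (m.update k (degreeOf k p - m k)) (p.coeff m)

theorem algebraMap_reversal (k : Fin 4) (p : Poly) : algebraMap Poly RatFun (reversal k p) =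
    x k ^ degreeOf k p * aeval (Function.update x k (x k)⁻¹) p := by
  rw [reversal, map_sum, aeval_def, eval₂_eq', Finset.mul_sum]
  refine Finset.sum_congr rfl fun m hm => ?_
  rw [algebraMap_eq_aeval, aeval_monomial, mul_left_comm, Finsupp.prod_fintype _ _ (by simp),
    ← Finset.mul_prod_erase _ _ (Finset.mem_univ k),
    ← Finset.mul_prod_erase _ (fun i => Function.update x k (x k)⁻¹ i ^ m i) (Finset.mem_univ k)]
  have hd : m k ≤ degreeOf k p := monomial_le_degreeOf k hm
  have h1 : ∀ i ∈ Finset.univ.erase k, x i ^ (m.update k (degreeOf k p - m k)) i =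
      Function.update x k (x k)⁻¹ i ^ m i := by
    intro i hi
    have hik := Finset.ne_of_mem_erase hi
    rw [Finsupp.update_apply, if_neg hik, Function.update_of_ne hik]
  rw [Finset.prod_congr rfl h1, Finsupp.update_apply, if_pos rfl, Function.update_self,
    ← mul_assoc (x k ^ degreeOf k p), inv_pow, pow_sub₀ _ (x_ne_zero k) hd]

/-- A monomial of top degree in `x k` loses this variable under reversal, and it cannot be
cancelled. -/
theorem not_X_dvd_reversal (k : Fin 4) {p : Poly} (hp : p ≠ 0) : ¬ X k ∣ reversal k p := by
  obtain ⟨m, hm, hmk⟩ : ∃ m ∈ p.support, m k = degreeOf k p := by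
    have h := Finset.exists_mem_eq_sup p.support (support_nonempty.2 hp) fun m => m k
    rw [← degreeOf_eq_sup] at h
    obtain ⟨m, hm, h⟩ := h
    exact ⟨m, hm, h.symm⟩
  rintro ⟨q, hq⟩
  have h0 : coeff (m.update k 0) (reversal k p) = 0 := by
    rw [hq, coeff_X_mul', if_neg]
    simp
  rw [reversal, coeff_sum, Finset.sum_eq_single m] at h0
  · rw [coeff_monomial, if_pos (by rw [hmk, Nat.sub_self])] at h0
    exact mem_support_iff.1 hm h0
  -- Reversal is injective on the exponents that occur, since these are bounded by the degree and
  -- the truncated subtraction is exact.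
  · intro m' hm' hne
    rw [coeff_monomial, if_neg]
    intro h
    refine hne (Finsupp.ext fun i => ?_)
    have hi := DFunLike.congr_fun h i
    rw [Finsupp.update_apply, Finsupp.update_apply] at hi
    split_ifs at hi with hik
    · subst hik
      have := monomial_le_degreeOf i hm'
      omega
    · exact hi
  · exact fun h => absurd hm h

/-- Minus the degree with respect to `x k` is the order along the hyperplane `x k = ∞`. -/
theorem boundaryOrd_inl (A : Params) (k : Fin 4) {p : Poly} (hp : p ≠ 0) :
    boundaryOrd A (Sum.inl k) (algebraMap Poly RatFun p) = -(degreeOf k p : ℤ) := by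
  have hdom : Dominant (chart A (Sum.inl k)) := evals_chartEx A (Sum.inl k) ▸ dominant_chart A _
  have hw := isOrd_ordAlong (irreducible_X k)
  have h1 : subst (chart A (Sum.inl k)) (algebraMap Poly RatFun p) =
      aeval (Function.update x k (x k)⁻¹) p := subst_algebraMap hdom p
  have h2 := algebraMap_reversal k p
  have hx : x k ^ degreeOf k p ≠ 0 := pow_ne_zero _ (x_ne_zero k)
  have h3 : aeval (Function.update x k (x k)⁻¹) p ≠ 0 := by
    intro h0
    rw [h0, mul_zero] at h2
    refine not_X_dvd_reversal k hp ?_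
    rw [(IsFractionRing.to_map_eq_zero_iff (R := Poly)).1 h2]
    exact dvd_zero _
  have h4 := congrArg (ordAlong (X k)) h2
  rw [ordAlong_eq_zero (irreducible_X k) (not_X_dvd_reversal k hp), hw.mul hx h3,
    hw.pow (x_ne_zero k), show ordAlong (X k) (x k) = 1 from ordAlong_self (irreducible_X k)] at h4
  change ordAlong (X k) (subst (chart A (Sum.inl k)) (algebraMap Poly RatFun p)) = _
  rw [h1]
  linarith

/-- The multiplicities of the divisor of poles of a coordinate. -/
theorem hyperplaneDiv_apply {A : Params} (hA : A.Generic) (j : Fin 4) (v : primeDivisors A) :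
    hyperplaneDiv A j v = max 0 (-v.1 (x j)) := by
  obtain ⟨v, ⟨p, hp, rfl⟩ | ⟨b, rfl⟩⟩ := v
  · refine (sum_boundaryDiv_ordAlong hA _ hp).trans (max_eq_left ?_).symm
    exact neg_nonpos.2 (ordAlong_nonneg hp (g := X j))
  · exact sum_boundaryDiv_boundary hA _ b

/-- The class of a divisor of poles. -/
theorem mk_poles {A : Params} (hA : A.Generic) {f : RatFun} {P : Div A}
    (hP : ∀ v : primeDivisors A, P v = max 0 (-v.1 f)) :
    (QuotientAddGroup.mk P : Pic A) = ∑ b, (max 0 (-boundaryOrd A b f) -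
      boundaryOrd A b (algebraMap Poly RatFun (IsFractionRing.den Poly f : Poly))) • bd A b := by
  rw [← mk_sum_boundaryDiv, ← sub_eq_zero, ← QuotientAddGroup.mk_sub, QuotientAddGroup.eq_zero_iff]
  -- In lowest terms the poles of `f` on `ℂ⁴` are exactly the zeros of its denominator. Subtracting
  -- the divisor of the denominator leaves a divisor on the boundary.
  refine AddSubgroup.subset_closure ⟨_, algebraMap_poly_ne_zero (den_ne_zero f), ?_⟩
  rintro ⟨v, ⟨p, hp, rfl⟩ | ⟨b, rfl⟩⟩
  · rw [Finsupp.sub_apply, sum_boundaryDiv_ordAlong hA _ hp, sub_zero, hP]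
    change max 0 (-ordAlong p f) = ordAlong p _
    rw [ordAlong_algebraMap hp (den_ne_zero f), ordAlong]
    by_cases hd : p ∣ (IsFractionRing.den Poly f : Poly)
    · have hn : ¬ p ∣ IsFractionRing.num Poly f := fun hn =>
        hp.not_isUnit (IsFractionRing.num_den_reduced Poly f hn hd)
      rw [multiplicity_eq_zero.2 hn]
      simp
    · rw [multiplicity_eq_zero.2 hd]
      simp
  · rw [Finsupp.sub_apply, sum_boundaryDiv_boundary hA, hP]
    exact sub_sub_cancel _ _

theorem toPic_H (A : Params) (j : Fin 4) :
    toPic A (H j) = QuotientAddGroup.mk (hyperplaneDiv A j) := by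
  have h1 : ∀ i, H j (Sum.inl i) = if i = j then 1 else 0 := fun i => by
    simp [H, Pi.single_apply]
  have h2 : ∀ k, H j (Sum.inr k) = 0 := fun k => by simp [H]
  simp only [toPic, h1, h2, ite_smul, one_zsmul, zero_zsmul, Finset.sum_ite_eq', Finset.mem_univ,
    if_true, Finset.sum_const_zero, add_zero]

/-- The degrees of the components of a pseudo-isomorphism are read off from its action on the
Picard group. -/
theorem degIn_eq {A B : Params} (hA : A.Generic) (hB : B.Generic) {φ : RatFun →ₐ[ℂ] RatFun}
    (h : IsPseudoIso A B φ) {j : Fin 4} {D : NSLattice} (hD : h.pull (toPic B (H j)) = toPic A D)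
    (k : Fin 4) : (degIn k (φ (x j)) : ℤ) = D (Sum.inl k) := by
  set f := φ (x j) with hf
  have hf0 : f ≠ 0 := h.apply_ne_zero (x_ne_zero j)
  -- Prime divisors correspond bijectively, so the polar divisor of `x j` pulls back exactly to that
  -- of `f`.
  have hP : ∀ v : primeDivisors A, h.pullDiv (hyperplaneDiv B j) v = max 0 (-v.1 f) := fun v => by
    rw [h.pullDiv_apply, hyperplaneDiv_apply hB, h.equiv_val]
  rw [toPic_H, h.pull_mk, mk_poles hA hP, toPic_eq hA] at hD
  have hb := congrFun (sum_bd_injective hA hD) (Sum.inl k)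
  have hv := isOrd_boundaryOrd A (Sum.inl k)
  have hn := algebraMap_poly_ne_zero (num_ne_zero hf0)
  have hd := algebraMap_poly_ne_zero (den_ne_zero f)
  have h1 : boundaryOrd A (Sum.inl k) f = -(degreeOf k (IsFractionRing.num Poly f) : ℤ) +
      degreeOf k (IsFractionRing.den Poly f : Poly) := by
    conv_lhs => rw [← num_div_den f]
    rw [hv.div hn hd, boundaryOrd_inl A k (num_ne_zero hf0), boundaryOrd_inl A k (den_ne_zero f)]
    ring
  rw [toBd_inl, h1, boundaryOrd_inl A k (den_ne_zero f)] at hb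
  -- The coefficient is `max 0 (deg num - deg den) + deg den`, which is the larger of the two
  -- degrees.
  rw [← hb, degIn]
  push_cast
  omega

theorem degIn_TPullIter {A : Params} (hA : A.Generic) (i : Fin 6) (j k : Fin 4) (n : ℕ) :
    (degIn k (TPullIter i n A (x j)) : ℤ) = kac i n (H j) (Sum.inl k) := by
  obtain ⟨h, hD⟩ := exists_pull_TPullIter hA i n
  exact degIn_eq hA (hA.TParam_iterate i n) h (hD _) k

open Asymptotics Filter in
theorem isTheta_quadratic {a : ℝ} (ha : a ≠ 0) (b c : ℝ) :
    (fun n : ℕ => a * (n : ℝ) ^ 2 + (b * n + c)) =Θ[atTop] fun n : ℕ => (n : ℝ) ^ 2 := by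
  have hn : Tendsto (fun n : ℕ => (n : ℝ)) atTop atTop := tendsto_natCast_atTop_atTop
  have h1 : (fun n : ℕ => b * (n : ℝ) + c) =o[atTop] fun n : ℕ => a * (n : ℝ) ^ 2 := by
    refine IsLittleO.const_mul_right ha (IsLittleO.add (IsLittleO.const_mul_left ?_ b) ?_)
    · simpa [Function.comp_def] using
        (isLittleO_pow_pow_atTop_of_lt (𝕜 := ℝ) (show 1 < 2 by norm_num)).comp_tendsto hn
    · refine isLittleO_const_left.2 (Or.inr ?_)
      simpa [Function.comp_def] using (tendsto_pow_atTop (α := ℝ) two_ne_zero).comp hn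
  exact (IsEquivalent.add_isLittleO IsEquivalent.refl h1).isTheta.trans
    ((isTheta_refl _ _).const_mul_left ha)

theorem isTheta_degIn {A : Params} (hA : A.Generic) (i : Fin 6) (j k : Fin 4) :
    (fun n : ℕ => (degIn k (TPullIter i n A (x j)) : ℝ)) =Θ[Filter.atTop]
      fun n : ℕ => (n : ℝ) ^ 2 := by
  -- Both factors equal `2` for every choice of variables.
  have hne : pairing (H j) coδ * δ (Sum.inl k) ≠ 0 := by
    clear hA
    decide +revert
  have h : ∀ n : ℕ, (degIn k (TPullIter i n A (x j)) : ℝ) =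
      ((pairing (H j) coδ * δ (Sum.inl k) : ℤ) : ℝ) * (n : ℝ) ^ 2 +
      (((pairing (H j) coδ * root i (Sum.inl k) + pairing (root i) (coroot i) / 2 *
        pairing (H j) (coroot i) * δ (Sum.inl k) : ℤ) : ℝ) * n + (H j (Sum.inl k) : ℤ)) := by
    intro n
    have h := degIn_TPullIter hA i j k n
    simp only [kac, Pi.add_apply, Pi.smul_apply, smul_eq_mul] at h
    have h' := congrArg (Int.cast : ℤ → ℝ) h
    rw [Int.cast_natCast] at h'
    rw [h']
    -- The integer quotient is made opaque so that the cast is not pushed through the division.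
    generalize pairing (root i) (coroot i) / 2 = e
    push_cast
    ring
  simp only [h]
  exact isTheta_quadratic (Int.cast_ne_zero.2 hne) _ _

end

end FST

end

open FST
theorem mainTheorem3 (A : Params) (hA : A.Generic) (i : Fin 6) :
    -- the Picard groups of all the varieties `𝒳_{Tⁿ(A)}`, and `δ = -K`
    (∀ n : ℕ, Function.Bijective (toPic ((TParam i)^[n] A)) ∧
      toPic ((TParam i)^[n] A) δ = -canonicalClass ((TParam i)^[n] A)) ∧
    -- `T` is a pseudo-isomorphism, and its action on the Picard group is a translation
    (∃ h : IsPseudoIso A (TParam i A) (TPull i A),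
      (∀ D : NSLattice, h.pull (toPic (TParam i A) D) =
        toPic A (D + pairing D coδ • root i +
          (pairing D coδ + pairing (root i) (coroot i) / 2 * pairing D (coroot i)) • δ)) ∧
      (∀ j : Fin 6, h.pull (toPic (TParam i A) (root j)) =
        toPic A (root j +
          (if j = i then 2 else if j = i + 1 ∨ j = i - 1 then -1 else 0 : ℤ) • δ))) ∧
    -- the iterates
    (∀ n : ℕ, ∃ h : IsPseudoIso A ((TParam i)^[n] A) (TPullIter i n A),
      ∀ D : NSLattice, h.pull (toPic ((TParam i)^[n] A) D) = toPic A (kac i n D)) ∧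
    -- the degrees
    (∀ (j k : Fin 4) (n : ℕ),
      (degIn k (TPullIter i n A (x j)) : ℤ) = kac i n (H j) (Sum.inl k)) ∧
    (∀ j k : Fin 4,
      (fun n : ℕ => (degIn k (TPullIter i n A (x j)) : ℝ)) =Θ[Filter.atTop]
        fun n : ℕ => (n : ℝ) ^ 2) := by
  refine ⟨fun n => ⟨toPic_bijective (hA.TParam_iterate i n), toPic_δ (hA.TParam_iterate i n)⟩, ?_,
    exists_pull_TPullIter hA i, degIn_TPullIter hA i, isTheta_degIn hA i⟩
  obtain ⟨h, hD⟩ := exists_pull_TPull hA i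
  refine ⟨h, fun D => (hD D).trans (congrArg (toPic A) ?_),
    fun j => (hD _).trans (congrArg (toPic A) ?_)⟩
  · simp [kac]
  -- Only the term with `⟨αⱼ, α̌ᵢ⟩` survives, multiplied by `-1`.
  · have h1 : pairing (root j) coδ = 0 := by
      clear h hD hA
      decide +revert
    rw [kac, h1, pairing_root_coroot_self, pairing_root_coroot, mul_zero, mul_zero, zero_smul,
      add_zero, zero_add]
    congr 2
    split_ifs <;> rfl
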